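/- Let $d\in\mathbb N$, $L_1>1$ and $L_2>0$. There is a constant $C$ depending only on $L_1,L_2,d$ such that the following holds. Let $k\ge 2$, and let $\pi,\rho$ be probability measures supported on $[0,1]^d$ with Lebesgue densities (also denoted $\pi,\rho$) in $C^k([0,1]^d)$ such that $$\|\pi\|_{C^k([0,1]^d)}\le L_1,\quad \|\rho\|_{C^k([0,1]^d)}\le L_1,\quad \inf_{[0,1]^d}\pi\ge L_2,\quad \inf_{[0,1]^d}\rho\ge L_2 .$$ Here $\|f\|_{C^k(S)}=\sup_{n\le k}\sup_{x\in S}\|D^nf(x)\|$, with the operator norm of multilinear maps. Let $T:[0,1]^d\to[0,1]^d$ be the Knothe--Rosenblatt map from $\pi$ to $\rho$: for $j=1,\dots,d$, $$T_j(x_1,\dots,x_j)=F_{\rho,j}\big(T_1(x),\dots,T_{j-1}(x),\,\cdot\,\big)^{-1}\big(F_{\pi,j}(x_1,\dots,x_j)\big),$$ where $F_{\mu,j}(x_1,\dots,x_{j-1},\cdot)$ is the distribution function on $[0,1]$ of the $j$-th coordinate under $\mu$ conditioned on the first $j-1$ coordinates being $x_1,\dots,x_{j-1}$. Let $f^\Delta:[0,1]^d\times[0,1]\to\mathbb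 R^d$ be the straight-line velocity field of $T$, i.e. $$f^\Delta\big((1-t)x+tT(x),\,t\big)=T(x)-x,\qquad x\in[0,1]^d,\ t\in[0,1].$$ Let $r\in\mathbb R$ and let $g=(g_1,\dots,g_d)\in C^2([0,1]^d\times[0,1],\mathbb R^d)$ satisfy $g_j(x,t)=h_j(x,t)\,x_j(1-x_j)$ with $h_j\in C^2([0,1]^d\times[0,1],\mathbb R)$ for all $j$, and $\|g\|_{C^2([0,1]^d\times[0,1])}\le r$. For a velocity field $f$ on $[0,1]^d\times[0,1]$ let $X_f(x,t)\in[0,1]^d$ denote its flow map, $X_f(x,t)=x+\int_0^t f(X_f(x,s),s)\,ds$ for $x\in[0,1]^d$, $t\in[0,1]$. Then $f^\Delta(\cdot,t)\in C^1([0,1]^d)$ for all $t\in[0,1]$, the norm below is finite, the flow maps of $f^\Delta$ and of $g$ exist and are unique on $[0,1]^d\times[0,1]$, $X_g(\cdot,1)_\sharp\pi$ and $X_{f^\Delta}(\cdot,1)_\sharp\pi$ are probability measures, and $$\mathrm{KL}\big(X_g(\cdot,1)_\sharp\pi\,\big\|\,X_{f^\Delta}(\cdot,1)_\sharp\pi\big)\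 \le\ C\,\|f^\Delta-g\|_{C^1}^2,\qquad \|f^\Delta-g\|_{C^1}:=\sup_{t\in[0,1]}\|f^\Delta(\cdot,t)-g(\cdot,t)\|_{C^1([0,1]^d)} .$$ The constant $C$ does not depend on $k$, $r$, $\pi$, $\rho$ or $g$. -/

import Mathlib

open MeasureTheory Set
open scoped ENNReal NNReal

namespace KRFlow

noncomputable section

/-- `ℝ^d` with the Euclidean norm. -/
abbrev E (d : ℕ) : Type := EuclideanSpace ℝ (Fin d)

/-- The unit cube `[0,1]^d`. -/
def cube (d : ℕ) : Set (E d) := {x | ∀ i, x i ∈ Icc (0 : ℝ) 1}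

/-- The space-time cylinder `[0,1]^d × [0,1]` inside `ℝ^d × ℝ` with its Euclidean norm. -/
def cylinder (d : ℕ) : Set (WithLp 2 (E d × ℝ)) :=
  {z | z.fst ∈ cube d ∧ z.snd ∈ Icc (0 : ℝ) 1}

/-- The (extended) `C^k` norm on `S`: `sup_{n ≤ k} sup_{x ∈ S} ‖D^n f(x)‖`, where `D^n` is the
Fréchet derivative (one-sided at boundary points of `S`) and `‖·‖` is the norm of multilinear
maps. It is only used for functions that are `C^k` on `S`. -/
def cNorm {X Y : Type*} [NormedAddCommGroup X] [NormedSpace ℝ X]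
    [NormedAddCommGroup Y] [NormedSpace ℝ Y] (k : ℕ) (S : Set X) (f : X → Y) : ℝ≥0∞ :=
  ⨆ (n : ℕ) (_ : n ≤ k) (x : X) (_ : x ∈ S), ‖iteratedFDerivWithin ℝ n f S x‖ₑ

/-- The probability measure `μ` has Lebesgue density `p` on `[0,1]^d` and vanishes outside,
`p ∈ C^k([0,1]^d)`, `‖p‖_{C^k} ≤ L₁` and `p ≥ L₂` on `[0,1]^d`.
(For `L₂ > 0` the support of such a `μ` is exactly `[0,1]^d`.) -/
structure RegularDensity {d : ℕ} (k : ℕ) (L₁ L₂ : ℝ) (μ : Measure (E d)) (p : E d → ℝ) :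
    Prop where
  isProbabilityMeasure : IsProbabilityMeasure μ
  eq_withDensity : μ = (volume.restrict (cube d)).withDensity (fun x => ENNReal.ofReal (p x))
  contDiffOn : ContDiffOn ℝ k p (cube d)
  norm_le : cNorm k (cube d) p ≤ ENNReal.ofReal L₁
  lower_bound : ∀ x ∈ cube d, L₂ ≤ p x

/-! ### The Knothe–Rosenblatt map (coordinates are numbered from `0`) -/

/-- `(x_0, …, x_{k-1}, t_k, …, t_{d-1})`. -/
def splice {d : ℕ} (k : ℕ) (x t : E d) : E d :=
  WithLp.toLp 2 fun i => if (i : ℕ) < k then x i else t i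

/-- `x` with its `i`-th coordinate replaced by `s`. -/
def setCoord {d : ℕ} (x : E d) (i : Fin d) (s : ℝ) : E d :=
  WithLp.toLp 2 (Function.update (WithLp.ofLp x) i s)

/-- The marginal density of the first `k` coordinates,
`∫_{[0,1]^{d-k}} p(x_0, …, x_{k-1}, t_k, …, t_{d-1}) d(t_k, …, t_{d-1})`. The integral is written
over all of `[0,1]^d`: the integrand does not depend on `t_0, …, t_{k-1}`, each of which
ranges over an interval of length one. -/
def marginal {d : ℕ} (p : E d → ℝ) (k : ℕ) (x : E d) : ℝ :=
  ∫ t in cube d, p (splice k x t)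

/-- The density at `s` of the `i`-th coordinate conditioned on the preceding ones being
`x_0, …, x_{i-1}`. -/
def condDensity {d : ℕ} (p : E d → ℝ) (i : Fin d) (x : E d) (s : ℝ) : ℝ :=
  marginal p (i + 1) (setCoord x i s) / marginal p i x

/-- The distribution function of the `i`-th coordinate conditioned on the preceding ones being
`x_0, …, x_{i-1}`. -/
def condCDF {d : ℕ} (p : E d → ℝ) (i : Fin d) (x : E d) (s : ℝ) : ℝ :=
  ∫ τ in (0 : ℝ)..s, condDensity p i x τ

/-- The recursion for the first `k` components of the Knothe–Rosenblatt map from the density `p`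
to the density `q`:
`T_k(x) = F_{q,k}(T_0(x), …, T_{k-1}(x), ·)⁻¹ (F_{p,k}(x_0, …, x_{k-1}, x_k))`,
the inverse being taken on `[0,1]`. Components not yet computed are set to `0`. -/
def krPartial {d : ℕ} (p q : E d → ℝ) : ℕ → E d → E d
  | 0, _ => 0
  | k + 1, x =>
    if h : k < d then
      setCoord (krPartial p q k x) ⟨k, h⟩
        (Function.invFunOn (condCDF q ⟨k, h⟩ (krPartial p q k x)) (Icc (0 : ℝ) 1)
          (condCDF p ⟨k, h⟩ x (x ⟨k, h⟩)))
    else krPartial p q k x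

/-- The Knothe–Rosenblatt map `T` on `[0,1]^d` from the density `p` to the density `q`. -/
def krMap {d : ℕ} (p q : E d → ℝ) (x : E d) : E d := krPartial p q d x

/-! ### Displacement interpolation and its velocity field -/

/-- The displacement interpolation `T_t(x) = (1 - t) x + t T(x)`. -/
def interp {d : ℕ} (T : E d → E d) (t : ℝ) (x : E d) : E d := (1 - t) • x + t • T x

/-- The straight-line velocity field of `T` on `[0,1]^d × [0,1]`, determined by
`f(T_t(x), t) = T(x) - x`: at `(y, t)` it is `T(x) - x` where `x ∈ [0,1]^d` and `T_t(x) = y`. -/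
def straightVelocity {d : ℕ} (T : E d → E d) (y : E d) (t : ℝ) : E d :=
  T (Function.invFunOn (interp T t) (cube d) y) - Function.invFunOn (interp T t) (cube d) y

/-- The velocity field `f^Δ` whose flow is the displacement interpolation of the
Knothe–Rosenblatt map from `p` to `q`. -/
def krVelocity {d : ℕ} (p q : E d → ℝ) : E d → ℝ → E d := straightVelocity (krMap p q)

/-! ### Flows of velocity fields on `[0,1]^d × [0,1]` -/

/-- `γ : [0,1] → [0,1]^d` solves `γ(t) = x + ∫_0^t f(γ(s), s) ds`. -/
structure IsTrajectory {d : ℕ} (f : E d → ℝ → E d) (x : E d) (γ : ℝ → E d) : Prop where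
  continuousOn : ContinuousOn γ (Icc 0 1)
  mem_cube : ∀ t ∈ Icc (0 : ℝ) 1, γ t ∈ cube d
  eq_integral : ∀ t ∈ Icc (0 : ℝ) 1, γ t = x + ∫ s in (0 : ℝ)..t, f (γ s) s

/-- From every point of `[0,1]^d` there is exactly one trajectory of `f` on the time
interval `[0,1]`. -/
def WellPosed {d : ℕ} (f : E d → ℝ → E d) : Prop :=
  ∀ x ∈ cube d, (∃ γ, IsTrajectory f x γ) ∧
    ∀ γ₁ γ₂, IsTrajectory f x γ₁ → IsTrajectory f x γ₂ → EqOn γ₁ γ₂ (Icc 0 1)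

/-- The flow map `X_f(x, t)`: the trajectory of `f` starting at `x`. -/
def flowMap {d : ℕ} (f : E d → ℝ → E d) (x : E d) : ℝ → E d :=
  Classical.epsilon (IsTrajectory f x)

/-- The time-one distribution `X_f(·, 1)_♯ μ`. -/
def pushforward {d : ℕ} (f : E d → ℝ → E d) (μ : Measure (E d)) : Measure (E d) :=
  μ.map (fun x => flowMap f x 1)

/-! ### The ansatz class and the distance of velocity fields -/

/-- The ansatz class `C^k_ansatz(r)`: fields on `[0,1]^d × [0,1]` with components
`g_j(x,t) = h_j(x,t) x_j (1 - x_j)`, `h_j ∈ C^k([0,1]^d × [0,1])`, that are of class `C²`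
with `‖g‖_{C²([0,1]^d × [0,1])} ≤ r`. -/
structure InAnsatz {d : ℕ} (k : ℕ) (r : ℝ) (g : E d → ℝ → E d) : Prop where
  factor : ∃ h : Fin d → WithLp 2 (E d × ℝ) → ℝ,
    (∀ j, ContDiffOn ℝ k (h j) (cylinder d)) ∧
    ∀ z ∈ cylinder d, ∀ j, g z.fst z.snd j = h j z * (z.fst j * (1 - z.fst j))
  contDiffOn : ContDiffOn ℝ 2 (fun z : WithLp 2 (E d × ℝ) => g z.fst z.snd) (cylinder d)
  norm_le : cNorm 2 (cylinder d) (fun z : WithLp 2 (E d × ℝ) => g z.fst z.snd)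
    ≤ ENNReal.ofReal r

/-- `‖f - g‖_{C^1([0,1]^d)}` for time-dependent fields: the supremum over `t ∈ [0,1]` of the
spatial norms `‖f(·,t) - g(·,t)‖_{C^1([0,1]^d)}`. -/
def c1Dist {d : ℕ} (f g : E d → ℝ → E d) : ℝ≥0∞ :=
  ⨆ (t : ℝ) (_ : t ∈ Icc (0 : ℝ) 1), cNorm 1 (cube d) (fun x => f x t - g x t)

end

end KRFlow

/-!
For a density `p` on the cube, the conditional distribution functions `F_{p,j}` assemble into a
triangular map `R_p` of the cube, and the Knothe–Rosenblatt map satisfies `R_q ∘ T = R_p`. Hence `T`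
is triangular, and its derivatives and the lower bounds on its diagonal derivatives `∂_i T_i` are
controlled by `L₁`, `L₂` and `d` alone. Triangularity with positive diagonal survives the
interpolation `T_t = (1 - t) id + t T`, so the maps `T_t` are uniformly bi-Lipschitz bijections of
the cube; this bounds `f^Δ` in `C¹`. Along the line `t ↦ T_t x`,
`div f^Δ (T_t x, t) = ∑ i, d/dt log (1 - t + t ∂_i T_i x)`, so that `div f^Δ(·, t)` is Lipschitz as
well: it only involves the diagonal derivatives, which are quotients of conditional densities and
therefore one derivative smoother than a general first derivative of `f^Δ`.

Let `δ = ‖f^Δ - g‖_{C¹}`. By Gronwall the flows of `f^Δ` and `g` stay within `O(δ)` of each other,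
and by Liouville's formula the logarithms of their Jacobian determinants, the integrals of the
divergences along trajectories, differ by `O(δ)`. By the change of variables formula the two
pushforwards of `π` then have a density ratio whose logarithm is `O(δ)` everywhere, and the
Kullback–Leibler divergence is quadratic in the logarithm of the ratio.
-/

namespace KRFlow

section Calculus

variable {X Y : Type*} [NormedAddCommGroup X] [NormedSpace ℝ X] [NormedAddCommGroup Y]
  [NormedSpace ℝ Y]

theorem one_sub_mem_Icc {t : ℝ} (ht : t ∈ Icc (0 : ℝ) 1) : 1 - t ∈ Icc (0 : ℝ) 1 :=
  ⟨sub_nonneg.2 ht.2, sub_le_self 1 ht.1⟩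

theorem hasDerivWithinAt_comp_one_sub {u : ℝ → X} {u' : X} {t : ℝ}
    (h : HasDerivWithinAt u u' (Icc 0 1) (1 - t)) :
    HasDerivWithinAt (fun s => u (1 - s)) (-u') (Icc 0 1) t := by
  have := h.scomp t (((hasDerivAt_id t).const_sub 1).hasDerivWithinAt (s := Icc 0 1))
    fun s hs => one_sub_mem_Icc hs
  simpa [Function.comp_def] using this

theorem hasDerivWithinAt_Ici_of_Icc {u : ℝ → X} {u' : X} {a b t : ℝ}
    (h : HasDerivWithinAt u u' (Icc a b) t) (ht : t ∈ Ico a b) : HasDerivWithinAt u u' (Ici t) t :=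
  h.mono_of_mem_nhdsWithin (Icc_mem_nhdsGE_of_mem ht)

theorem gronwallBound_le_mul_exp {δ K ε t : ℝ} (hδ : 0 ≤ δ) (hK : 0 ≤ K) (hε : 0 ≤ ε)
    (ht : t ∈ Icc (0 : ℝ) 1) : gronwallBound δ K ε t ≤ (δ + ε) * Real.exp K := by
  rcases hK.eq_or_lt with rfl | hpos
  · simpa [gronwallBound_K0] using mul_le_of_le_one_right hε ht.2
  · have exp_sub_one_le : Real.exp K - 1 ≤ K * Real.exp K := by
      have h := mul_le_mul_of_nonneg_right (Real.add_one_le_exp (-K)) (Real.exp_pos K).le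
      rw [← Real.exp_add, neg_add_cancel, Real.exp_zero] at h
      linarith
    have exp_le : Real.exp (K * t) ≤ Real.exp K :=
      Real.exp_le_exp.2 (mul_le_of_le_one_right hK ht.2)
    rw [gronwallBound_of_K_ne_0 hpos.ne', add_mul]
    refine add_le_add (mul_le_mul_of_nonneg_left exp_le hδ) ?_
    rw [div_mul_eq_mul_div, div_le_iff₀ hpos, mul_assoc]
    exact mul_le_mul_of_nonneg_left (by linarith) hε

theorem norm_le_of_norm_hasDerivWithinAt_le {u u' : ℝ → X} {K ε : ℝ} (hK : 0 ≤ K) (hε : 0 ≤ ε)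
    (hu : ∀ t ∈ Icc (0 : ℝ) 1, HasDerivWithinAt u (u' t) (Icc 0 1) t)
    (hu' : ∀ t ∈ Icc (0 : ℝ) 1, ‖u' t‖ ≤ K * ‖u t‖ + ε) {t : ℝ} (ht : t ∈ Icc (0 : ℝ) 1) :
    ‖u t‖ ≤ (‖u 0‖ + ε) * Real.exp K := by
  have h := norm_le_gronwallBound_of_norm_deriv_right_le
    (fun s hs => (hu s hs).continuousWithinAt)
    (fun s hs => hasDerivWithinAt_Ici_of_Icc (hu s (Ico_subset_Icc_self hs)) hs) le_rfl
    (fun s hs => hu' s (Ico_subset_Icc_self hs)) t ht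
  rw [sub_zero] at h
  exact h.trans (gronwallBound_le_mul_exp (norm_nonneg _) hK hε ht)

theorem nonpos_of_deriv_nonpos_of_pos {u u' : ℝ → ℝ} (h0 : u 0 ≤ 0)
    (hu : ∀ t ∈ Icc (0 : ℝ) 1, HasDerivWithinAt u (u' t) (Icc 0 1) t)
    (hu' : ∀ t ∈ Icc (0 : ℝ) 1, 0 < u t → u' t ≤ 0) {t : ℝ} (ht : t ∈ Icc (0 : ℝ) 1) :
    u t ≤ 0 := by
  refine le_of_forall_pos_le_add fun ε hε => ?_
  have barrier_le : u t ≤ ε / 2 * (1 + t) :=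
    image_le_of_deriv_right_lt_deriv_boundary (a := 0) (b := 1)
      (B := fun s => ε / 2 * (1 + s)) (B' := fun _ => ε / 2)
      (fun s hs => (hu s hs).continuousWithinAt)
      (fun s hs => hasDerivWithinAt_Ici_of_Icc (hu s (Ico_subset_Icc_self hs)) hs)
      (by linarith)
      (fun s => by simpa using ((hasDerivAt_id s).const_add 1).const_mul (ε / 2))
      (fun s hs heq => by
        have hpos : 0 < u s := by rw [heq]; nlinarith [hs.1]
        exact (hu' s (Ico_subset_Icc_self hs) hpos).trans_lt (half_pos hε)) ht
  nlinarith [ht.2]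

/-- The radial retraction of a normed space onto its closed unit ball. -/
noncomputable def radialRetraction (x : X) : X := (max 1 ‖x‖)⁻¹ • x

theorem norm_radialRetraction (x : X) : ‖radialRetraction x‖ = (max 1 ‖x‖)⁻¹ * ‖x‖ := by
  rw [radialRetraction, norm_smul, norm_inv,
    Real.norm_of_nonneg (zero_le_one.trans (le_max_left _ _))]

theorem norm_radialRetraction_le_one (x : X) : ‖radialRetraction x‖ ≤ 1 :=
  (norm_radialRetraction x).trans_le
    (inv_mul_le_one_of_le₀ (le_max_right _ _) (zero_le_one.trans (le_max_left _ _)))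

theorem norm_radialRetraction_le (x : X) : ‖radialRetraction x‖ ≤ ‖x‖ :=
  (norm_radialRetraction x).trans_le
    (mul_le_of_le_one_left (norm_nonneg _) (inv_le_one_of_one_le₀ (le_max_left _ _)))

theorem radialRetraction_of_norm_le_one {x : X} (hx : ‖x‖ ≤ 1) : radialRetraction x = x := by
  rw [radialRetraction, max_eq_left hx, inv_one, one_smul]

theorem lipschitzWith_radialRetraction : LipschitzWith 2 (radialRetraction : X → X) := by
  refine LipschitzWith.of_dist_le_mul fun x y => ?_
  rw [dist_eq_norm, dist_eq_norm, radialRetraction, radialRetraction]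
  have hx : 0 < max 1 ‖x‖ := zero_lt_one.trans_le (le_max_left _ _)
  have hy : 0 < max 1 ‖y‖ := zero_lt_one.trans_le (le_max_left _ _)
  have abs_sub_le : |max 1 ‖y‖ - max 1 ‖x‖| ≤ ‖x - y‖ := by
    refine (abs_max_sub_max_le_max _ _ _ _).trans (max_le (by simp) ?_)
    rw [norm_sub_rev]
    exact abs_norm_sub_norm_le y x
  have split : (max 1 ‖x‖)⁻¹ • x - (max 1 ‖y‖)⁻¹ • y =
      (max 1 ‖x‖)⁻¹ • ((x - y) + ((max 1 ‖y‖ - max 1 ‖x‖) * (max 1 ‖y‖)⁻¹) • y) := by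
    rw [smul_add, smul_smul, smul_sub, sub_mul, mul_inv_cancel₀ hy.ne', mul_sub,
      inv_mul_cancel_left₀ hx.ne', sub_smul, mul_one]
    abel
  have norm_second_le : ‖((max 1 ‖y‖ - max 1 ‖x‖) * (max 1 ‖y‖)⁻¹) • y‖ ≤ ‖x - y‖ := by
    rw [norm_smul, Real.norm_eq_abs, abs_mul, abs_of_pos (inv_pos.2 hy), mul_assoc]
    refine (mul_le_of_le_one_right (abs_nonneg _) ?_).trans abs_sub_le
    exact inv_mul_le_one_of_le₀ (le_max_right _ _) hy.le
  rw [split, norm_smul, norm_inv, Real.norm_of_nonneg hx.le]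
  refine (mul_le_of_le_one_left (norm_nonneg _) (inv_le_one_of_one_le₀ (le_max_left _ _))).trans ?_
  refine (norm_add_le _ _).trans ?_
  rw [NNReal.coe_ofNat, two_mul]
  gcongr

end Calculus

/-- A curve in `S` that starts at `x` and whose velocity at each time `t ∈ [0,1]` is `f (γ t) t`:
the differential form of the integral equation in `IsTrajectory`. -/
structure IsSolutionIn {X : Type*} [NormedAddCommGroup X] [NormedSpace ℝ X] (S : Set X)
    (f : X → ℝ → X) (x : X) (γ : ℝ → X) : Prop where
  initial : γ 0 = x
  mem : ∀ t ∈ Icc (0 : ℝ) 1, γ t ∈ S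
  hasDerivWithinAt : ∀ t ∈ Icc (0 : ℝ) 1, HasDerivWithinAt γ (f (γ t) t) (Icc 0 1) t

section Solutions

variable {X : Type*} [NormedAddCommGroup X] [NormedSpace ℝ X] {S : Set X} {f g : X → ℝ → X}
  {x y : X} {γ η : ℝ → X} {K : ℝ≥0}

namespace IsSolutionIn

theorem continuousOn (h : IsSolutionIn S f x γ) : ContinuousOn γ (Icc 0 1) := fun t ht =>
  (h.hasDerivWithinAt t ht).continuousWithinAt

theorem reverse (h : IsSolutionIn S f x γ) :
    IsSolutionIn S (fun z t => -f z (1 - t)) (γ 1) fun t => γ (1 - t) where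
  initial := by simp
  mem t ht := h.mem _ (one_sub_mem_Icc ht)
  hasDerivWithinAt t ht := hasDerivWithinAt_comp_one_sub (h.hasDerivWithinAt _ (one_sub_mem_Icc ht))

theorem norm_sub_le_of_norm_field_sub_le {ε : ℝ} (hε : 0 ≤ ε)
    (hK : ∀ t ∈ Icc (0 : ℝ) 1, LipschitzOnWith K (fun z => f z t) S)
    (hfg : ∀ t ∈ Icc (0 : ℝ) 1, ∀ z ∈ S, ‖f z t - g z t‖ ≤ ε) (hγ : IsSolutionIn S f x γ)
    (hη : IsSolutionIn S g y η) {t : ℝ} (ht : t ∈ Icc (0 : ℝ) 1) :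
    ‖γ t - η t‖ ≤ (‖x - y‖ + ε) * Real.exp K := by
  rw [← hγ.initial, ← hη.initial]
  refine norm_le_of_norm_hasDerivWithinAt_le K.coe_nonneg hε
    (fun s hs => (hγ.hasDerivWithinAt s hs).sub (hη.hasDerivWithinAt s hs)) (fun s hs => ?_) ht
  calc ‖f (γ s) s - g (η s) s‖
      ≤ ‖f (γ s) s - f (η s) s‖ + ‖f (η s) s - g (η s) s‖ := norm_sub_le_norm_sub_add_norm_sub ..
    _ ≤ K * ‖γ s - η s‖ + ε :=
      add_le_add ((hK s hs).norm_sub_le (hγ.mem s hs) (hη.mem s hs)) (hfg s hs _ (hη.mem s hs))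

theorem norm_sub_le (hK : ∀ t ∈ Icc (0 : ℝ) 1, LipschitzOnWith K (fun z => f z t) S)
    (hγ : IsSolutionIn S f x γ) (hη : IsSolutionIn S f y η) {t : ℝ} (ht : t ∈ Icc (0 : ℝ) 1) :
    ‖γ t - η t‖ ≤ ‖x - y‖ * Real.exp K := by
  simpa using norm_sub_le_of_norm_field_sub_le le_rfl hK (by simp) hγ hη ht

theorem eqOn (hK : ∀ t ∈ Icc (0 : ℝ) 1, LipschitzOnWith K (fun z => f z t) S)
    (hγ : IsSolutionIn S f x γ) (hη : IsSolutionIn S f x η) : EqOn γ η (Icc 0 1) := fun t ht => by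
  simpa [sub_eq_zero] using norm_sub_le hK hγ hη ht

theorem eqOn_of_eq_at_one (hK : ∀ t ∈ Icc (0 : ℝ) 1, LipschitzOnWith K (fun z => f z t) S)
    (hγ : IsSolutionIn S f x γ) (hη : IsSolutionIn S f y η) (h : γ 1 = η 1) :
    EqOn γ η (Icc 0 1) := fun t ht => by
  have := eqOn (fun t ht => (hK _ (one_sub_mem_Icc ht)).neg) hγ.reverse (h ▸ hη.reverse)
    (one_sub_mem_Icc ht)
  simpa only [sub_sub_cancel] using this

end IsSolutionIn

variable [CompleteSpace X]

theorem exists_isSolutionIn_univ_of_bounded {L : ℝ≥0}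
    (hK : ∀ t ∈ Icc (0 : ℝ) 1, LipschitzWith K fun z => f z t)
    (hc : ∀ z, ContinuousOn (f z) (Icc 0 1)) (hL : ∀ t ∈ Icc (0 : ℝ) 1, ∀ z, ‖f z t‖ ≤ L) (x : X) :
    ∃ γ, IsSolutionIn univ f x γ := by
  have hp : IsPicardLindelof (fun t z => f z t) (⟨0, by simp⟩ : Icc (0 : ℝ) 1) x L 0 L K :=
    { lipschitzOnWith := fun t ht => (hK t ht).lipschitzOnWith
      continuousOn := fun z _ => hc z
      norm_le := fun t ht z _ => hL t ht z
      mul_max_le := by simp }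
  obtain ⟨γ, hγ0, hγ⟩ := hp.exists_eq_forall_mem_Icc_hasDerivWithinAt₀
  exact ⟨γ, hγ0, fun _ _ => mem_univ _, hγ⟩

/- A linear field is made bounded by a radial retraction onto a ball which, by Gronwall's
inequality, the solution never leaves. By linearity, we may rescale so that this is the unit
ball. -/
theorem exists_isSolutionIn_univ_linear {A : ℝ → X →L[ℝ] X} (hA : ContinuousOn A (Icc 0 1))
    (x : X) : ∃ γ, IsSolutionIn univ (fun z t => A t z) x γ := by
  obtain ⟨K, hK⟩ := isCompact_Icc.exists_bound_of_continuousOn hA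
  have hK0 : 0 ≤ K := (norm_nonneg _).trans (hK 0 (by simp))
  set R : ℝ := (1 + ‖x‖) * Real.exp K with hR
  have hRpos : 0 < R := by positivity
  obtain ⟨γ, hγ0, -, hγ⟩ := exists_isSolutionIn_univ_of_bounded
    (f := fun z t => A t (radialRetraction z)) (K := K.toNNReal * 2) (L := K.toNNReal)
    (fun t ht => ((A t).lipschitzWith_of_opNorm_le
      ((hK t ht).trans (Real.le_coe_toNNReal K))).comp lipschitzWith_radialRetraction)
    (fun z => hA.clm_apply continuousOn_const)
    (fun t ht z => by simpa [hK0] using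
      (A t).le_of_opNorm_le_of_le (hK t ht) (norm_radialRetraction_le_one z)) (R⁻¹ • x)
  have norm_field_le : ∀ t ∈ Icc (0 : ℝ) 1, ‖A t (radialRetraction (γ t))‖ ≤ K * ‖γ t‖ + 0 :=
    fun t ht => by
      simpa using (A t).le_of_opNorm_le_of_le (hK t ht) (norm_radialRetraction_le (γ t))
  have norm_le_one : ∀ t ∈ Icc (0 : ℝ) 1, ‖γ t‖ ≤ 1 := fun t ht => by
    refine (norm_le_of_norm_hasDerivWithinAt_le hK0 le_rfl hγ norm_field_le ht).trans ?_
    rw [hγ0, add_zero, norm_smul, norm_inv, Real.norm_of_nonneg hRpos.le, mul_assoc,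
      inv_mul_le_one₀ hRpos, hR]
    gcongr
    linarith
  refine ⟨fun t => R • γ t, by simp [hγ0, hRpos.ne'], fun _ _ => mem_univ _, fun t ht => ?_⟩
  have := (hγ t ht).const_smul R
  rwa [radialRetraction_of_norm_le_one (norm_le_one t ht), ← map_smul] at this

theorem exists_fundamental_solution {A : ℝ → X →L[ℝ] X} (hA : ContinuousOn A (Icc 0 1)) :
    ∃ M : ℝ → X →L[ℝ] X, M 0 = ContinuousLinearMap.id ℝ X ∧
      ∀ t ∈ Icc (0 : ℝ) 1, HasDerivWithinAt M ((A t).comp (M t)) (Icc 0 1) t := by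
  obtain ⟨M, hM0, -, hM⟩ := exists_isSolutionIn_univ_linear
    ((ContinuousLinearMap.compL ℝ X X X).continuous.comp_continuousOn hA)
    (ContinuousLinearMap.id ℝ X)
  exact ⟨M, hM0, hM⟩

end Solutions

/-- A time-dependent vector field on `S × [0,1]` that is jointly continuous and has a jointly
continuous spatial derivative. Nothing is asked of the derivative in time. -/
structure IsSpatiallyC1On {X : Type*} [NormedAddCommGroup X] [NormedSpace ℝ X] (S : Set X)
    (f : X → ℝ → X) : Prop where
  continuousOn : ContinuousOn (fun z : X × ℝ => f z.1 z.2) (S ×ˢ Icc 0 1)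
  differentiableOn : ∀ t ∈ Icc (0 : ℝ) 1, DifferentiableOn ℝ (fun x => f x t) S
  continuousOn_fderivWithin :
    ContinuousOn (fun z : X × ℝ => fderivWithin ℝ (fun x => f x z.2) S z.1) (S ×ˢ Icc 0 1)

namespace IsSpatiallyC1On

variable {X : Type*} [NormedAddCommGroup X] [NormedSpace ℝ X] {S : Set X} {f : X → ℝ → X}

theorem exists_norm_fderivWithin_le (h : IsSpatiallyC1On S f) (hS : IsCompact S) :
    ∃ K : ℝ≥0, ∀ t ∈ Icc (0 : ℝ) 1, ∀ x ∈ S, ‖fderivWithin ℝ (fun y => f y t) S x‖ ≤ K := by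
  obtain ⟨K, hK⟩ :=
    (hS.prod isCompact_Icc).exists_bound_of_continuousOn h.continuousOn_fderivWithin
  exact ⟨K.toNNReal, fun t ht x hx => (hK (x, t) ⟨hx, ht⟩).trans (Real.le_coe_toNNReal K)⟩

theorem lipschitzOnWith (h : IsSpatiallyC1On S f) (hc : Convex ℝ S) {K : ℝ≥0} {t : ℝ}
    (ht : t ∈ Icc (0 : ℝ) 1) (hK : ∀ x ∈ S, ‖fderivWithin ℝ (fun y => f y t) S x‖ ≤ K) :
    LipschitzOnWith K (fun x => f x t) S :=
  hc.lipschitzOnWith_of_nnnorm_fderivWithin_le (h.differentiableOn t ht) hK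

theorem exists_lipschitzOnWith (h : IsSpatiallyC1On S f) (hS : IsCompact S) (hc : Convex ℝ S) :
    ∃ K : ℝ≥0, ∀ t ∈ Icc (0 : ℝ) 1, LipschitzOnWith K (fun x => f x t) S := by
  obtain ⟨K, hK⟩ := h.exists_norm_fderivWithin_le hS
  exact ⟨K, fun t ht => h.lipschitzOnWith hc ht (hK t ht)⟩

theorem exists_norm_sub_sub_fderivWithin_le (h : IsSpatiallyC1On S f) (hS : IsCompact S)
    (hc : Convex ℝ S) {ε : ℝ} (hε : 0 < ε) :
    ∃ δ > 0, ∀ t ∈ Icc (0 : ℝ) 1, ∀ x ∈ S, ∀ y ∈ S, ‖y - x‖ < δ →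
      ‖f y t - f x t - fderivWithin ℝ (fun z => f z t) S x (y - x)‖ ≤ ε * ‖y - x‖ := by
  obtain ⟨δ, hδ, hfδ⟩ := Metric.uniformContinuousOn_iff.1
    ((hS.prod isCompact_Icc).uniformContinuousOn_of_continuous h.continuousOn_fderivWithin) ε hε
  refine ⟨δ, hδ, fun t ht x hx y hy hxy => ?_⟩
  have hsub : segment ℝ x y ⊆ S := hc.segment_subset hx hy
  refine (convex_segment x y).norm_image_sub_le_of_norm_hasFDerivWithin_le'
    (fun z hz => (h.differentiableOn t ht z (hsub hz)).hasFDerivWithinAt.mono hsub)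
    (fun z hz => ?_) (left_mem_segment ℝ x y) (right_mem_segment ℝ x y)
  rw [← dist_eq_norm]
  refine (hfδ (z, t) ⟨hsub hz, ht⟩ (x, t) ⟨hx, ht⟩ ?_).le
  rw [dist_prod_same_right, dist_eq_norm]
  exact (norm_sub_le_of_mem_segment hz).trans_lt hxy

section FlowDerivative

variable {Φ : X → ℝ → X} {x : X} {M : ℝ → X →L[ℝ] X}

theorem norm_solution_sub_sub_fundamental_le {K : ℝ≥0} {ε : ℝ} (hε : 0 ≤ ε)
    (hK : ∀ t ∈ Icc (0 : ℝ) 1, ∀ x ∈ S, ‖fderivWithin ℝ (fun y => f y t) S x‖ ≤ K)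
    (hM0 : M 0 = ContinuousLinearMap.id ℝ X) {y : X} {γ η : ℝ → X}
    (hγ : IsSolutionIn S f x γ) (hη : IsSolutionIn S f y η)
    (hM : ∀ t ∈ Icc (0 : ℝ) 1, HasDerivWithinAt M
      ((fderivWithin ℝ (fun z => f z t) S (γ t)).comp (M t)) (Icc 0 1) t)
    (hlin : ∀ t ∈ Icc (0 : ℝ) 1, ‖f (η t) t - f (γ t) t -
      fderivWithin ℝ (fun z => f z t) S (γ t) (η t - γ t)‖ ≤ ε)
    {t : ℝ} (ht : t ∈ Icc (0 : ℝ) 1) :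
    ‖η t - γ t - M t (y - x)‖ ≤ ε * Real.exp K := by
  have hderiv : ∀ s ∈ Icc (0 : ℝ) 1, HasDerivWithinAt (fun s => η s - γ s - M s (y - x))
      (f (η s) s - f (γ s) s - fderivWithin ℝ (fun z => f z s) S (γ s) (M s (y - x)))
      (Icc 0 1) s := fun s hs =>
    ((hη.hasDerivWithinAt s hs).sub (hγ.hasDerivWithinAt s hs)).sub <| by
      simpa using (hM s hs).clm_apply (hasDerivWithinAt_const s (Icc (0 : ℝ) 1) (y - x))
  have := norm_le_of_norm_hasDerivWithinAt_le K.coe_nonneg hε hderiv (fun s hs => ?_) ht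
  · simpa [hη.initial, hγ.initial, hM0] using this
  · set A := fderivWithin ℝ (fun z => f z s) S (γ s)
    calc ‖f (η s) s - f (γ s) s - A (M s (y - x))‖
        = ‖A (η s - γ s - M s (y - x)) + (f (η s) s - f (γ s) s - A (η s - γ s))‖ := by
          rw [map_sub A (η s - γ s)]; congr 1; abel
      _ ≤ K * ‖η s - γ s - M s (y - x)‖ + ε :=
          norm_add_le_of_le (A.le_of_opNorm_le (hK s hs _ (hγ.mem s hs)) _) (hlin s hs)

theorem hasFDerivWithinAt_solution (h : IsSpatiallyC1On S f) (hS : IsCompact S) (hc : Convex ℝ S)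
    (hΦ : ∀ y ∈ S, IsSolutionIn S f y (Φ y)) (hx : x ∈ S) (hM0 : M 0 = ContinuousLinearMap.id ℝ X)
    (hM : ∀ t ∈ Icc (0 : ℝ) 1, HasDerivWithinAt M
      ((fderivWithin ℝ (fun z => f z t) S (Φ x t)).comp (M t)) (Icc 0 1) t)
    {t : ℝ} (ht : t ∈ Icc (0 : ℝ) 1) : HasFDerivWithinAt (fun y => Φ y t) (M t) S x := by
  obtain ⟨K, hK⟩ := h.exists_norm_fderivWithin_le hS
  have hΦlip : ∀ y ∈ S, ∀ s ∈ Icc (0 : ℝ) 1, ‖Φ y s - Φ x s‖ ≤ ‖y - x‖ * Real.exp K :=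
    fun y hy s hs => IsSolutionIn.norm_sub_le (fun t ht => h.lipschitzOnWith hc ht (hK t ht))
      (hΦ y hy) (hΦ x hx) hs
  rw [hasFDerivWithinAt_iff_isLittleO, Asymptotics.isLittleO_iff]
  intro ε hε
  set c := Real.exp K
  have hcpos : 0 < c := Real.exp_pos _
  obtain ⟨δ, hδ, hfδ⟩ :=
    h.exists_norm_sub_sub_fderivWithin_le hS hc (ε := ε / (c * c)) (by positivity)
  filter_upwards [self_mem_nhdsWithin,
    mem_nhdsWithin_of_mem_nhds (Metric.ball_mem_nhds x (div_pos hδ hcpos))] with y hy hyδ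
  rw [Metric.mem_ball, dist_eq_norm, lt_div_iff₀ hcpos] at hyδ
  have hlin : ∀ s ∈ Icc (0 : ℝ) 1, ‖f (Φ y s) s - f (Φ x s) s -
      fderivWithin ℝ (fun z => f z s) S (Φ x s) (Φ y s - Φ x s)‖ ≤ ε / c * ‖y - x‖ := by
    intro s hs
    calc _ ≤ ε / (c * c) * ‖Φ y s - Φ x s‖ := hfδ s hs _ ((hΦ x hx).mem s hs) _
          ((hΦ y hy).mem s hs) ((hΦlip y hy s hs).trans_lt hyδ)
      _ ≤ ε / (c * c) * (‖y - x‖ * c) := by gcongr; exact hΦlip y hy s hs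
      _ = ε / c * ‖y - x‖ := by field_simp
  refine (norm_solution_sub_sub_fundamental_le (by positivity) hK hM0 (hΦ x hx) (hΦ y hy) hM hlin
    ht).trans_eq ?_
  change ε / c * ‖y - x‖ * c = _
  field_simp

end FlowDerivative

end IsSpatiallyC1On

section Cube

variable {d : ℕ}

theorem abs_apply_le_norm (x : E d) (i : Fin d) : |x i| ≤ ‖x‖ := by
  simpa using PiLp.norm_apply_le x i

theorem sum_smul_single (x : E d) : ∑ i, x i • EuclideanSpace.single i (1 : ℝ) = x := by
  simpa using (EuclideanSpace.basisFun (Fin d) ℝ).sum_repr x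

theorem norm_le_of_abs_apply_le {x : E d} {c : ℝ} (h : ∀ i, |x i| ≤ c) : ‖x‖ ≤ d * c := by
  rw [← sum_smul_single x]
  refine (norm_sum_le_of_le _ fun i _ => ?_).trans_eq (by simp : ∑ _i : Fin d, c = d * c)
  simpa [norm_smul] using h i

theorem convex_cube (d : ℕ) : Convex ℝ (cube d) := fun _ hx _ hy _ _ ha hb hab i =>
  convex_Icc (0 : ℝ) 1 (hx i) (hy i) ha hb hab

theorem cube_eq_preimage (d : ℕ) :
    cube d = EuclideanSpace.equiv (Fin d) ℝ ⁻¹' univ.pi fun _ => Icc (0 : ℝ) 1 := by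
  ext x
  simp only [cube, Set.mem_ofPred_eq, mem_preimage, Set.mem_univ_pi]
  rfl

theorem isCompact_cube (d : ℕ) : IsCompact (cube d) := by
  rw [cube_eq_preimage]
  exact (EuclideanSpace.equiv (Fin d) ℝ).toHomeomorph.isCompact_preimage.2
    (isCompact_univ_pi fun _ => isCompact_Icc)

theorem measurableSet_cube (d : ℕ) : MeasurableSet (cube d) := (isCompact_cube d).measurableSet

theorem interior_cube_nonempty (d : ℕ) : (interior (cube d)).Nonempty := by
  refine ⟨WithLp.toLp 2 fun _ => 1 / 2, interior_maximal
    (t := EuclideanSpace.equiv (Fin d) ℝ ⁻¹' univ.pi fun _ => Ioo (0 : ℝ) 1) ?_ ?_ ?_⟩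
  · rw [cube_eq_preimage]
    exact preimage_mono (pi_mono fun _ _ => Ioo_subset_Icc_self)
  · exact (isOpen_set_pi finite_univ fun _ _ => isOpen_Ioo).preimage
      (EuclideanSpace.equiv (Fin d) ℝ).continuous
  · intro i _
    norm_num

theorem uniqueDiffOn_cube (d : ℕ) : UniqueDiffOn ℝ (cube d) :=
  uniqueDiffOn_convex (convex_cube d) (interior_cube_nonempty d)

/-- The coordinatewise projection of `ℝ^d` onto the unit cube. -/
noncomputable def cubeClamp (x : E d) : E d :=
  WithLp.toLp 2 fun i => (projIcc 0 1 zero_le_one (x i) : ℝ)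

theorem cubeClamp_apply (x : E d) (i : Fin d) :
    cubeClamp x i = (projIcc 0 1 zero_le_one (x i) : ℝ) := rfl

theorem cubeClamp_mem_cube (x : E d) : cubeClamp x ∈ cube d := fun i =>
  (projIcc 0 1 zero_le_one (x i)).2

theorem cubeClamp_of_mem_cube {x : E d} (hx : x ∈ cube d) : cubeClamp x = x := by
  ext i
  rw [cubeClamp_apply, projIcc_of_mem zero_le_one (hx i)]

theorem lipschitzWith_cubeClamp : LipschitzWith 1 (cubeClamp : E d → E d) := by
  refine LipschitzWith.of_dist_le_mul fun x y => ?_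
  rw [NNReal.coe_one, one_mul, EuclideanSpace.dist_eq, EuclideanSpace.dist_eq]
  gcongr with i
  have := (LipschitzWith.projIcc (zero_le_one (α := ℝ))).dist_le_mul (x i) (y i)
  rwa [NNReal.coe_one, one_mul, Subtype.dist_eq] at this

end Cube

section Trajectories

variable {d : ℕ} {f : E d → ℝ → E d} {x : E d} {γ : ℝ → E d}

theorem continuousOn_uncurry_swap
    (hf : ContinuousOn (fun z : E d × ℝ => f z.1 z.2) (cube d ×ˢ Icc 0 1)) :
    ContinuousOn (Function.uncurry fun t x => f x t) (Icc 0 1 ×ˢ cube d) :=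
  hf.comp continuous_swap.continuousOn fun _ hz => ⟨hz.2, hz.1⟩

theorem IsTrajectory.isSolutionIn
    (hf : ContinuousOn (fun z : E d × ℝ => f z.1 z.2) (cube d ×ˢ Icc 0 1))
    (h : IsTrajectory f x γ) : IsSolutionIn (cube d) f x γ where
  initial := by simpa using h.eq_integral 0 (by simp)
  mem := h.mem_cube
  hasDerivWithinAt t ht := by
    have := ODE.hasDerivWithinAt_picard_Icc (f := fun t x => f x t) (t₀ := 0) (by simp)
      (continuousOn_uncurry_swap hf) h.continuousOn h.mem_cube x ht
    exact this.congr (fun s hs => h.eq_integral s hs) (h.eq_integral t ht)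

theorem IsSolutionIn.isTrajectory
    (hf : ContinuousOn (fun z : E d × ℝ => f z.1 z.2) (cube d ×ˢ Icc 0 1))
    (h : IsSolutionIn (cube d) f x γ) : IsTrajectory f x γ where
  continuousOn := h.continuousOn
  mem_cube := h.mem
  eq_integral t ht := by
    have hsub : uIcc 0 t ⊆ Icc (0 : ℝ) 1 := by
      rw [uIcc_of_le ht.1]; exact Icc_subset_Icc_right ht.2
    have := ODE.picard_eq_of_hasDerivAt (f := fun t x => f x t) (t₀ := 0) (t := t) (u := cube d)
      (α := γ) ((continuousOn_uncurry_swap hf).mono (prod_mono hsub le_rfl))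
      (fun s hs => (h.hasDerivWithinAt s (hsub hs)).mono hsub) fun s hs => h.mem s (hsub hs)
    rw [ODE.picard_apply, h.initial] at this
    exact this.symm

theorem wellPosed_of_exists_isSolutionIn
    (hf : ContinuousOn (fun z : E d × ℝ => f z.1 z.2) (cube d ×ˢ Icc 0 1)) {K : ℝ≥0}
    (hK : ∀ t ∈ Icc (0 : ℝ) 1, LipschitzOnWith K (fun x => f x t) (cube d))
    (hex : ∀ x ∈ cube d, ∃ γ, IsSolutionIn (cube d) f x γ) : WellPosed f := fun x hx =>
  ⟨(hex x hx).imp fun _ h => h.isTrajectory hf, fun _ _ h₁ h₂ =>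
    (h₁.isSolutionIn hf).eqOn hK (h₂.isSolutionIn hf)⟩

theorem WellPosed.isTrajectory_flowMap (h : WellPosed f) (hx : x ∈ cube d) :
    IsTrajectory f x (flowMap f x) :=
  Classical.epsilon_spec (h x hx).1

end Trajectories

/-- A vector field on `[0,1]^d × [0,1]` that is `C¹` in space, uniformly in time, and tangent to
the faces of the cube, so that its flow preserves the cube. -/
structure IsTangentField {d : ℕ} (g : E d → ℝ → E d) : Prop
    extends IsSpatiallyC1On (cube d) g where
  tangent : ∀ x ∈ cube d, ∀ t ∈ Icc (0 : ℝ) 1, ∀ i, x i = 0 ∨ x i = 1 → g x t i = 0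

theorem isSpatiallyC1On_of_contDiffOn_prod {X : Type*} [NormedAddCommGroup X] [NormedSpace ℝ X]
    {S : Set X} (hS : UniqueDiffOn ℝ S) {f : X → ℝ → X}
    (hf : ContDiffOn ℝ 1 (fun z : X × ℝ => f z.1 z.2) (S ×ˢ Icc 0 1)) : IsSpatiallyC1On S f := by
  have hderiv : ∀ z ∈ S ×ˢ Icc (0 : ℝ) 1, HasFDerivWithinAt (fun y => f y z.2)
      ((fderivWithin ℝ (fun z : X × ℝ => f z.1 z.2) (S ×ˢ Icc 0 1) z).comp
        (ContinuousLinearMap.inl ℝ X ℝ)) S z.1 := fun z hz =>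
    (hf.differentiableOn one_ne_zero z hz).hasFDerivWithinAt.comp (f := fun y => (y, z.2)) z.1
      (hasFDerivAt_prodMk_left z.1 z.2).hasFDerivWithinAt fun y hy => ⟨hy, hz.2⟩
  refine ⟨hf.continuousOn, fun t ht x hx => (hderiv (x, t) ⟨hx, ht⟩).differentiableWithinAt, ?_⟩
  exact ((hf.continuousOn_fderivWithin (hS.prod (uniqueDiffOn_Icc zero_lt_one)) le_rfl).clm_comp
    continuousOn_const).congr fun z hz => (hderiv z hz).fderivWithin (hS z.1 hz.1)

theorem InAnsatz.isTangentField {d k : ℕ} {r : ℝ} {g : E d → ℝ → E d} (h : InAnsatz k r g) :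
    IsTangentField g where
  toIsSpatiallyC1On := isSpatiallyC1On_of_contDiffOn_prod (uniqueDiffOn_cube d) <|
    (h.contDiffOn.of_le one_le_two).comp
      (WithLp.prodContinuousLinearEquiv 2 ℝ (E d) ℝ).symm.contDiff.contDiffOn fun _ hz => hz
  tangent x hx t ht i hi := by
    obtain ⟨b, -, hb⟩ := h.factor
    have := hb (WithLp.toLp 2 (x, t)) ⟨hx, ht⟩ i
    rcases hi with hi | hi <;> simpa [hi] using this

theorem hasDerivWithinAt_apply {d : ℕ} {γ : ℝ → E d} {γ' : E d} {s : Set ℝ} {t : ℝ}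
    (h : HasDerivWithinAt γ γ' s t) (i : Fin d) :
    HasDerivWithinAt (fun s => γ s i) (γ' i) s t :=
  (EuclideanSpace.proj i : E d →L[ℝ] ℝ).hasFDerivAt.comp_hasDerivWithinAt t h

namespace IsTangentField

variable {d : ℕ} {g : E d → ℝ → E d}

theorem reverse (h : IsTangentField g) : IsTangentField fun x t => -g x (1 - t) := by
  have hmaps : MapsTo (fun z : E d × ℝ => (z.1, 1 - z.2)) (cube d ×ˢ Icc 0 1)
      (cube d ×ˢ Icc 0 1) := fun z hz => ⟨hz.1, one_sub_mem_Icc hz.2⟩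
  refine ⟨⟨?_, fun t ht => (h.differentiableOn _ (one_sub_mem_Icc ht)).neg, ?_⟩, ?_⟩
  · exact (h.continuousOn.comp (by fun_prop) hmaps).neg
  · refine (h.continuousOn_fderivWithin.comp (by fun_prop) hmaps).neg.congr fun z hz => ?_
    exact fderivWithin_neg (uniqueDiffOn_cube d z.1 hz.1)
  · intro x hx t ht i hi
    simp [h.tangent x hx (1 - t) (one_sub_mem_Icc ht) i hi]

theorem mem_cube_of_clamped (h : IsTangentField g) {γ : ℝ → E d} (h0 : γ 0 ∈ cube d)
    (hγ : ∀ t ∈ Icc (0 : ℝ) 1, HasDerivWithinAt γ (g (cubeClamp (γ t)) t) (Icc 0 1) t) {t : ℝ}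
    (ht : t ∈ Icc (0 : ℝ) 1) : γ t ∈ cube d := by
  have hγi : ∀ i, ∀ s ∈ Icc (0 : ℝ) 1, HasDerivWithinAt (fun s => γ s i)
      (g (cubeClamp (γ s)) s i) (Icc 0 1) s := fun i s hs => hasDerivWithinAt_apply (hγ s hs) i
  intro i
  constructor
  · refine neg_nonpos.1 (nonpos_of_deriv_nonpos_of_pos (u := fun s => -γ s i)
      (neg_nonpos.2 (h0 i).1) (fun s hs => (hγi i s hs).neg) (fun s hs hneg => ?_) ht)
    rw [h.tangent _ (cubeClamp_mem_cube _) s hs i (.inl ?_), neg_zero]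
    rw [cubeClamp_apply, projIcc_of_le_left _ (neg_pos.1 hneg).le]
  · refine sub_nonpos.1 (nonpos_of_deriv_nonpos_of_pos (u := fun s => γ s i - 1)
      (sub_nonpos.2 (h0 i).2) (fun s hs => (hγi i s hs).sub_const 1) (fun s hs hpos => ?_) ht)
    rw [h.tangent _ (cubeClamp_mem_cube _) s hs i (.inr ?_)]
    rw [cubeClamp_apply, projIcc_of_right_le _ (sub_pos.1 hpos).le]

theorem exists_lipschitzOnWith (h : IsTangentField g) :
    ∃ K : ℝ≥0, ∀ t ∈ Icc (0 : ℝ) 1, LipschitzOnWith K (fun x => g x t) (cube d) :=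
  h.toIsSpatiallyC1On.exists_lipschitzOnWith (isCompact_cube d) (convex_cube d)

theorem exists_isSolutionIn (h : IsTangentField g) {x : E d} (hx : x ∈ cube d) :
    ∃ γ, IsSolutionIn (cube d) g x γ := by
  obtain ⟨K, hK⟩ := h.exists_lipschitzOnWith
  obtain ⟨L, hL⟩ :=
    ((isCompact_cube d).prod isCompact_Icc).exists_bound_of_continuousOn h.continuousOn
  obtain ⟨γ, hγ0, -, hγ⟩ := exists_isSolutionIn_univ_of_bounded
    (f := fun y t => g (cubeClamp y) t) (K := K * 1) (L := L.toNNReal)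
    (fun t ht => lipschitzOnWith_univ.1 <|
      (hK t ht).comp lipschitzWith_cubeClamp.lipschitzOnWith fun y _ => cubeClamp_mem_cube y)
    (fun y => h.continuousOn.comp (f := fun t => (cubeClamp y, t)) (by fun_prop)
      fun t ht => ⟨cubeClamp_mem_cube y, ht⟩)
    (fun t ht y => (hL (cubeClamp y, t) ⟨cubeClamp_mem_cube y, ht⟩).trans
      (Real.le_coe_toNNReal L)) x
  have hmem : ∀ t ∈ Icc (0 : ℝ) 1, γ t ∈ cube d := fun t =>
    h.mem_cube_of_clamped (hγ0 ▸ hx) hγ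
  refine ⟨γ, hγ0, hmem, fun t ht => ?_⟩
  simpa only [cubeClamp_of_mem_cube (hmem t ht)] using hγ t ht

theorem wellPosed (h : IsTangentField g) : WellPosed g := by
  obtain ⟨K, hK⟩ := h.exists_lipschitzOnWith
  exact wellPosed_of_exists_isSolutionIn h.continuousOn hK fun x hx => h.exists_isSolutionIn hx

theorem isSolutionIn_flowMap (h : IsTangentField g) {x : E d} (hx : x ∈ cube d) :
    IsSolutionIn (cube d) g x (flowMap g x) :=
  (h.wellPosed.isTrajectory_flowMap hx).isSolutionIn h.continuousOn

theorem bijOn_flowMap (h : IsTangentField g) :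
    BijOn (fun x => flowMap g x 1) (cube d) (cube d) := by
  obtain ⟨K, hK⟩ := h.exists_lipschitzOnWith
  refine ⟨fun x hx => (h.isSolutionIn_flowMap hx).mem 1 (by simp), fun x hx y hy hxy => ?_,
    fun z hz => ?_⟩
  · have hγ := h.isSolutionIn_flowMap hx
    have hη := h.isSolutionIn_flowMap hy
    rw [← hγ.initial, ← hη.initial]
    exact hγ.eqOn_of_eq_at_one hK hη hxy (by simp)
  · obtain ⟨η, hη⟩ := h.reverse.exists_isSolutionIn hz
    have hη1 : η 1 ∈ cube d := hη.mem 1 (by simp)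
    have hback : IsSolutionIn (cube d) g (η 1) fun t => η (1 - t) := by simpa using hη.reverse
    refine ⟨η 1, hη1, ?_⟩
    have := (h.isSolutionIn_flowMap hη1).eqOn hK hback (show (1 : ℝ) ∈ Icc (0 : ℝ) 1 by simp)
    simpa [hη.initial] using this

end IsTangentField

section Determinants

variable {n R : Type*} [Fintype n] [DecidableEq n] [CommRing R]

theorem sum_det_updateCol_mul (A M : Matrix n n R) :
    ∑ k, (M.updateCol k fun i => (A * M) i k).det = A.trace * M.det := by
  have det_updateCol : ∀ k, (M.updateCol k fun i => (A * M) i k).det =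
      (M.adjugate * (A * M)) k k := fun k => by
    rw [← Matrix.cramer_apply, Matrix.cramer_eq_adjugate_mulVec]
    rfl
  calc ∑ k, (M.updateCol k fun i => (A * M) i k).det
      = (M.adjugate * (A * M)).trace := Finset.sum_congr rfl fun k _ => det_updateCol k
    _ = (A * (M.det • 1)).trace := by
      rw [Matrix.trace_mul_comm, Matrix.mul_assoc, Matrix.mul_adjugate]
    _ = A.trace * M.det := by
      rw [Matrix.mul_smul, Matrix.trace_smul, mul_one, smul_eq_mul, mul_comm]

theorem hasDerivWithinAt_det {M : ℝ → Matrix n n ℝ} {M' : Matrix n n ℝ} {S : Set ℝ} {t : ℝ}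
    (h : ∀ i j, HasDerivWithinAt (fun s => M s i j) (M' i j) S t) :
    HasDerivWithinAt (fun s => (M s).det)
      (∑ k, ((M t).updateCol k fun i => M' i k).det) S t := by
  have hasDerivWithinAt_prod : ∀ σ : Equiv.Perm n, HasDerivWithinAt (fun s => ∏ i, M s (σ i) i)
      (∑ k, ∏ i, ((M t).updateCol k fun i => M' i k) (σ i) i) S t := by
    intro σ
    refine (HasDerivWithinAt.fun_finsetProd (u := Finset.univ) (f := fun i s => M s (σ i) i)
      fun i _ => h (σ i) i).congr_deriv (Finset.sum_congr rfl fun k _ => ?_)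
    rw [← Finset.mul_prod_erase Finset.univ _ (Finset.mem_univ k), mul_comm, smul_eq_mul,
      Matrix.updateCol_self]
    congr 1
    refine Finset.prod_congr rfl fun i hi => ?_
    rw [Matrix.updateCol_ne (Finset.ne_of_mem_erase hi)]
  simp_rw [Matrix.det_apply]
  rw [Finset.sum_comm]
  simp_rw [← Finset.smul_sum]
  exact HasDerivWithinAt.fun_sum fun σ _ =>
    (hasDerivWithinAt_prod σ).const_smul (Equiv.Perm.sign σ)

theorem eq_mul_exp_of_hasDerivWithinAt {u a Θ : ℝ → ℝ}
    (hu : ∀ t ∈ Icc (0 : ℝ) 1, HasDerivWithinAt u (a t * u t) (Icc 0 1) t)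
    (hΘ : ∀ t ∈ Icc (0 : ℝ) 1, HasDerivWithinAt Θ (a t) (Icc 0 1) t) {t : ℝ}
    (ht : t ∈ Icc (0 : ℝ) 1) : u t = u 0 * Real.exp (Θ t - Θ 0) := by
  have hderiv : ∀ s ∈ Icc (0 : ℝ) 1,
      HasDerivWithinAt (fun s => u s * Real.exp (-Θ s)) 0 (Icc 0 1) s := fun s hs =>
    ((hu s hs).mul (hΘ s hs).neg.exp).congr_deriv (by simp only [Pi.neg_apply]; ring)
  have hconst := constant_of_has_deriv_right_zero
    (fun s hs => (hderiv s hs).continuousWithinAt)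
    (fun s hs => hasDerivWithinAt_Ici_of_Icc (hderiv s (Ico_subset_Icc_self hs)) hs) t ht
  rw [sub_eq_neg_add, Real.exp_add, ← mul_assoc, ← hconst, mul_assoc, ← Real.exp_add,
    neg_add_cancel, Real.exp_zero, mul_one]

end Determinants

section Liouville

variable {d : ℕ}

/-- The matrix of a linear endomorphism of `ℝ^d` in the standard basis. -/
noncomputable def stdMatrix (A : E d →L[ℝ] E d) : Matrix (Fin d) (Fin d) ℝ :=
  Matrix.of fun i j => A (EuclideanSpace.single j 1) i

theorem stdMatrix_apply (A : E d →L[ℝ] E d) (i j : Fin d) :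
    stdMatrix A i j = A (EuclideanSpace.single j 1) i := rfl

theorem stdMatrix_eq_toMatrix (A : E d →L[ℝ] E d) :
    stdMatrix A = LinearMap.toMatrix (EuclideanSpace.basisFun (Fin d) ℝ).toBasis
      (EuclideanSpace.basisFun (Fin d) ℝ).toBasis (A : E d →ₗ[ℝ] E d) := by
  ext i j
  simp [stdMatrix_apply, LinearMap.toMatrix_apply]

theorem stdMatrix_comp (A B : E d →L[ℝ] E d) :
    stdMatrix (A.comp B) = stdMatrix A * stdMatrix B := by
  simp only [stdMatrix_eq_toMatrix, ContinuousLinearMap.toLinearMap_comp,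
    LinearMap.toMatrix_comp _ (EuclideanSpace.basisFun (Fin d) ℝ).toBasis]

theorem stdMatrix_id : stdMatrix (ContinuousLinearMap.id ℝ (E d)) = 1 := by
  ext i j
  simp [stdMatrix_apply, Matrix.one_apply]

theorem stdMatrix_sub (A B : E d →L[ℝ] E d) : stdMatrix (A - B) = stdMatrix A - stdMatrix B := rfl

theorem det_stdMatrix (A : E d →L[ℝ] E d) : (stdMatrix A).det = A.det := by
  rw [stdMatrix_eq_toMatrix, LinearMap.det_toMatrix]

theorem abs_stdMatrix_le (A : E d →L[ℝ] E d) (i j : Fin d) : |stdMatrix A i j| ≤ ‖A‖ :=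
  (abs_apply_le_norm _ i).trans ((A.le_opNorm _).trans_eq (by simp))

theorem abs_trace_stdMatrix_le (A : E d →L[ℝ] E d) : |(stdMatrix A).trace| ≤ d * ‖A‖ := by
  refine (Finset.abs_sum_le_sum_abs _ _).trans
    ((Finset.sum_le_sum fun i _ => abs_stdMatrix_le A i i).trans_eq ?_)
  simp

theorem continuous_trace_stdMatrix : Continuous fun A : E d →L[ℝ] E d => (stdMatrix A).trace :=
  continuous_finsetSum _ fun i _ => (EuclideanSpace.proj i : E d →L[ℝ] ℝ).continuous.comp
    (ContinuousLinearMap.apply ℝ (E d) (EuclideanSpace.single i (1 : ℝ))).continuous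

theorem det_eq_exp_integral_trace {A M : ℝ → E d →L[ℝ] E d} (hA : ContinuousOn A (Icc 0 1))
    (hM0 : M 0 = ContinuousLinearMap.id ℝ (E d))
    (hM : ∀ t ∈ Icc (0 : ℝ) 1, HasDerivWithinAt M ((A t).comp (M t)) (Icc 0 1) t) {t : ℝ}
    (ht : t ∈ Icc (0 : ℝ) 1) :
    (M t).det = Real.exp (∫ s in (0 : ℝ)..t, (stdMatrix (A s)).trace) := by
  have hdet : ∀ s ∈ Icc (0 : ℝ) 1, HasDerivWithinAt (fun s => (stdMatrix (M s)).det)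
      ((stdMatrix (A s)).trace * (stdMatrix (M s)).det) (Icc 0 1) s := fun s hs => by
    rw [← sum_det_updateCol_mul, ← stdMatrix_comp]
    refine hasDerivWithinAt_det fun i j => ?_
    have := (hM s hs).clm_apply (hasDerivWithinAt_const s (Icc (0 : ℝ) 1)
      (EuclideanSpace.single j (1 : ℝ)))
    simpa [stdMatrix_apply] using hasDerivWithinAt_apply this i
  have htrace : ContinuousOn (fun s => (stdMatrix (A s)).trace) (Icc 0 1) :=
    continuous_trace_stdMatrix.comp_continuousOn hA
  have hintegral : ∀ s ∈ Icc (0 : ℝ) 1, HasDerivWithinAt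
      (fun s => ∫ r in (0 : ℝ)..s, (stdMatrix (A r)).trace) (stdMatrix (A s)).trace
      (Icc 0 1) s := fun s hs => by
    have : Fact (s ∈ Icc (0 : ℝ) 1) := ⟨hs⟩
    exact intervalIntegral.integral_hasDerivWithinAt_right
      ((htrace.mono (Icc_subset_Icc_right hs.2)).intervalIntegrable_of_Icc hs.1)
      (htrace.stronglyMeasurableAtFilter_nhdsWithin measurableSet_Icc s) (htrace s hs)
  have := eq_mul_exp_of_hasDerivWithinAt hdet hintegral ht
  rwa [hM0, stdMatrix_id, Matrix.det_one, one_mul, intervalIntegral.integral_same, sub_zero,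
    det_stdMatrix] at this

/-- The spatial divergence on `[0,1]^d` of a time-dependent vector field. -/
noncomputable def divergence (f : E d → ℝ → E d) (x : E d) (t : ℝ) : ℝ :=
  (stdMatrix (fderivWithin ℝ (fun y => f y t) (cube d) x)).trace

namespace IsTangentField

variable {g : E d → ℝ → E d}

theorem continuousOn_fderivWithin_flowMap (h : IsTangentField g) {x : E d} (hx : x ∈ cube d) :
    ContinuousOn (fun t => fderivWithin ℝ (fun y => g y t) (cube d) (flowMap g x t)) (Icc 0 1) :=
  h.continuousOn_fderivWithin.comp (f := fun t => (flowMap g x t, t))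
    ((h.isSolutionIn_flowMap hx).continuousOn.prodMk continuousOn_id)
    fun t ht => ⟨(h.isSolutionIn_flowMap hx).mem t ht, ht⟩

theorem continuousOn_divergence_flowMap (h : IsTangentField g) {x : E d} (hx : x ∈ cube d) :
    ContinuousOn (fun t => divergence g (flowMap g x t) t) (Icc 0 1) :=
  continuous_trace_stdMatrix.comp_continuousOn (h.continuousOn_fderivWithin_flowMap hx)

theorem exists_hasFDerivWithinAt_flowMap (h : IsTangentField g) {x : E d} (hx : x ∈ cube d) :
    ∃ M : E d →L[ℝ] E d, HasFDerivWithinAt (fun y => flowMap g y 1) M (cube d) x ∧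
      M.det = Real.exp (∫ t in (0 : ℝ)..1, divergence g (flowMap g x t) t) := by
  have hA := h.continuousOn_fderivWithin_flowMap hx
  obtain ⟨M, hM0, hM⟩ := exists_fundamental_solution hA
  exact ⟨M 1, h.hasFDerivWithinAt_solution (isCompact_cube d) (convex_cube d)
    (fun y hy => h.isSolutionIn_flowMap hy) hx hM0 hM (by simp),
    det_eq_exp_integral_trace hA hM0 hM (by simp)⟩

end IsTangentField

end Liouville

section InverseMaps

theorem contDiffOn_one_of_hasFDerivWithinAt {X Y : Type*} [NormedAddCommGroup X]
    [NormedSpace ℝ X] [NormedAddCommGroup Y] [NormedSpace ℝ Y] {S : Set X}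
    (hS : UniqueDiffOn ℝ S) {f : X → Y} {f' : X → X →L[ℝ] Y}
    (hf : ∀ x ∈ S, HasFDerivWithinAt f (f' x) S x) (hf' : ContinuousOn f' S) :
    ContDiffOn ℝ 1 f S := by
  rw [← zero_add (1 : WithTop ℕ∞), contDiffOn_succ_iff_fderivWithin hS]
  exact ⟨fun x hx => (hf x hx).differentiableWithinAt, by simp,
    contDiffOn_zero.2 (hf'.congr fun x hx => (hf x hx).fderivWithin (hS x hx))⟩

theorem continuousOn_of_isCompact_of_rightInvOn {X Y : Type*} [TopologicalSpace X]
    [TopologicalSpace Y] [T2Space Y] {K : Set X} {S : Set Y} {f : X → Y} {g : Y → X}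
    (hK : IsCompact K) (hf : ContinuousOn f K) (hinj : InjOn f K) (hg : MapsTo g S K)
    (hfg : RightInvOn g f S) : ContinuousOn g S := by
  refine continuousOn_iff_isClosed.2 fun C hC =>
    ⟨f '' (K ∩ C), ((hK.inter_right hC).image_of_continuousOn
      (hf.mono inter_subset_left)).isClosed, ?_⟩
  ext y
  refine and_congr_left fun hy => ⟨fun h => ⟨g y, ⟨hg hy, h⟩, hfg hy⟩, ?_⟩
  rintro ⟨x, ⟨hx, hxC⟩, rfl⟩
  have hgx : g (f x) = x := hinj (hg hy) hx (hfg hy)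
  rwa [mem_preimage, hgx]

variable {X : Type*} [NormedAddCommGroup X] [NormedSpace ℝ X] [FiniteDimensional ℝ X]

theorem continuousAt_inverse_of_det_ne_zero {B : X →L[ℝ] X} (hB : B.det ≠ 0) :
    ContinuousAt (ContinuousLinearMap.inverse : (X →L[ℝ] X) → X →L[ℝ] X) B := by
  have : CompleteSpace X := FiniteDimensional.complete ℝ X
  have h := (contDiffAt_map_inverse (𝕜 := ℝ) (n := 0)
    (B.toContinuousLinearEquivOfDetNeZero hB)).continuousAt
  rwa [ContinuousLinearMap.coe_toContinuousLinearEquivOfDetNeZero] at h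

theorem inverse_comp_self_of_det_ne_zero {B : X →L[ℝ] X} (hB : B.det ≠ 0) :
    B.inverse.comp B = ContinuousLinearMap.id ℝ X := by
  rw [← B.coe_toContinuousLinearEquivOfDetNeZero hB, ContinuousLinearMap.inverse_equiv,
    ContinuousLinearEquiv.coe_symm_comp_coe]

theorem exists_norm_inverse_le (X : Type*) [NormedAddCommGroup X] [NormedSpace ℝ X]
    [FiniteDimensional ℝ X] (K : ℝ) {m : ℝ} (hm : 0 < m) :
    ∃ A, ∀ B : X →L[ℝ] X, ‖B‖ ≤ K → m ≤ B.det → ‖B.inverse‖ ≤ A := by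
  have : ProperSpace (X →L[ℝ] X) := FiniteDimensional.proper ℝ _
  have hcomp : IsCompact (Metric.closedBall (0 : X →L[ℝ] X) K ∩ {B | m ≤ B.det}) :=
    (isCompact_closedBall _ _).inter_right
      (isClosed_le continuous_const ContinuousLinearMap.continuous_det)
  obtain ⟨A, hA⟩ := hcomp.exists_bound_of_continuousOn (f := ContinuousLinearMap.inverse)
    fun B hB => (continuousAt_inverse_of_det_ne_zero (hm.trans_le hB.2).ne').continuousWithinAt
  exact ⟨A, fun B hB hdet => hA B ⟨mem_closedBall_zero_iff.2 hB, hdet⟩⟩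

theorem hasFDerivWithinAt_inverse_of_rightInvOn {S R : X → X} {U V : Set X} {B : X →L[ℝ] X} {y : X}
    (hS : HasFDerivWithinAt S B U (R y)) (hB : B.det ≠ 0) (hR : ContinuousWithinAt R V y)
    (hRm : MapsTo R V U) (hSR : RightInvOn R S V) (hy : y ∈ V) :
    HasFDerivWithinAt R B.inverse V y := by
  rw [← B.coe_toContinuousLinearEquivOfDetNeZero hB] at hS ⊢
  rw [ContinuousLinearMap.inverse_equiv]
  exact HasFDerivWithinAt.of_local_left_inverse
    (tendsto_nhdsWithin_iff.2 ⟨hR, Filter.eventually_of_mem self_mem_nhdsWithin hRm⟩)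
    hS hy (Filter.eventually_of_mem self_mem_nhdsWithin hSR)

end InverseMaps

section Coordinates

variable {d : ℕ}

theorem setCoord_apply (x : E d) (i j : Fin d) (s : ℝ) :
    setCoord x i s j = if j = i then s else x j := by
  simp [setCoord, Function.update_apply]

theorem setCoord_self (x : E d) (i : Fin d) (s : ℝ) : setCoord x i s i = s := by
  simp [setCoord_apply]

theorem setCoord_of_ne (x : E d) {i j : Fin d} (h : j ≠ i) (s : ℝ) :
    setCoord x i s j = x j := by
  simp [setCoord_apply, h]

theorem setCoord_eq (x : E d) (i : Fin d) : setCoord x i (x i) = x := by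
  simp [setCoord]

theorem setCoord_mem_cube {x : E d} (hx : x ∈ cube d) (i : Fin d) {s : ℝ}
    (hs : s ∈ Icc (0 : ℝ) 1) : setCoord x i s ∈ cube d := by
  intro j
  rw [setCoord_apply]
  split_ifs
  exacts [hs, hx j]

theorem setCoord_eq_add (x : E d) (i : Fin d) (s : ℝ) :
    setCoord x i s = x + (s - x i) • EuclideanSpace.single i (1 : ℝ) := by
  ext j
  by_cases h : j = i
  · subst h; simp [setCoord_apply]
  · simp [setCoord_apply, h]

theorem hasDerivAt_setCoord (x : E d) (i : Fin d) (s : ℝ) :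
    HasDerivAt (setCoord x i) (EuclideanSpace.single i (1 : ℝ)) s := by
  rw [funext (setCoord_eq_add x i)]
  simpa using (((hasDerivAt_id s).sub_const (x i)).smul_const
    (EuclideanSpace.single i (1 : ℝ))).const_add x

variable {f : E d → E d}

theorem hasDerivWithinAt_apply_setCoord (hf : DifferentiableOn ℝ f (cube d)) {x : E d}
    (hx : x ∈ cube d) (i j : Fin d) {s : ℝ} (hs : s ∈ Icc (0 : ℝ) 1) :
    HasDerivWithinAt (fun s => f (setCoord x j s) i)
      (stdMatrix (fderivWithin ℝ f (cube d) (setCoord x j s)) i j) (Icc 0 1) s :=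
  hasDerivWithinAt_apply ((hf _ (setCoord_mem_cube hx j hs)).hasFDerivWithinAt.comp_hasDerivWithinAt
    s (hasDerivAt_setCoord x j s).hasDerivWithinAt fun _ ht => setCoord_mem_cube hx j ht) i

theorem stdMatrix_fderivWithin_eq_of_hasDerivWithinAt (hf : DifferentiableOn ℝ f (cube d))
    {x : E d} (hx : x ∈ cube d) {i j : Fin d} {a : ℝ}
    (h : HasDerivWithinAt (fun s => f (setCoord x j s) i) a (Icc 0 1) (x j)) :
    stdMatrix (fderivWithin ℝ f (cube d) x) i j = a := by
  have h' := hasDerivWithinAt_apply_setCoord hf hx i j (hx j)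
  rw [setCoord_eq] at h'
  exact (uniqueDiffOn_Icc zero_lt_one (x j) (hx j)).eq_deriv _ h' h

theorem isLowerTriangular_stdMatrix_fderivWithin (hf : DifferentiableOn ℝ f (cube d))
    (hcongr : ∀ x ∈ cube d, ∀ y ∈ cube d, ∀ i, (∀ j ≤ i, x j = y j) → f x i = f y i) {x : E d}
    (hx : x ∈ cube d) : (stdMatrix (fderivWithin ℝ f (cube d) x)).IsLowerTriangular := by
  intro i j (hij : i < j)
  refine stdMatrix_fderivWithin_eq_of_hasDerivWithinAt hf hx <|
    (hasDerivWithinAt_const (x j) (Icc (0 : ℝ) 1) (f x i)).congr (fun s hs => ?_) (by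
      rw [setCoord_eq])
  exact hcongr _ (setCoord_mem_cube hx j hs) _ hx _ fun l hl =>
    setCoord_of_ne _ (hl.trans_lt hij).ne _

theorem mul_apply_self_of_isLowerTriangular {m R : Type*} [Fintype m] [LinearOrder m] [Semiring R]
    {M N : Matrix m m R} (hM : M.IsLowerTriangular) (hN : N.IsLowerTriangular) (i : m) :
    (M * N) i i = M i i * N i i := by
  rw [Matrix.mul_apply, Finset.sum_eq_single i (fun j _ hj => ?_) (by simp)]
  rcases hj.lt_or_gt with hlt | hgt
  · rw [hN hlt, mul_zero]
  · rw [hM hgt, zero_mul]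

end Coordinates

section TriangularMaps

/-- A lower triangular `C¹` self-map of the cube that preserves every face, with derivative
bounded by `K` and diagonal partial derivatives bounded below by `c > 0`. The constants are part
of the notion because the estimates have to be uniform over all maps sharing them. -/
structure IsTriangular {d : ℕ} (c K : ℝ) (S : E d → E d) : Prop where
  pos : 0 < c
  contDiffOn : ContDiffOn ℝ 1 S (cube d)
  norm_fderivWithin_le : ∀ x ∈ cube d, ‖fderivWithin ℝ S (cube d) x‖ ≤ K
  apply_congr : ∀ x ∈ cube d, ∀ y ∈ cube d, ∀ i, (∀ j ≤ i, x j = y j) → S x i = S y i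
  apply_of_mem_face : ∀ x ∈ cube d, ∀ i, x i = 0 ∨ x i = 1 → S x i = x i
  le_stdMatrix : ∀ x ∈ cube d, ∀ i, c ≤ stdMatrix (fderivWithin ℝ S (cube d) x) i i

namespace IsTriangular

variable {d : ℕ} {c K c' K' : ℝ} {S S' : E d → E d} {x y : E d} {i : Fin d} {s t : ℝ}

theorem differentiableOn (h : IsTriangular c K S) : DifferentiableOn ℝ S (cube d) :=
  h.contDiffOn.differentiableOn one_ne_zero

theorem hasFDerivWithinAt (h : IsTriangular c K S) (hx : x ∈ cube d) :
    HasFDerivWithinAt S (fderivWithin ℝ S (cube d) x) (cube d) x :=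
  (h.differentiableOn x hx).hasFDerivWithinAt

theorem norm_sub_le (h : IsTriangular c K S) (hx : x ∈ cube d) (hy : y ∈ cube d) :
    ‖S x - S y‖ ≤ K * ‖x - y‖ :=
  (convex_cube d).norm_image_sub_le_of_norm_fderivWithin_le h.differentiableOn
    h.norm_fderivWithin_le hy hx

theorem lipschitzOnWith (h : IsTriangular c K T) : LipschitzOnWith K.toNNReal T (cube d) :=
  LipschitzOnWith.of_dist_le' fun x hx y hy => by
    simpa only [dist_eq_norm] using h.norm_sub_le hx hy

theorem isLowerTriangular (h : IsTriangular c K S) (hx : x ∈ cube d) :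
    (stdMatrix (fderivWithin ℝ S (cube d) x)).IsLowerTriangular :=
  isLowerTriangular_stdMatrix_fderivWithin h.differentiableOn h.apply_congr hx

theorem stdMatrix_pos (h : IsTriangular c K S) (hx : x ∈ cube d) (i : Fin d) :
    0 < stdMatrix (fderivWithin ℝ S (cube d) x) i i :=
  h.pos.trans_le (h.le_stdMatrix x hx i)

theorem stdMatrix_le (h : IsTriangular c K S) (hx : x ∈ cube d) (i : Fin d) :
    stdMatrix (fderivWithin ℝ S (cube d) x) i i ≤ K :=
  (le_abs_self _).trans ((abs_stdMatrix_le _ i i).trans (h.norm_fderivWithin_le x hx))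

theorem det_eq (h : IsTriangular c K S) (hx : x ∈ cube d) :
    (fderivWithin ℝ S (cube d) x).det = ∏ i, stdMatrix (fderivWithin ℝ S (cube d) x) i i := by
  rw [← det_stdMatrix, Matrix.det_of_isLowerTriangular _ (h.isLowerTriangular hx)]

theorem pow_le_det (h : IsTriangular c K S) (hx : x ∈ cube d) :
    c ^ d ≤ (fderivWithin ℝ S (cube d) x).det := by
  rw [h.det_eq hx]
  simpa using Finset.prod_le_prod (s := Finset.univ) (f := fun _ => c)
    (fun _ _ => h.pos.le) fun i _ => h.le_stdMatrix x hx i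

theorem mul_sub_le (h : IsTriangular c K S) (hx : x ∈ cube d) (i : Fin d)
    (hs : s ∈ Icc (0 : ℝ) 1) (ht : t ∈ Icc (0 : ℝ) 1) (hst : s ≤ t) :
    c * (t - s) ≤ S (setCoord x i t) i - S (setCoord x i s) i := by
  have hderiv : ∀ s ∈ Icc (0 : ℝ) 1, HasDerivWithinAt (fun s => S (setCoord x i s) i)
      (stdMatrix (fderivWithin ℝ S (cube d) (setCoord x i s)) i i) (Icc 0 1) s := fun s hs =>
    hasDerivWithinAt_apply_setCoord h.differentiableOn hx i i hs
  refine (convex_Icc (0 : ℝ) 1).mul_sub_le_image_sub_of_le_deriv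
    (fun s hs => (hderiv s hs).continuousWithinAt)
    (fun s hs => ((hderiv s (interior_subset hs)).differentiableWithinAt).mono interior_subset)
    (fun s hs => ?_) s hs t ht hst
  rw [((hderiv s (interior_subset hs)).hasDerivAt (mem_interior_iff_mem_nhds.1 hs)).deriv]
  exact h.le_stdMatrix _ (setCoord_mem_cube hx i (interior_subset hs)) i

theorem strictMonoOn_apply_setCoord (h : IsTriangular c K S) (hx : x ∈ cube d) (i : Fin d) :
    StrictMonoOn (fun s => S (setCoord x i s) i) (Icc 0 1) := fun _ hs _ ht hst =>
  sub_pos.1 ((mul_pos h.pos (sub_pos.2 hst)).trans_le (h.mul_sub_le hx i hs ht hst.le))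

theorem apply_setCoord_zero (h : IsTriangular c K S) (hx : x ∈ cube d) (i : Fin d) :
    S (setCoord x i 0) i = 0 := by
  simpa [setCoord_self] using
    h.apply_of_mem_face _ (setCoord_mem_cube hx i (by simp)) i (.inl (setCoord_self x i 0))

theorem apply_setCoord_one (h : IsTriangular c K S) (hx : x ∈ cube d) (i : Fin d) :
    S (setCoord x i 1) i = 1 := by
  simpa [setCoord_self] using
    h.apply_of_mem_face _ (setCoord_mem_cube hx i (by simp)) i (.inr (setCoord_self x i 1))

theorem mapsTo (h : IsTriangular c K S) : MapsTo S (cube d) (cube d) := by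
  intro x hx i
  have hmono := (h.strictMonoOn_apply_setCoord hx i).monotoneOn
  have hlow := hmono (by simp) (hx i) (hx i).1
  have hupp := hmono (hx i) (by simp) (hx i).2
  simp only [setCoord_eq, h.apply_setCoord_zero hx, h.apply_setCoord_one hx] at hlow hupp
  exact ⟨hlow, hupp⟩

theorem apply_eq_of_image_apply_eq (h : IsTriangular c K S) (hx : x ∈ cube d) (hy : y ∈ cube d)
    (i : Fin d) (hxy : ∀ j ≤ i, S x j = S y j) : x i = y i := by
  induction i using WellFoundedLT.induction with
  | ind i ih =>
    refine (h.strictMonoOn_apply_setCoord hx i).injOn (hx i) (hy i) ?_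
    simp only [setCoord_eq, hxy i le_rfl]
    refine h.apply_congr _ hy _ (setCoord_mem_cube hx i (hy i)) i fun j hj => ?_
    rcases hj.eq_or_lt with rfl | hlt
    · rw [setCoord_self]
    · rw [setCoord_of_ne _ hlt.ne, ih j hlt fun l hl => hxy l (hl.trans hj)]

theorem injOn (h : IsTriangular c K S) : InjOn S (cube d) := fun x hx y hy hxy => by
  ext i
  exact h.apply_eq_of_image_apply_eq hx hy i fun j _ => by rw [hxy]

theorem exists_apply_setCoord_eq (h : IsTriangular c K S) (hx : x ∈ cube d) (i : Fin d)
    (hs : s ∈ Icc (0 : ℝ) 1) : ∃ t ∈ Icc (0 : ℝ) 1, S (setCoord x i t) i = s := by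
  refine intermediate_value_Icc zero_le_one (fun t ht =>
    (hasDerivWithinAt_apply_setCoord h.differentiableOn hx i i ht).continuousWithinAt) ?_
  simpa only [h.apply_setCoord_zero hx, h.apply_setCoord_one hx] using hs

theorem surjOn (h : IsTriangular c K S) : SurjOn S (cube d) (cube d) := by
  intro z hz
  suffices key : ∀ k : ℕ, ∃ x ∈ cube d, ∀ i : Fin d, (i : ℕ) < k → S x i = z i by
    obtain ⟨x, hx, hxz⟩ := key d
    exact ⟨x, hx, by ext i; exact hxz i i.2⟩
  intro k
  induction k with
  | zero => exact ⟨0, fun _ => by simp, fun i hi => absurd hi (Nat.not_lt_zero _)⟩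
  | succ k ih =>
    obtain ⟨x, hx, hxz⟩ := ih
    by_cases hk : k < d
    · obtain ⟨s, hs, hsz⟩ := h.exists_apply_setCoord_eq hx ⟨k, hk⟩ (hz ⟨k, hk⟩)
      refine ⟨setCoord x ⟨k, hk⟩ s, setCoord_mem_cube hx _ hs, fun j hj => ?_⟩
      rcases Nat.lt_succ_iff_lt_or_eq.1 hj with hlt | rfl
      · rw [← hxz j hlt]
        exact h.apply_congr _ (setCoord_mem_cube hx _ hs) _ hx _ fun l hl =>
          setCoord_of_ne _ (Fin.ne_of_lt (lt_of_le_of_lt hl hlt)) _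
      · exact hsz
    · exact ⟨x, hx, fun j _ => hxz j (by omega)⟩

theorem mapsTo_invFunOn (h : IsTriangular c K S) :
    MapsTo (Function.invFunOn S (cube d)) (cube d) (cube d) :=
  h.surjOn.mapsTo_invFunOn

theorem rightInvOn_invFunOn (h : IsTriangular c K S) :
    RightInvOn (Function.invFunOn S (cube d)) S (cube d) :=
  h.surjOn.rightInvOn_invFunOn

theorem continuousOn_invFunOn (h : IsTriangular c K S) :
    ContinuousOn (Function.invFunOn S (cube d)) (cube d) :=
  continuousOn_of_isCompact_of_rightInvOn (isCompact_cube d) h.contDiffOn.continuousOn h.injOn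
    h.mapsTo_invFunOn h.rightInvOn_invFunOn

theorem det_ne_zero (h : IsTriangular c K S) (hx : x ∈ cube d) :
    (fderivWithin ℝ S (cube d) x).det ≠ 0 :=
  ((pow_pos h.pos d).trans_le (h.pow_le_det hx)).ne'

theorem hasFDerivWithinAt_invFunOn (h : IsTriangular c K S) (hy : y ∈ cube d) :
    HasFDerivWithinAt (Function.invFunOn S (cube d))
      (fderivWithin ℝ S (cube d) (Function.invFunOn S (cube d) y)).inverse (cube d) y :=
  hasFDerivWithinAt_inverse_of_rightInvOn (h.hasFDerivWithinAt (h.mapsTo_invFunOn hy))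
    (h.det_ne_zero (h.mapsTo_invFunOn hy)) (h.continuousOn_invFunOn y hy) h.mapsTo_invFunOn
    h.rightInvOn_invFunOn hy

theorem contDiffOn_invFunOn (h : IsTriangular c K S) :
    ContDiffOn ℝ 1 (Function.invFunOn S (cube d)) (cube d) :=
  contDiffOn_one_of_hasFDerivWithinAt (uniqueDiffOn_cube d)
    (fun _ hy => h.hasFDerivWithinAt_invFunOn hy) fun y hy =>
    (continuousAt_inverse_of_det_ne_zero
      (h.det_ne_zero (h.mapsTo_invFunOn hy))).comp_continuousWithinAt
      (f := fun y => fderivWithin ℝ S (cube d) (Function.invFunOn S (cube d) y))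
      ((h.contDiffOn.continuousOn_fderivWithin (uniqueDiffOn_cube d) le_rfl).comp
        h.continuousOn_invFunOn h.mapsTo_invFunOn y hy)

theorem invFunOn_apply_congr (h : IsTriangular c K S) (hx : x ∈ cube d) (hy : y ∈ cube d)
    (i : Fin d) (hxy : ∀ j ≤ i, x j = y j) :
    Function.invFunOn S (cube d) x i = Function.invFunOn S (cube d) y i :=
  h.apply_eq_of_image_apply_eq (h.mapsTo_invFunOn hx) (h.mapsTo_invFunOn hy) i fun j hj => by
    rw [h.rightInvOn_invFunOn hx, h.rightInvOn_invFunOn hy, hxy j hj]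

theorem invFunOn_apply_of_mem_face (h : IsTriangular c K S) (hy : y ∈ cube d)
    (hi : y i = 0 ∨ y i = 1) : Function.invFunOn S (cube d) y i = y i := by
  have hRy := h.mapsTo_invFunOn hy
  refine (h.strictMonoOn_apply_setCoord hRy i).injOn (hRy i) (hy i) ?_
  simp only [setCoord_eq, h.rightInvOn_invFunOn hy]
  rw [h.apply_of_mem_face _ (setCoord_mem_cube hRy i (hy i)) i (by rwa [setCoord_self]),
    setCoord_self]

theorem stdMatrix_fderivWithin_comp (h : IsTriangular c K S) (hx : x ∈ cube d)
    {B : E d →L[ℝ] E d} (hB : (stdMatrix B).IsLowerTriangular) (i : Fin d) :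
    stdMatrix (B.comp (fderivWithin ℝ S (cube d) x)) i i =
      stdMatrix B i i * stdMatrix (fderivWithin ℝ S (cube d) x) i i := by
  rw [stdMatrix_comp, mul_apply_self_of_isLowerTriangular hB (h.isLowerTriangular hx)]

theorem stdMatrix_fderivWithin_invFunOn (h : IsTriangular c K S) (hy : y ∈ cube d) (i : Fin d) :
    stdMatrix (fderivWithin ℝ (Function.invFunOn S (cube d)) (cube d) y) i i =
      (stdMatrix (fderivWithin ℝ S (cube d) (Function.invFunOn S (cube d) y)) i i)⁻¹ := by
  have hRy := h.mapsTo_invFunOn hy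
  have hlow : (stdMatrix (fderivWithin ℝ (Function.invFunOn S (cube d)) (cube d) y)
      ).IsLowerTriangular :=
    isLowerTriangular_stdMatrix_fderivWithin
      (h.contDiffOn_invFunOn.differentiableOn one_ne_zero)
      (fun x hx y hy i hxy => h.invFunOn_apply_congr hx hy i hxy) hy
  refine eq_inv_of_mul_eq_one_left ?_
  rw [← h.stdMatrix_fderivWithin_comp hRy hlow,
    (h.hasFDerivWithinAt_invFunOn hy).fderivWithin (uniqueDiffOn_cube d y hy),
    inverse_comp_self_of_det_ne_zero (h.det_ne_zero hRy), stdMatrix_id, Matrix.one_apply_eq]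

theorem exists_isTriangular_invFunOn (d : ℕ) {c : ℝ} (hc : 0 < c) (K : ℝ) :
    ∃ c' > 0, ∃ K', ∀ S : E d → E d, IsTriangular c K S →
      IsTriangular c' K' (Function.invFunOn S (cube d)) := by
  obtain ⟨A, hA⟩ := exists_norm_inverse_le (E d) K (pow_pos hc d)
  refine ⟨(max 1 K)⁻¹, by positivity, A, fun S h => ?_⟩
  exact
    { pos := inv_pos.2 (zero_lt_one.trans_le (le_max_left _ _))
      contDiffOn := h.contDiffOn_invFunOn
      norm_fderivWithin_le := fun y hy => by
        have hRy := h.mapsTo_invFunOn hy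
        rw [(h.hasFDerivWithinAt_invFunOn hy).fderivWithin (uniqueDiffOn_cube d y hy)]
        exact hA _ (h.norm_fderivWithin_le _ hRy) (h.pow_le_det hRy)
      apply_congr := fun x hx y hy i hxy => h.invFunOn_apply_congr hx hy i hxy
      apply_of_mem_face := fun y hy i hi => h.invFunOn_apply_of_mem_face hy hi
      le_stdMatrix := fun y hy i => by
        rw [h.stdMatrix_fderivWithin_invFunOn hy]
        exact inv_anti₀ (h.stdMatrix_pos (h.mapsTo_invFunOn hy) i)
          ((h.stdMatrix_le (h.mapsTo_invFunOn hy) i).trans (le_max_right _ _)) }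

theorem comp (h : IsTriangular c K S) (h' : IsTriangular c' K' S') :
    IsTriangular (c * c') (K * K') (S ∘ S') := by
  have hderiv : ∀ x ∈ cube d, fderivWithin ℝ (S ∘ S') (cube d) x =
      (fderivWithin ℝ S (cube d) (S' x)).comp (fderivWithin ℝ S' (cube d) x) := fun x hx =>
    ((h.hasFDerivWithinAt (h'.mapsTo hx)).comp x (h'.hasFDerivWithinAt hx) h'.mapsTo).fderivWithin
      (uniqueDiffOn_cube d x hx)
  exact
    { pos := mul_pos h.pos h'.pos
      contDiffOn := h.contDiffOn.comp h'.contDiffOn h'.mapsTo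
      norm_fderivWithin_le := fun x hx => by
        have hx' := h.norm_fderivWithin_le _ (h'.mapsTo hx)
        rw [hderiv x hx]
        exact (ContinuousLinearMap.opNorm_comp_le _ _).trans (mul_le_mul hx'
          (h'.norm_fderivWithin_le x hx) (norm_nonneg _) ((norm_nonneg _).trans hx'))
      apply_congr := fun x hx y hy i hxy =>
        h.apply_congr _ (h'.mapsTo hx) _ (h'.mapsTo hy) i fun j hj =>
          h'.apply_congr x hx y hy j fun l hl => hxy l (hl.trans hj)
      apply_of_mem_face := fun x hx i hi => by
        have hx' := h'.apply_of_mem_face x hx i hi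
        rw [Function.comp_apply, h.apply_of_mem_face _ (h'.mapsTo hx) i (by rwa [hx']), hx']
      le_stdMatrix := fun x hx i => by
        rw [hderiv x hx, h'.stdMatrix_fderivWithin_comp hx (h.isLowerTriangular (h'.mapsTo hx))]
        exact mul_le_mul (h.le_stdMatrix _ (h'.mapsTo hx) i) (h'.le_stdMatrix x hx i) h'.pos.le
          (h.stdMatrix_pos (h'.mapsTo hx) i).le }

theorem congr (h : IsTriangular c K S) (he : EqOn S' S (cube d)) : IsTriangular c K S' where
  pos := h.pos
  contDiffOn := h.contDiffOn.congr he
  norm_fderivWithin_le x hx := by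
    rw [fderivWithin_congr he (he hx)]; exact h.norm_fderivWithin_le x hx
  apply_congr x hx y hy i hxy := by rw [he hx, he hy]; exact h.apply_congr x hx y hy i hxy
  apply_of_mem_face x hx i hi := by rw [he hx]; exact h.apply_of_mem_face x hx i hi
  le_stdMatrix x hx i := by rw [fderivWithin_congr he (he hx)]; exact h.le_stdMatrix x hx i

theorem hasFDerivWithinAt_interp (h : IsTriangular c K S) (t : ℝ) (hx : x ∈ cube d) :
    HasFDerivWithinAt (interp S t) ((1 - t) • ContinuousLinearMap.id ℝ (E d) +
      t • fderivWithin ℝ S (cube d) x) (cube d) x :=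
  ((hasFDerivWithinAt_id x _).const_smul (1 - t)).add ((h.hasFDerivWithinAt hx).const_smul t)

theorem stdMatrix_fderivWithin_interp (h : IsTriangular c K S) (t : ℝ) (hx : x ∈ cube d)
    (i : Fin d) : stdMatrix (fderivWithin ℝ (interp S t) (cube d) x) i i =
      1 + t * (stdMatrix (fderivWithin ℝ S (cube d) x) i i - 1) := by
  rw [(h.hasFDerivWithinAt_interp t hx).fderivWithin (uniqueDiffOn_cube d x hx)]
  simp [stdMatrix_apply]
  ring

theorem interp (h : IsTriangular c K S) (ht : t ∈ Icc (0 : ℝ) 1) :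
    IsTriangular (min 1 c) (1 + K) (interp S t) where
  pos := lt_min zero_lt_one h.pos
  contDiffOn := by
    have hid : ContDiffOn ℝ 1 (fun x : E d => x) (cube d) := contDiffOn_id
    exact (hid.const_smul (1 - t)).add (h.contDiffOn.const_smul t)
  norm_fderivWithin_le x hx := by
    rw [(h.hasFDerivWithinAt_interp t hx).fderivWithin (uniqueDiffOn_cube d x hx)]
    refine (norm_add_le _ _).trans (add_le_add ?_ ?_)
    · rw [norm_smul, Real.norm_of_nonneg (sub_nonneg.2 ht.2)]
      exact mul_le_one₀ (by linarith [ht.1]) (norm_nonneg _) ContinuousLinearMap.norm_id_le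
    · rw [norm_smul, Real.norm_of_nonneg ht.1]
      exact (mul_le_of_le_one_left (norm_nonneg _) ht.2).trans (h.norm_fderivWithin_le x hx)
  apply_congr x hx y hy i hxy := by
    simp only [KRFlow.interp, PiLp.add_apply, PiLp.smul_apply]
    rw [hxy i le_rfl, h.apply_congr x hx y hy i hxy]
  apply_of_mem_face x hx i hi := by
    simp only [KRFlow.interp, PiLp.add_apply, PiLp.smul_apply, smul_eq_mul]
    rw [h.apply_of_mem_face x hx i hi]
    ring
  le_stdMatrix x hx i := by
    rw [h.stdMatrix_fderivWithin_interp t hx]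
    have hconvex : 1 + t * (stdMatrix (fderivWithin ℝ S (cube d) x) i i - 1) =
        (1 - t) * 1 + t * stdMatrix (fderivWithin ℝ S (cube d) x) i i := by ring
    rw [hconvex]
    calc min 1 c = (1 - t) * min 1 c + t * min 1 c := by ring
      _ ≤ _ := add_le_add
        (mul_le_mul_of_nonneg_left (min_le_left _ _) (sub_nonneg.2 ht.2))
        (mul_le_mul_of_nonneg_left ((min_le_right _ _).trans (h.le_stdMatrix x hx i)) ht.1)

end IsTriangular

end TriangularMaps

section BoundedC1

variable {X Y : Type*} [NormedAddCommGroup X] [NormedSpace ℝ X] [NormedAddCommGroup Y]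
  [NormedSpace ℝ Y] {S : Set X} {a a' b b' c : ℝ}

/-- `f` is `C¹` on `S`, with `‖f‖ ≤ a` and `‖f'‖ ≤ b` there. It keeps track of the constants in the
estimates for densities, which have to be uniform. -/
structure IsC1BoundedOn (S : Set X) (a b : ℝ) (f : X → Y) : Prop where
  contDiffOn : ContDiffOn ℝ 1 f S
  norm_le : ∀ x ∈ S, ‖f x‖ ≤ a
  norm_fderivWithin_le : ∀ x ∈ S, ‖fderivWithin ℝ f S x‖ ≤ b

namespace IsC1BoundedOn

theorem hasFDerivWithinAt {f : X → Y} (hf : IsC1BoundedOn S a b f) {x : X} (hx : x ∈ S) :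
    HasFDerivWithinAt f (fderivWithin ℝ f S x) S x :=
  (hf.contDiffOn.differentiableOn one_ne_zero x hx).hasFDerivWithinAt

theorem congr {f g : X → Y} (hf : IsC1BoundedOn S a b f) (hfg : EqOn g f S) :
    IsC1BoundedOn S a b g where
  contDiffOn := hf.contDiffOn.congr hfg
  norm_le x hx := (hfg hx).symm ▸ hf.norm_le x hx
  norm_fderivWithin_le x hx := by
    rw [fderivWithin_congr hfg (hfg hx)]
    exact hf.norm_fderivWithin_le x hx

theorem norm_sub_le {f : X → Y} (hf : IsC1BoundedOn S a b f) (hS : Convex ℝ S) {x y : X}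
    (hx : x ∈ S) (hy : y ∈ S) : ‖f x - f y‖ ≤ b * ‖x - y‖ :=
  hS.norm_image_sub_le_of_norm_fderivWithin_le (hf.contDiffOn.differentiableOn one_ne_zero)
    hf.norm_fderivWithin_le hy hx

theorem lipschitzOnWith {f : X → Y} (hf : IsC1BoundedOn S a b f) (hS : Convex ℝ S) :
    LipschitzOnWith b.toNNReal f S :=
  LipschitzOnWith.of_dist_le' fun x hx y hy => by
    simpa only [dist_eq_norm] using hf.norm_sub_le hS hx hy

theorem sub {f g : X → Y} (hf : IsC1BoundedOn S a b f) (hg : IsC1BoundedOn S a' b' g)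
    (hS : UniqueDiffOn ℝ S) : IsC1BoundedOn S (a + a') (b + b') fun x => f x - g x where
  contDiffOn := hf.contDiffOn.sub hg.contDiffOn
  norm_le x hx :=
    (_root_.norm_sub_le _ _).trans (add_le_add (hf.norm_le x hx) (hg.norm_le x hx))
  norm_fderivWithin_le x hx := by
    rw [((hf.hasFDerivWithinAt hx).fun_sub (hg.hasFDerivWithinAt hx)).fderivWithin (hS x hx)]
    exact (_root_.norm_sub_le _ _).trans
      (add_le_add (hf.norm_fderivWithin_le x hx) (hg.norm_fderivWithin_le x hx))

theorem comp {Z : Type*} [NormedAddCommGroup Z] [NormedSpace ℝ Z] {R : Set Z} {f : X → Y}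
    {T : Z → X} (hf : IsC1BoundedOn S a b f) (hR : UniqueDiffOn ℝ R) (hT : ContDiffOn ℝ 1 T R)
    (hTc : ∀ z ∈ R, ‖fderivWithin ℝ T R z‖ ≤ c) (hmaps : MapsTo T R S) :
    IsC1BoundedOn R a (b * c) fun z => f (T z) where
  contDiffOn := hf.contDiffOn.comp hT hmaps
  norm_le z hz := hf.norm_le _ (hmaps hz)
  norm_fderivWithin_le z hz := by
    have hderiv := (hf.hasFDerivWithinAt (hmaps hz)).comp z
      (hT.differentiableOn one_ne_zero z hz).hasFDerivWithinAt hmaps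
    rw [show fderivWithin ℝ (fun z => f (T z)) R z = _ from hderiv.fderivWithin (hR z hz)]
    exact (ContinuousLinearMap.opNorm_comp_le _ _).trans <|
      mul_le_mul (hf.norm_fderivWithin_le _ (hmaps hz)) (hTc z hz) (norm_nonneg _)
        ((norm_nonneg _).trans (hf.norm_fderivWithin_le _ (hmaps hz)))

variable {f g : X → ℝ}

theorem mul (hf : IsC1BoundedOn S a b f) (hg : IsC1BoundedOn S a' b' g) (hS : UniqueDiffOn ℝ S) :
    IsC1BoundedOn S (a * a') (a * b' + a' * b) fun x => f x * g x where
  contDiffOn := hf.contDiffOn.mul hg.contDiffOn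
  norm_le x hx := (norm_mul _ _).trans_le <| mul_le_mul (hf.norm_le x hx) (hg.norm_le x hx)
    (norm_nonneg _) ((norm_nonneg _).trans (hf.norm_le x hx))
  norm_fderivWithin_le x hx := by
    have hderiv := (hf.hasFDerivWithinAt hx).mul (hg.hasFDerivWithinAt hx)
    rw [show fderivWithin ℝ (fun x => f x * g x) S x = _ from hderiv.fderivWithin (hS x hx)]
    refine (norm_add_le _ _).trans (add_le_add ?_ ?_) <;> rw [norm_smul]
    · exact mul_le_mul (hf.norm_le x hx) (hg.norm_fderivWithin_le x hx) (norm_nonneg _)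
        ((norm_nonneg _).trans (hf.norm_le x hx))
    · exact mul_le_mul (hg.norm_le x hx) (hf.norm_fderivWithin_le x hx) (norm_nonneg _)
        ((norm_nonneg _).trans (hg.norm_le x hx))

theorem inv (hf : IsC1BoundedOn S a b f) (hS : UniqueDiffOn ℝ S) (hc : 0 < c)
    (hfc : ∀ x ∈ S, c ≤ f x) : IsC1BoundedOn S c⁻¹ ((c ^ 2)⁻¹ * b) fun x => (f x)⁻¹ where
  contDiffOn := hf.contDiffOn.inv fun x hx => (hc.trans_le (hfc x hx)).ne'
  norm_le x hx := by
    rw [norm_inv, Real.norm_of_nonneg (hc.le.trans (hfc x hx))]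
    exact inv_anti₀ hc (hfc x hx)
  norm_fderivWithin_le x hx := by
    have hderiv := (hasDerivAt_inv (hc.trans_le (hfc x hx)).ne').comp_hasFDerivWithinAt x
      (hf.hasFDerivWithinAt hx)
    rw [show fderivWithin ℝ (fun x => (f x)⁻¹) S x = _ from hderiv.fderivWithin (hS x hx),
      norm_smul, norm_neg, norm_inv, norm_pow, Real.norm_of_nonneg (hc.le.trans (hfc x hx))]
    exact mul_le_mul (inv_anti₀ (by positivity) (pow_le_pow_left₀ hc.le (hfc x hx) 2))
      (hf.norm_fderivWithin_le x hx) (norm_nonneg _) (by positivity)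

end IsC1BoundedOn

end BoundedC1

section Averages

variable {Ω X Y : Type*} [MeasurableSpace Ω] [NormedAddCommGroup X] [NormedAddCommGroup Y]
  {μ : Measure Ω} {S : Set X}

theorem integrable_comp_of_continuousOn [MeasurableSpace X] [BorelSpace X]
    [SecondCountableTopologyEither X Y] [IsFiniteMeasure μ] {f : X → Y} (hS : IsCompact S)
    (hf : ContinuousOn f S) {φ : Ω → X} (hφ : AEMeasurable φ μ) (hφS : ∀ᵐ ω ∂μ, φ ω ∈ S) :
    Integrable (fun ω => f (φ ω)) μ := by
  obtain ⟨C, hC⟩ := hS.exists_bound_of_continuousOn hf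
  have hmap : (μ.map φ).restrict S = μ.map φ := Measure.restrict_eq_self_of_ae_mem
    ((ae_map_iff hφ hS.measurableSet).2 hφS)
  have hmeas : AEStronglyMeasurable f (μ.map φ) := by
    rw [← hmap]
    exact hf.aestronglyMeasurable hS.measurableSet
  exact Integrable.of_bound (hmeas.comp_aemeasurable hφ) C (hφS.mono fun ω hω => hC _ hω)

variable [NormedSpace ℝ X] [NormedSpace ℝ Y] [IsProbabilityMeasure μ] {F : Ω → X → Y} {L : ℝ}

-- Dominated convergence: the first-order remainders divided by `‖y - x‖` are bounded by `2 * L`.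
theorem hasFDerivWithinAt_integral_of_norm_fderivWithin_le (hS : Convex ℝ S)
    (hint : ∀ x ∈ S, Integrable (fun ω => F ω x) μ)
    (hmeas : ∀ x ∈ S, AEStronglyMeasurable (fun ω => fderivWithin ℝ (F ω) S x) μ)
    (hdiff : ∀ᵐ ω ∂μ, DifferentiableOn ℝ (F ω) S)
    (hL : ∀ᵐ ω ∂μ, ∀ x ∈ S, ‖fderivWithin ℝ (F ω) S x‖ ≤ L) {x : X} (hx : x ∈ S) :
    HasFDerivWithinAt (fun x => ∫ ω, F ω x ∂μ) (∫ ω, fderivWithin ℝ (F ω) S x ∂μ) S x := by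
  have hint' : Integrable (fun ω => fderivWithin ℝ (F ω) S x) μ :=
    Integrable.of_bound (hmeas x hx) L (hL.mono fun ω hω => hω x hx)
  have hrem : ∀ y ∈ S, Integrable
      (fun ω => F ω y - F ω x - fderivWithin ℝ (F ω) S x (y - x)) μ := fun y hy =>
    ((hint y hy).sub (hint x hx)).sub (hint'.apply_continuousLinearMap _)
  have hlim : Filter.Tendsto (fun y => ∫ ω, ‖y - x‖⁻¹ *
      ‖F ω y - F ω x - fderivWithin ℝ (F ω) S x (y - x)‖ ∂μ) (nhdsWithin x S)
      (nhds (∫ _, (0 : ℝ) ∂μ)) := by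
    refine tendsto_integral_filter_of_dominated_convergence (fun _ => L + L) ?_ ?_
      (integrable_const _) ?_
    · filter_upwards [self_mem_nhdsWithin] with y hy
      exact ((hrem y hy).norm.const_mul _).aestronglyMeasurable
    · filter_upwards [self_mem_nhdsWithin] with y hy
      filter_upwards [hdiff, hL] with ω hω hωL
      have hLip := hS.norm_image_sub_le_of_norm_fderivWithin_le hω hωL hx hy
      have hlin := (fderivWithin ℝ (F ω) S x).le_of_opNorm_le (hωL x hx) (y - x)
      rw [norm_mul, norm_inv, norm_norm, norm_norm]
      refine inv_mul_le_of_le_mul₀ (norm_nonneg _)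
        (by linarith [(norm_nonneg _).trans (hωL x hx)]) ?_
      linarith [norm_sub_le (F ω y - F ω x) (fderivWithin ℝ (F ω) S x (y - x))]
    · filter_upwards [hdiff] with ω hω
      exact hasFDerivWithinAt_iff_tendsto.1 (hω x hx).hasFDerivWithinAt
  rw [integral_zero] at hlim
  refine hasFDerivWithinAt_iff_tendsto.2 (squeeze_zero' (.of_forall fun y => by positivity) ?_ hlim)
  filter_upwards [self_mem_nhdsWithin] with y hy
  rw [integral_const_mul, ContinuousLinearMap.integral_apply hint',
    ← integral_sub (hint y hy) (hint x hx), ← integral_sub (f := fun ω => F ω y - F ω x)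
      ((hint y hy).sub (hint x hx)) (hint'.apply_continuousLinearMap _)]
  exact mul_le_mul_of_nonneg_left (norm_integral_le_integral_norm _) (by positivity)

theorem contDiffOn_one_integral (hS : Convex ℝ S) (hSu : UniqueDiffOn ℝ S)
    (hint : ∀ x ∈ S, Integrable (fun ω => F ω x) μ)
    (hmeas : ∀ x ∈ S, AEStronglyMeasurable (fun ω => fderivWithin ℝ (F ω) S x) μ)
    (hF : ∀ᵐ ω ∂μ, ContDiffOn ℝ 1 (F ω) S)
    (hL : ∀ᵐ ω ∂μ, ∀ x ∈ S, ‖fderivWithin ℝ (F ω) S x‖ ≤ L) :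
    ContDiffOn ℝ 1 (fun x => ∫ ω, F ω x ∂μ) S ∧
      ∀ x ∈ S, ‖fderivWithin ℝ (fun x => ∫ ω, F ω x ∂μ) S x‖ ≤ L := by
  have hderiv : ∀ x ∈ S, HasFDerivWithinAt (fun x => ∫ ω, F ω x ∂μ)
      (∫ ω, fderivWithin ℝ (F ω) S x ∂μ) S x := fun x hx =>
    hasFDerivWithinAt_integral_of_norm_fderivWithin_le hS hint hmeas
      (hF.mono fun ω hω => hω.differentiableOn one_ne_zero) hL hx
  refine ⟨contDiffOn_one_of_hasFDerivWithinAt hSu hderiv ?_, fun x hx => ?_⟩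
  · exact continuousOn_of_dominated (bound := fun _ => L) hmeas
      (fun x hx => hL.mono fun ω hω => hω x hx) (integrable_const L)
      (hF.mono fun ω hω => hω.continuousOn_fderivWithin hSu le_rfl)
  · rw [(hderiv x hx).fderivWithin (hSu x hx)]
    exact (norm_integral_le_of_norm_le_const (hL.mono fun ω hω => hω x hx)).trans_eq (by simp)

theorem IsC1BoundedOn.integral_comp_affine [FiniteDimensional ℝ X] [MeasurableSpace X]
    [BorelSpace X] {p : X → ℝ} {C : ℝ} (hp : IsC1BoundedOn S C L p) (hSc : IsCompact S)
    (hS : Convex ℝ S) (hSu : UniqueDiffOn ℝ S)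
    {A : Ω → X →L[ℝ] X} {b : Ω → X} (hA : AEStronglyMeasurable A μ) (hb : AEMeasurable b μ)
    (hA1 : ∀ᵐ ω ∂μ, ‖A ω‖ ≤ 1) (hAb : ∀ᵐ ω ∂μ, MapsTo (fun x => A ω x + b ω) S S) :
    IsC1BoundedOn S C L fun x => ∫ ω, p (A ω x + b ω) ∂μ := by
  have : ProperSpace X := FiniteDimensional.proper ℝ X
  have : ProperSpace (X →L[ℝ] ℝ) := FiniteDimensional.proper ℝ _
  have hmaps : ∀ x : X, AEMeasurable (fun ω => A ω x + b ω) μ := fun x =>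
    (hA.apply_continuousLinearMap x).aemeasurable.add hb
  have hderiv : ∀ ω, MapsTo (fun x => A ω x + b ω) S S → ∀ x ∈ S,
      fderivWithin ℝ (fun x => p (A ω x + b ω)) S x =
        (fderivWithin ℝ p S (A ω x + b ω)).comp (A ω) := fun ω hω x hx =>
    ((hp.hasFDerivWithinAt (hω hx)).comp x
      (((A ω).hasFDerivWithinAt).add_const (b ω)) hω).fderivWithin (hSu x hx)
  have hintegral := contDiffOn_one_integral (F := fun ω x => p (A ω x + b ω)) (L := L) hS hSu
    (fun x hx => integrable_comp_of_continuousOn hSc hp.contDiffOn.continuousOn (hmaps x)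
      (hAb.mono fun ω hω => hω hx)) (fun x hx => ?_) ?_ ?_
  · refine ⟨hintegral.1, fun x hx => ?_, hintegral.2⟩
    exact (norm_integral_le_of_norm_le_const
      (hAb.mono fun ω hω => hp.norm_le _ (hω hx))).trans_eq (by simp)
  · have h := (integrable_comp_of_continuousOn hSc
      (hp.contDiffOn.continuousOn_fderivWithin hSu le_rfl) (hmaps x)
      (hAb.mono fun ω hω => hω hx)).aestronglyMeasurable
    exact ((ContinuousLinearMap.compL ℝ X X ℝ).continuous₂.comp_aestronglyMeasurable₂ h hA).congr
      (hAb.mono fun ω hω => (hderiv ω hω x hx).symm)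
  · exact hAb.mono fun ω hω => hp.contDiffOn.comp
      ((A ω).contDiff.add contDiff_const).contDiffOn hω
  · filter_upwards [hAb, hA1] with ω hω hω1 x hx
    rw [hderiv ω hω x hx]
    exact (ContinuousLinearMap.opNorm_comp_le _ _).trans
      ((mul_le_of_le_one_right (norm_nonneg _) hω1).trans (hp.norm_fderivWithin_le _ (hω hx)))

end Averages

section Diagonal

variable {d : ℕ}

/-- The diagonal linear map with entries `a`; coordinatewise contractions of the cube are of this
form up to a translation. -/
noncomputable def diagMap (a : Fin d → ℝ) : E d →L[ℝ] E d :=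
  Matrix.toEuclideanCLM (𝕜 := ℝ) (Matrix.diagonal a)

theorem diagMap_apply (a : Fin d → ℝ) (x : E d) (i : Fin d) : diagMap a x i = a i * x i := by
  simp [diagMap, Matrix.mulVec_diagonal]

theorem norm_diagMap_le {a : Fin d → ℝ} (ha : ∀ i, |a i| ≤ 1) : ‖diagMap a‖ ≤ 1 := by
  refine ContinuousLinearMap.opNorm_le_bound _ zero_le_one fun x => ?_
  rw [one_mul, EuclideanSpace.norm_eq, EuclideanSpace.norm_eq]
  refine Real.sqrt_le_sqrt (Finset.sum_le_sum fun i _ => pow_le_pow_left₀ (norm_nonneg _) ?_ 2)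
  rw [diagMap_apply, norm_mul]
  exact mul_le_of_le_one_left (norm_nonneg _) (ha i)

theorem continuous_diagMap {Ω : Type*} [TopologicalSpace Ω] {a : Ω → Fin d → ℝ}
    (ha : Continuous a) : Continuous fun ω => diagMap (a ω) := by
  rw [continuous_clm_apply]
  intro x
  have happly : (fun ω => diagMap (a ω) x) = fun ω => WithLp.toLp 2 fun i => a ω i * x i := by
    ext ω i
    exact diagMap_apply (a ω) x i
  rw [happly]
  fun_prop

theorem splice_apply (k : ℕ) (x t : E d) (i : Fin d) :
    splice k x t i = if (i : ℕ) < k then x i else t i := rfl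

theorem splice_mem_cube (k : ℕ) {x t : E d} (hx : x ∈ cube d) (ht : t ∈ cube d) :
    splice k x t ∈ cube d := fun i => by
  rw [splice_apply]
  split_ifs
  exacts [hx i, ht i]

theorem splice_eq_diagMap (k : ℕ) (x t : E d) :
    splice k x t = diagMap (fun i => if (i : ℕ) < k then 1 else 0) x +
      diagMap (fun i => if (i : ℕ) < k then 0 else 1) t := by
  ext i
  simp only [PiLp.add_apply, diagMap_apply, splice_apply]
  split_ifs <;> simp

theorem continuous_splice (k : ℕ) (x : E d) : Continuous fun t => splice k x t := by
  simp_rw [splice_eq_diagMap]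
  fun_prop

theorem splice_congr {k : ℕ} {x y : E d} (h : ∀ i : Fin d, (i : ℕ) < k → x i = y i) (t : E d) :
    splice k x t = splice k y t := by
  ext i
  simp only [splice_apply]
  split_ifs with hi
  exacts [h i hi, rfl]

theorem setCoord_mul_eq_diagMap (x : E d) (i : Fin d) (u : ℝ) :
    setCoord x i (x i * u) = diagMap (Function.update 1 i u) x := by
  ext j
  rw [diagMap_apply, setCoord_apply, Function.update_apply]
  split_ifs with h
  · rw [h, mul_comm]
  · rw [Pi.one_apply, one_mul]

theorem splice_succ_setCoord (i : Fin d) (x t : E d) (s : ℝ) :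
    splice (i + 1) (setCoord x i s) t = splice i x (setCoord t i s) := by
  ext j
  simp only [splice_apply, setCoord_apply, Fin.ext_iff]
  split_ifs <;> first | rfl | omega

end Diagonal

section LebesgueOnCube

theorem measurePreserving_ofLp_cube (d : ℕ) :
    MeasurePreserving (WithLp.ofLp : E d → Fin d → ℝ) (volume.restrict (cube d))
      (Measure.pi fun _ => volume.restrict (Icc (0 : ℝ) 1)) := by
  have h := (PiLp.volume_preserving_ofLp (Fin d)).restrict_preimage
    (MeasurableSet.univ_pi fun _ : Fin d => measurableSet_Icc (a := (0 : ℝ)) (b := 1))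
  have hcube : (WithLp.ofLp : E d → Fin d → ℝ) ⁻¹' univ.pi (fun _ => Icc 0 1) = cube d :=
    (cube_eq_preimage d).symm
  rwa [hcube, volume_pi, Measure.restrict_pi_pi] at h

instance isProbabilityMeasure_Icc : IsProbabilityMeasure (volume.restrict (Icc (0 : ℝ) 1)) :=
  ⟨by simp⟩

instance isProbabilityMeasure_cube (d : ℕ) : IsProbabilityMeasure (volume.restrict (cube d)) := by
  constructor
  rw [← preimage_univ (f := (WithLp.ofLp : E d → Fin d → ℝ)),
    (measurePreserving_ofLp_cube d).measure_preimage MeasurableSet.univ.nullMeasurableSet]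
  exact measure_univ

theorem measurePreserving_update {ι : Type*} [Fintype ι] [DecidableEq ι] {X : ι → Type*}
    [∀ i, MeasurableSpace (X i)] (ν : ∀ i, Measure (X i)) [∀ i, IsProbabilityMeasure (ν i)]
    (i : ι) : MeasurePreserving (fun z : X i × (∀ j, X j) => Function.update z.2 i z.1)
      ((ν i).prod (Measure.pi ν)) (Measure.pi ν) := by
  have hmeas : Measurable (fun z : X i × (∀ j, X j) => Function.update z.2 i z.1) :=
    measurable_update'.comp measurable_swap
  refine ⟨hmeas, (Measure.pi_eq fun s hs => ?_).symm⟩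
  rw [Measure.map_apply hmeas (MeasurableSet.univ_pi hs)]
  have hpre : (fun z : X i × (∀ j, X j) => Function.update z.2 i z.1) ⁻¹' univ.pi s =
      s i ×ˢ univ.pi (Function.update s i univ) := by
    ext z
    simp only [mem_preimage, Set.mem_univ_pi, mem_prod]
    rw [Function.forall_update_iff z.2 (fun j y => y ∈ s j),
      Function.forall_update_iff s (fun j A => z.2 j ∈ A)]
    simp
  rw [hpre, Measure.prod_prod, Measure.pi_pi, ← Finset.mul_prod_erase _ _ (Finset.mem_univ i),
    ← Finset.mul_prod_erase Finset.univ (fun j => ν j (s j)) (Finset.mem_univ i),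
    Function.update_self, measure_univ, one_mul]
  congr 1
  refine Finset.prod_congr rfl fun j hj => ?_
  rw [Function.update_of_ne (Finset.ne_of_mem_erase hj)]

theorem measurePreserving_setCoord {d : ℕ} (i : Fin d) :
    MeasurePreserving (fun z : ℝ × E d => setCoord z.2 i z.1)
      ((volume.restrict (Icc (0 : ℝ) 1)).prod (volume.restrict (cube d)))
      (volume.restrict (cube d)) := by
  have htoLp : MeasurePreserving (WithLp.toLp 2 : (Fin d → ℝ) → E d)
      (Measure.pi fun _ => volume.restrict (Icc (0 : ℝ) 1)) (volume.restrict (cube d)) :=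
    (measurePreserving_ofLp_cube d).symm (MeasurableEquiv.toLp 2 (Fin d → ℝ)).symm
  exact htoLp.comp ((measurePreserving_update _ i).comp
    ((MeasurePreserving.id _).prod (measurePreserving_ofLp_cube d)))

end LebesgueOnCube

section Densities

section CNorm

variable {X Y : Type*} [NormedAddCommGroup X] [NormedSpace ℝ X] [NormedAddCommGroup Y]
  [NormedSpace ℝ Y] {n k : ℕ} {S : Set X} {f : X → Y} {C : ℝ} {x : X}

theorem enorm_iteratedFDerivWithin_le_cNorm (hn : n ≤ k) (f : X → Y) (hx : x ∈ S) :
    ‖iteratedFDerivWithin ℝ n f S x‖ₑ ≤ cNorm k S f :=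
  le_iSup₂_of_le n hn
    (le_iSup₂ (f := fun x (_ : x ∈ S) => ‖iteratedFDerivWithin ℝ n f S x‖ₑ) x hx)

theorem norm_iteratedFDerivWithin_le_of_cNorm_le (hn : n ≤ k) (hC : 0 ≤ C)
    (h : cNorm k S f ≤ ENNReal.ofReal C) (hx : x ∈ S) : ‖iteratedFDerivWithin ℝ n f S x‖ ≤ C := by
  rw [← ENNReal.ofReal_le_ofReal_iff hC, ofReal_norm]
  exact (enorm_iteratedFDerivWithin_le_cNorm hn f hx).trans h

theorem isC1BoundedOn_of_cNorm_le (hk : 1 ≤ k) (hS : UniqueDiffOn ℝ S) (hC : 0 ≤ C)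
    (hf : ContDiffOn ℝ 1 f S) (h : cNorm k S f ≤ ENNReal.ofReal C) : IsC1BoundedOn S C C f where
  contDiffOn := hf
  norm_le _ hx := norm_iteratedFDerivWithin_zero (𝕜 := ℝ) (f := f) (s := S) ▸
    norm_iteratedFDerivWithin_le_of_cNorm_le k.zero_le hC h hx
  norm_fderivWithin_le x hx := norm_iteratedFDerivWithin_one f (hS x hx) ▸
    norm_iteratedFDerivWithin_le_of_cNorm_le hk hC h hx

theorem IsC1BoundedOn.cNorm_one_le {a b : ℝ} (hf : IsC1BoundedOn S a b f)
    (hS : UniqueDiffOn ℝ S) : cNorm 1 S f ≤ ENNReal.ofReal (max a b) := by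
  refine iSup₂_le fun n hn => iSup₂_le fun x hx => ?_
  rw [← ofReal_norm]
  refine ENNReal.ofReal_le_ofReal ?_
  interval_cases n
  · rw [norm_iteratedFDerivWithin_zero]
    exact (hf.norm_le x hx).trans (le_max_left _ _)
  · rw [norm_iteratedFDerivWithin_one f (hS x hx)]
    exact (hf.norm_fderivWithin_le x hx).trans (le_max_right _ _)

end CNorm

variable {d : ℕ}

/-- A probability density on the cube, together with the bounds on it that the estimates
depend on. -/
structure IsC1Density (L₁ L₂ : ℝ) (p : E d → ℝ) : Prop where
  pos : 0 < L₂
  isC1BoundedOn : IsC1BoundedOn (cube d) L₁ L₁ p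
  ge : ∀ x ∈ cube d, L₂ ≤ p x
  integral_eq : ∫ x in cube d, p x = 1

theorem RegularDensity.isC1Density {k : ℕ} {L₁ L₂ : ℝ} {μ : Measure (E d)} {p : E d → ℝ}
    (h : RegularDensity k L₁ L₂ μ p) (hk : 1 ≤ k) (hL₁ : 0 ≤ L₁) (hL₂ : 0 < L₂) :
    IsC1Density L₁ L₂ p where
  pos := hL₂
  isC1BoundedOn := isC1BoundedOn_of_cNorm_le hk (uniqueDiffOn_cube d) hL₁
    (h.contDiffOn.of_le (by exact_mod_cast hk)) h.norm_le
  ge := h.lower_bound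
  integral_eq := by
    have hmass : μ univ = 1 := h.isProbabilityMeasure.measure_univ
    rw [h.eq_withDensity, withDensity_apply _ MeasurableSet.univ, Measure.restrict_univ] at hmass
    rw [integral_eq_lintegral_of_nonneg_ae, hmass, ENNReal.toReal_one]
    · exact (ae_restrict_mem (measurableSet_cube d)).mono fun x hx =>
        hL₂.le.trans (h.lower_bound x hx)
    · exact h.contDiffOn.continuousOn.aestronglyMeasurable (measurableSet_cube d)

section Marginals

variable {p : E d → ℝ} {k : ℕ} {i : Fin d} {x y : E d} {a b c : ℝ}

theorem marginal_congr (p : E d → ℝ) (h : ∀ i : Fin d, (i : ℕ) < k → x i = y i) :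
    marginal p k x = marginal p k y := by
  simp only [marginal, splice_congr h]

theorem condDensity_congr (p : E d → ℝ) (h : ∀ j < i, x j = y j) (s : ℝ) :
    condDensity p i x s = condDensity p i y s := by
  rw [condDensity, condDensity, marginal_congr p (k := i) fun j hj => h j hj,
    marginal_congr p (k := i + 1) (x := setCoord x i s) (y := setCoord y i s)]
  intro j hj
  rw [setCoord_apply, setCoord_apply]
  split_ifs with hji
  · rfl
  · exact h j (lt_of_le_of_ne (Nat.lt_succ_iff.1 hj) hji)

theorem condCDF_congr (p : E d → ℝ) (h : ∀ j < i, x j = y j) (s : ℝ) :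
    condCDF p i x s = condCDF p i y s := by
  simp only [condCDF, condDensity_congr p h]

theorem marginal_zero (p : E d → ℝ) (x : E d) : marginal p 0 x = ∫ t in cube d, p t := rfl

theorem marginal_self (p : E d → ℝ) (x : E d) : marginal p d x = p x := by
  have hsplice : ∀ t, splice d x t = x := fun t => by
    ext i
    rw [splice_apply, if_pos i.2]
  simp [marginal, hsplice]

theorem ae_splice_mem_cube (k : ℕ) (hx : x ∈ cube d) :
    ∀ᵐ t ∂volume.restrict (cube d), splice k x t ∈ cube d :=
  (ae_restrict_mem (measurableSet_cube d)).mono fun _ ht => splice_mem_cube k hx ht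

theorem integrable_splice (hp : ContinuousOn p (cube d)) (k : ℕ) (hx : x ∈ cube d) :
    IntegrableOn (fun t => p (splice k x t)) (cube d) :=
  integrable_comp_of_continuousOn (isCompact_cube d) hp (continuous_splice k x).aemeasurable
    (ae_splice_mem_cube k hx)

theorem le_integral_of_ae_le {Ω : Type*} [MeasurableSpace Ω] {μ : Measure Ω}
    [IsProbabilityMeasure μ] {f : Ω → ℝ} (hf : Integrable f μ) (h : ∀ᵐ ω ∂μ, c ≤ f ω) :
    c ≤ ∫ ω, f ω ∂μ := by
  simpa using integral_mono_ae (integrable_const c) hf h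

theorem le_marginal (hp : ContinuousOn p (cube d)) (hc : ∀ x ∈ cube d, c ≤ p x) (k : ℕ)
    (hx : x ∈ cube d) : c ≤ marginal p k x :=
  le_integral_of_ae_le (integrable_splice hp k hx)
    ((ae_splice_mem_cube k hx).mono fun _ => hc _)

theorem IsC1BoundedOn.marginal (h : IsC1BoundedOn (cube d) a b p) (k : ℕ) :
    IsC1BoundedOn (cube d) a b (marginal p k) := by
  unfold KRFlow.marginal
  simp_rw [splice_eq_diagMap]
  refine h.integral_comp_affine (A := fun _ => diagMap _) (isCompact_cube d) (convex_cube d)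
    (uniqueDiffOn_cube d) aestronglyMeasurable_const (ContinuousLinearMap.measurable _).aemeasurable
    (.of_forall fun _ => norm_diagMap_le fun i => by split_ifs <;> simp) ?_
  filter_upwards [ae_restrict_mem (measurableSet_cube d)] with t ht x hx
  simpa only [← splice_eq_diagMap] using splice_mem_cube k hx ht

-- Fubini: integrating out the `i`-th coordinate separately does not change the integral over the
-- cube of a function of `(t_i, …, t_{d-1})`.
theorem integral_marginal_setCoord (hp : ContinuousOn p (cube d)) (i : Fin d) (hx : x ∈ cube d) :
    ∫ s in (0 : ℝ)..1, marginal p (i + 1) (setCoord x i s) = marginal p i x := by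
  have hmp := measurePreserving_setCoord i
  have hint : Integrable (fun t => p (splice i x t)) (volume.restrict (cube d)) :=
    integrable_splice hp i hx
  rw [← hmp.map_eq] at hint
  rw [intervalIntegral.integral_of_le zero_le_one, ← integral_Icc_eq_integral_Ioc]
  simp only [marginal, splice_succ_setCoord]
  rw [← integral_prod (fun ω : ℝ × E d => p (splice i x (setCoord ω.2 i ω.1)))
      (hint.comp_aemeasurable hmp.aemeasurable),
    ← integral_map hmp.aemeasurable hint.aestronglyMeasurable, hmp.map_eq]

/-- The mean value of the `i`-th marginal on the segment from `(x_0, …, x_{i-1}, 0)` to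
`(x_0, …, x_i)`. It replaces the integral from `0` to `x_i` in the conditional distribution
function by one over a fixed interval. -/
noncomputable def innerMean (p : E d → ℝ) (i : Fin d) (x : E d) : ℝ :=
  ∫ u in Icc (0 : ℝ) 1, marginal p (i + 1) (setCoord x i (x i * u))

theorem setCoord_mul_mem_cube (i : Fin d) (hx : x ∈ cube d) {u : ℝ} (hu : u ∈ Icc (0 : ℝ) 1) :
    setCoord x i (x i * u) ∈ cube d :=
  setCoord_mem_cube hx i ⟨mul_nonneg (hx i).1 hu.1, mul_le_one₀ (hx i).2 hu.1 hu.2⟩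

theorem IsC1BoundedOn.innerMean (h : IsC1BoundedOn (cube d) a b p) (i : Fin d) :
    IsC1BoundedOn (cube d) a b (innerMean p i) := by
  have hmem : ∀ᵐ u ∂volume.restrict (Icc (0 : ℝ) 1), u ∈ Icc (0 : ℝ) 1 :=
    ae_restrict_mem measurableSet_Icc
  have hdiag : Continuous fun u : ℝ => diagMap (Function.update (1 : Fin d → ℝ) i u) :=
    continuous_diagMap (continuous_const.update i continuous_id)
  refine ((h.marginal (i + 1)).integral_comp_affine (b := fun _ => 0) (isCompact_cube d)
    (convex_cube d) (uniqueDiffOn_cube d) hdiag.aestronglyMeasurable aemeasurable_const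
    (hmem.mono fun u hu => norm_diagMap_le fun j => ?_) (hmem.mono fun u hu x hx => ?_)).congr
    fun x _ => ?_
  · rw [Function.update_apply]
    split_ifs
    · exact abs_le.2 ⟨by linarith [hu.1], hu.2⟩
    · simp
  · simpa only [add_zero, ← setCoord_mul_eq_diagMap] using setCoord_mul_mem_cube i hx hu
  · simp only [KRFlow.innerMean, setCoord_mul_eq_diagMap, add_zero]

theorem condCDF_eq (p : E d → ℝ) (i : Fin d) (x : E d) :
    condCDF p i x (x i) = x i * innerMean p i x * (marginal p i x)⁻¹ := by
  simp only [condCDF, condDensity, intervalIntegral.integral_div, innerMean]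
  rw [integral_Icc_eq_integral_Ioc, ← intervalIntegral.integral_of_le zero_le_one,
    intervalIntegral.mul_integral_comp_mul_left
      (f := fun τ => marginal p (i + 1) (setCoord x i τ)), mul_zero, mul_one, div_eq_mul_inv]

end Marginals

namespace IsC1Density

variable {L₁ L₂ : ℝ} {p : E d → ℝ}

theorem continuousOn (h : IsC1Density L₁ L₂ p) : ContinuousOn p (cube d) :=
  h.isC1BoundedOn.contDiffOn.continuousOn

theorem le_marginal (h : IsC1Density L₁ L₂ p) (k : ℕ) {x : E d} (hx : x ∈ cube d) :
    L₂ ≤ marginal p k x :=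
  KRFlow.le_marginal h.continuousOn h.ge k hx

theorem marginal_pos (h : IsC1Density L₁ L₂ p) (k : ℕ) {x : E d} (hx : x ∈ cube d) :
    0 < marginal p k x :=
  h.pos.trans_le (h.le_marginal k hx)

theorem marginal_le (h : IsC1Density L₁ L₂ p) (k : ℕ) {x : E d} (hx : x ∈ cube d) :
    marginal p k x ≤ L₁ :=
  (le_abs_self _).trans ((h.isC1BoundedOn.marginal k).norm_le x hx)

theorem pos_left (h : IsC1Density L₁ L₂ p) : 0 < L₁ :=
  have hzero : (0 : E d) ∈ cube d := fun _ => ⟨le_rfl, zero_le_one⟩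
  (h.marginal_pos 0 hzero).trans_le (h.marginal_le 0 hzero)

end IsC1Density

end Densities

section Rosenblatt

variable {d : ℕ} {L₁ L₂ : ℝ} {p q : E d → ℝ}

/-- The Rosenblatt transform of a density: the map of the cube whose `i`-th component is the
conditional distribution function of the `i`-th coordinate. -/
noncomputable def rosenblatt (p : E d → ℝ) (x : E d) : E d :=
  WithLp.toLp 2 fun i => condCDF p i x (x i)

theorem rosenblatt_apply (p : E d → ℝ) (x : E d) (i : Fin d) :
    rosenblatt p x i = condCDF p i x (x i) := rfl

theorem rosenblatt_setCoord_apply (p : E d → ℝ) (x : E d) (i : Fin d) (s : ℝ) :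
    rosenblatt p (setCoord x i s) i = condCDF p i x s := by
  rw [rosenblatt_apply, setCoord_self]
  exact condCDF_congr p (fun j hj => setCoord_of_ne x hj.ne s) s

/-- The density at `x_i` of the `i`-th coordinate conditioned on the preceding ones, as a function
of `x`. These are the diagonal entries of the derivative of the Rosenblatt transform. -/
noncomputable def diagDensity (p : E d → ℝ) (i : Fin d) (x : E d) : ℝ :=
  marginal p (i + 1) x / marginal p i x

theorem condDensity_apply_self (p : E d → ℝ) (i : Fin d) (x : E d) :
    condDensity p i x (x i) = diagDensity p i x := by
  rw [condDensity, setCoord_eq, diagDensity]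

theorem contDiffOn_and_norm_fderivWithin_le_of_apply {X : Type*} [NormedAddCommGroup X]
    [NormedSpace ℝ X] {S : Set X} {f : X → E d} {a b : ℝ} (hS : UniqueDiffOn ℝ S)
    (hf : ∀ i, IsC1BoundedOn S a b fun x => f x i) :
    ContDiffOn ℝ 1 f S ∧ ∀ x ∈ S, ‖fderivWithin ℝ f S x‖ ≤ d * b := by
  have hfC : ContDiffOn ℝ 1 f S := contDiffOn_euclidean.2 fun i => (hf i).contDiffOn
  refine ⟨hfC, fun x hx => ?_⟩
  rcases d.eq_zero_or_pos with rfl | hd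
  · rw [show fderivWithin ℝ f S x = 0 from Subsingleton.elim _ _, norm_zero, Nat.cast_zero,
      zero_mul]
  have hb : 0 ≤ b := (norm_nonneg _).trans ((hf ⟨0, hd⟩).norm_fderivWithin_le x hx)
  refine ContinuousLinearMap.opNorm_le_bound _ (by positivity) fun v => ?_
  rw [mul_assoc]
  refine norm_le_of_abs_apply_le fun i => ?_
  have hcomp := ((EuclideanSpace.proj i : E d →L[ℝ] ℝ).hasFDerivAt.comp_hasFDerivWithinAt x
    (hfC.differentiableOn one_ne_zero x hx).hasFDerivWithinAt).fderivWithin (hS x hx)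
  have happly : fderivWithin ℝ f S x v i = fderivWithin ℝ (fun x => f x i) S x v :=
    (DFunLike.congr_fun hcomp v).symm
  rw [happly]
  exact ContinuousLinearMap.le_of_opNorm_le _ ((hf i).norm_fderivWithin_le x hx) v

namespace IsC1Density

theorem continuousOn_condDensity (h : IsC1Density L₁ L₂ p) (i : Fin d) {x : E d}
    (hx : x ∈ cube d) : ContinuousOn (condDensity p i x) (Icc 0 1) :=
  ((h.isC1BoundedOn.marginal (i + 1)).contDiffOn.continuousOn.comp
    (fun s _ => (hasDerivAt_setCoord x i s).continuousAt.continuousWithinAt)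
    fun _ hs => setCoord_mem_cube hx i hs).div_const _

theorem hasDerivWithinAt_condCDF (h : IsC1Density L₁ L₂ p) (i : Fin d) {x : E d}
    (hx : x ∈ cube d) {s : ℝ} (hs : s ∈ Icc (0 : ℝ) 1) :
    HasDerivWithinAt (condCDF p i x) (condDensity p i x s) (Icc 0 1) s := by
  have : Fact (s ∈ Icc (0 : ℝ) 1) := ⟨hs⟩
  have hcont := h.continuousOn_condDensity i hx
  refine intervalIntegral.integral_hasDerivWithinAt_right ?_
    (hcont.stronglyMeasurableAtFilter_nhdsWithin measurableSet_Icc s) (hcont s hs)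
  exact (hcont.mono (uIcc_subset_Icc (by simp) hs)).intervalIntegrable

theorem condCDF_one (h : IsC1Density L₁ L₂ p) (i : Fin d) {x : E d} (hx : x ∈ cube d) :
    condCDF p i x 1 = 1 := by
  simp only [condCDF, condDensity, intervalIntegral.integral_div]
  rw [integral_marginal_setCoord h.continuousOn i hx, div_self (h.marginal_pos i hx).ne']

theorem isC1BoundedOn_marginal_div (h : IsC1Density L₁ L₂ p) (k l : ℕ) :
    IsC1BoundedOn (cube d) (L₁ * L₂⁻¹) (L₁ * ((L₂ ^ 2)⁻¹ * L₁) + L₂⁻¹ * L₁)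
      fun x => marginal p k x / marginal p l x := by
  simp_rw [div_eq_mul_inv]
  exact (h.isC1BoundedOn.marginal k).mul ((h.isC1BoundedOn.marginal l).inv (uniqueDiffOn_cube d)
    h.pos fun x hx => h.le_marginal l hx) (uniqueDiffOn_cube d)

theorem div_le_diagDensity (h : IsC1Density L₁ L₂ p) (i : Fin d) {x : E d} (hx : x ∈ cube d) :
    L₂ / L₁ ≤ diagDensity p i x :=
  div_le_div₀ (h.marginal_pos _ hx).le (h.le_marginal _ hx) (h.marginal_pos _ hx)
    (h.marginal_le _ hx)

theorem diagDensity_ne_zero (h : IsC1Density L₁ L₂ p) (i : Fin d) {x : E d} (hx : x ∈ cube d) :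
    diagDensity p i x ≠ 0 :=
  (div_pos (h.marginal_pos _ hx) (h.marginal_pos _ hx)).ne'

theorem prod_diagDensity (h : IsC1Density L₁ L₂ p) {x : E d} (hx : x ∈ cube d) :
    ∏ i, diagDensity p i x = p x := by
  have htelescope : ∀ k : ℕ, ∏ i ∈ Finset.range k, (marginal p (i + 1) x / marginal p i x) =
      marginal p k x := fun k =>
    Finset.prod_range_induction _ (fun k => marginal p k x) (by rw [marginal_zero, h.integral_eq]) k
      fun i _ => (mul_div_cancel₀ _ (h.marginal_pos i hx).ne').symm
  rw [← marginal_self p x, ← htelescope d]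
  exact Fin.prod_univ_eq_prod_range (fun i => marginal p (i + 1) x / marginal p i x) d

theorem isC1BoundedOn_rosenblatt_apply (h : IsC1Density L₁ L₂ p) (i : Fin d) :
    IsC1BoundedOn (cube d) (1 * L₁ * L₂⁻¹)
      (1 * L₁ * ((L₂ ^ 2)⁻¹ * L₁) + L₂⁻¹ * (1 * L₁ + L₁ * 1)) fun x => rosenblatt p x i := by
  have hproj : IsC1BoundedOn (cube d) 1 1 fun x : E d => x i :=
    { contDiffOn := (EuclideanSpace.proj i : E d →L[ℝ] ℝ).contDiff.contDiffOn
      norm_le := fun x hx => abs_le.2 ⟨by linarith [(hx i).1], (hx i).2⟩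
      norm_fderivWithin_le := fun x hx => by
        rw [show fderivWithin ℝ (fun x : E d => x i) (cube d) x = _ from
          (EuclideanSpace.proj i : E d →L[ℝ] ℝ).fderivWithin (uniqueDiffOn_cube d x hx)]
        exact ContinuousLinearMap.opNorm_le_bound _ zero_le_one fun v =>
          (abs_apply_le_norm v i).trans_eq (one_mul _).symm }
  simp_rw [rosenblatt_apply, condCDF_eq]
  exact (hproj.mul (h.isC1BoundedOn.innerMean i) (uniqueDiffOn_cube d)).mul
    ((h.isC1BoundedOn.marginal i).inv (uniqueDiffOn_cube d) h.pos fun x hx => h.le_marginal i hx)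
    (uniqueDiffOn_cube d)

theorem stdMatrix_fderivWithin_rosenblatt (h : IsC1Density L₁ L₂ p) {x : E d} (hx : x ∈ cube d)
    (i : Fin d) :
    stdMatrix (fderivWithin ℝ (rosenblatt p) (cube d) x) i i = diagDensity p i x := by
  have hC := (contDiffOn_and_norm_fderivWithin_le_of_apply (uniqueDiffOn_cube d)
    h.isC1BoundedOn_rosenblatt_apply).1
  refine stdMatrix_fderivWithin_eq_of_hasDerivWithinAt (hC.differentiableOn one_ne_zero) hx ?_
  simp_rw [rosenblatt_setCoord_apply, ← condDensity_apply_self]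
  exact h.hasDerivWithinAt_condCDF i hx (hx i)

end IsC1Density

theorem exists_isTriangular_rosenblatt (d : ℕ) (L₁ L₂ : ℝ) :
    ∃ K : ℝ, ∀ p : E d → ℝ, IsC1Density L₁ L₂ p → IsTriangular (L₂ / L₁) K (rosenblatt p) := by
  have hC1 : ∃ K, ∀ p : E d → ℝ, IsC1Density L₁ L₂ p → ContDiffOn ℝ 1 (rosenblatt p) (cube d) ∧
      ∀ x ∈ cube d, ‖fderivWithin ℝ (rosenblatt p) (cube d) x‖ ≤ K :=
    ⟨_, fun p h => contDiffOn_and_norm_fderivWithin_le_of_apply (uniqueDiffOn_cube d)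
      h.isC1BoundedOn_rosenblatt_apply⟩
  obtain ⟨K, hK⟩ := hC1
  refine ⟨K, fun p h => ?_⟩
  exact
    { pos := div_pos h.pos h.pos_left
      contDiffOn := (hK p h).1
      norm_fderivWithin_le := (hK p h).2
      apply_congr := fun x _ y _ i hxy => by
        rw [rosenblatt_apply, rosenblatt_apply, hxy i le_rfl]
        exact condCDF_congr p (fun j hj => hxy j hj.le) _
      apply_of_mem_face := fun x hx i hi => by
        rcases hi with hi | hi <;> rw [rosenblatt_apply, hi]
        · rw [condCDF, intervalIntegral.integral_same]
        · exact h.condCDF_one i hx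
      le_stdMatrix := fun x hx i => by
        rw [h.stdMatrix_fderivWithin_rosenblatt hx]
        exact h.div_le_diagDensity i hx }

end Rosenblatt

section KnotheRosenblatt

variable {d : ℕ} {L₁ L₂ : ℝ} {p q : E d → ℝ} {x y : E d}

theorem IsC1Density.injOn_condCDF (hq : IsC1Density L₁ L₂ q) (i : Fin d) (hy : y ∈ cube d) :
    InjOn (condCDF q i y) (Icc 0 1) := by
  obtain ⟨K, hK⟩ := exists_isTriangular_rosenblatt d L₁ L₂
  have hmono := (hK q hq).strictMonoOn_apply_setCoord hy i
  simp_rw [rosenblatt_setCoord_apply] at hmono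
  exact hmono.injOn

theorem krPartial_apply_of_rosenblatt_eq (hq : IsC1Density L₁ L₂ q) (hy : y ∈ cube d)
    (hxy : rosenblatt q y = rosenblatt p x) :
    ∀ (k : ℕ) (i : Fin d), (i : ℕ) < k → krPartial p q k x i = y i := by
  intro k
  induction k with
  | zero => exact fun i hi => absurd hi (Nat.not_lt_zero _)
  | succ k ih =>
    intro i hi
    by_cases hk : k < d
    · have hcdf : condCDF q ⟨k, hk⟩ (krPartial p q k x) = condCDF q ⟨k, hk⟩ y :=
        funext fun s => condCDF_congr q (fun j hj => ih j hj) s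
      have hval : condCDF p ⟨k, hk⟩ x (x ⟨k, hk⟩) = condCDF q ⟨k, hk⟩ y (y ⟨k, hk⟩) := by
        rw [← rosenblatt_apply, ← rosenblatt_apply, hxy]
      rw [krPartial, dif_pos hk, hcdf, hval,
        (hq.injOn_condCDF ⟨k, hk⟩ hy).leftInvOn_invFunOn (hy ⟨k, hk⟩), setCoord_apply]
      split_ifs with hik
      · rw [hik]
      · exact ih i (lt_of_le_of_ne (Nat.lt_succ_iff.1 hi) fun h => hik (Fin.ext h))
    · rw [krPartial, dif_neg hk]
      exact ih i (i.2.trans_le (not_lt.1 hk))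

theorem krMap_eq_invFunOn_rosenblatt (hp : IsC1Density L₁ L₂ p) (hq : IsC1Density L₁ L₂ q)
    (hx : x ∈ cube d) :
    krMap p q x = Function.invFunOn (rosenblatt q) (cube d) (rosenblatt p x) := by
  obtain ⟨K, hK⟩ := exists_isTriangular_rosenblatt d L₁ L₂
  have hpx := (hK p hp).mapsTo hx
  ext i
  exact krPartial_apply_of_rosenblatt_eq hq ((hK q hq).mapsTo_invFunOn hpx)
    ((hK q hq).rightInvOn_invFunOn hpx) d i i.2

theorem rosenblatt_krMap (hp : IsC1Density L₁ L₂ p) (hq : IsC1Density L₁ L₂ q) (hx : x ∈ cube d) :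
    rosenblatt q (krMap p q x) = rosenblatt p x := by
  obtain ⟨K, hK⟩ := exists_isTriangular_rosenblatt d L₁ L₂
  rw [krMap_eq_invFunOn_rosenblatt hp hq hx]
  exact (hK q hq).rightInvOn_invFunOn ((hK p hp).mapsTo hx)

theorem exists_isTriangular_krMap (d : ℕ) {L₁ L₂ : ℝ} (hL₁ : 0 < L₁) (hL₂ : 0 < L₂) :
    ∃ c > 0, ∃ K, ∀ p q : E d → ℝ, IsC1Density L₁ L₂ p → IsC1Density L₁ L₂ q →
      IsTriangular c K (krMap p q) := by
  obtain ⟨K, hK⟩ := exists_isTriangular_rosenblatt d L₁ L₂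
  obtain ⟨c', hc', K', hK'⟩ := IsTriangular.exists_isTriangular_invFunOn d (div_pos hL₂ hL₁) K
  exact ⟨c' * (L₂ / L₁), by positivity, K' * K, fun p q hp hq =>
    ((hK' _ (hK q hq)).comp (hK p hp)).congr fun x hx => krMap_eq_invFunOn_rosenblatt hp hq hx⟩

variable {c K : ℝ}

-- Differentiate `R_q ∘ T = R_p` and compare diagonals of lower triangular matrices.
theorem stdMatrix_fderivWithin_krMap (hp : IsC1Density L₁ L₂ p) (hq : IsC1Density L₁ L₂ q)
    (hT : IsTriangular c K (krMap p q)) (hx : x ∈ cube d) (i : Fin d) :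
    stdMatrix (fderivWithin ℝ (krMap p q) (cube d) x) i i =
      diagDensity p i x / diagDensity q i (krMap p q x) := by
  obtain ⟨K', hK'⟩ := exists_isTriangular_rosenblatt d L₁ L₂
  have hTx := hT.mapsTo hx
  have hcomp := (((hK' q hq).hasFDerivWithinAt hTx).comp x
    (hT.hasFDerivWithinAt hx) hT.mapsTo).congr (f₁ := rosenblatt p)
    (fun y hy => (rosenblatt_krMap hp hq hy).symm) (rosenblatt_krMap hp hq hx).symm
  rw [eq_div_iff (hq.diagDensity_ne_zero i hTx), mul_comm,
    ← hq.stdMatrix_fderivWithin_rosenblatt hTx i, ← hp.stdMatrix_fderivWithin_rosenblatt hx i,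
    hcomp.fderivWithin (uniqueDiffOn_cube d x hx),
    hT.stdMatrix_fderivWithin_comp hx ((hK' q hq).isLowerTriangular hTx)]

theorem prod_stdMatrix_fderivWithin_krMap_mul (hp : IsC1Density L₁ L₂ p)
    (hq : IsC1Density L₁ L₂ q) (hT : IsTriangular c K (krMap p q)) (hx : x ∈ cube d) :
    (∏ i, stdMatrix (fderivWithin ℝ (krMap p q) (cube d) x) i i) * q (krMap p q x) = p x := by
  have hTx := hT.mapsTo hx
  simp_rw [stdMatrix_fderivWithin_krMap hp hq hT hx]
  rw [Finset.prod_div_distrib, hp.prod_diagDensity hx, hq.prod_diagDensity hTx,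
    div_mul_cancel₀ _ (hq.pos.trans_le (hq.ge _ hTx)).ne']

theorem exists_isC1BoundedOn_stdMatrix_fderivWithin_krMap (d : ℕ) (L₁ L₂ c K : ℝ) :
    ∃ A B, ∀ (p q : E d → ℝ) (i : Fin d), IsC1Density L₁ L₂ p → IsC1Density L₁ L₂ q →
      IsTriangular c K (krMap p q) → IsC1BoundedOn (cube d) A B
        fun x => stdMatrix (fderivWithin ℝ (krMap p q) (cube d) x) i i := by
  refine ⟨_, _, fun p q i hp hq hT => (((hp.isC1BoundedOn_marginal_div (i + 1) i).mul
    ((hq.isC1BoundedOn_marginal_div i (i + 1)).comp (uniqueDiffOn_cube d) hT.contDiffOn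
      hT.norm_fderivWithin_le hT.mapsTo) (uniqueDiffOn_cube d)).congr fun x hx => ?_)⟩
  rw [stdMatrix_fderivWithin_krMap hp hq hT hx, diagDensity, diagDensity, div_eq_mul_inv, inv_div]

end KnotheRosenblatt

section StraightVelocity

theorem le_one_add_mul_sub_one {a m t : ℝ} (hm : m ≤ 1) (ha : m ≤ a) (ht : t ∈ Icc (0 : ℝ) 1) :
    m ≤ 1 + t * (a - 1) := by
  nlinarith [mul_nonneg ht.1 (sub_nonneg.2 ha), mul_nonneg (sub_nonneg.2 ht.2) (sub_nonneg.2 hm)]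

theorem one_add_mul_sub_one_pos {a t : ℝ} (ha : 0 < a) (ht : t ∈ Icc (0 : ℝ) 1) :
    0 < 1 + t * (a - 1) :=
  (lt_min zero_lt_one ha).trans_le (le_one_add_mul_sub_one (min_le_left _ _) (min_le_right _ _) ht)

theorem abs_sub_one_div_sub_le {a b m t : ℝ} (hm : 0 < m) (hm1 : m ≤ 1) (ha : m ≤ a) (hb : m ≤ b)
    (ht : t ∈ Icc (0 : ℝ) 1) :
    |(a - 1) / (1 + t * (a - 1)) - (b - 1) / (1 + t * (b - 1))| ≤ (m ^ 2)⁻¹ * |a - b| := by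
  have hda := le_one_add_mul_sub_one hm1 ha ht
  have hdb := le_one_add_mul_sub_one hm1 hb ht
  have hda' := hm.trans_le hda
  have hdb' := hm.trans_le hdb
  have hdiff : (a - 1) / (1 + t * (a - 1)) - (b - 1) / (1 + t * (b - 1)) =
      ((1 + t * (a - 1)) * (1 + t * (b - 1)))⁻¹ * (a - b) := by
    rw [div_sub_div _ _ hda'.ne' hdb'.ne', inv_mul_eq_div]
    congr 1
    ring
  rw [hdiff, abs_mul, abs_of_pos (by positivity), sq]
  gcongr

theorem intervalIntegrable_sub_one_div {a : ℝ} (ha : 0 < a) :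
    IntervalIntegrable (fun t => (a - 1) / (1 + t * (a - 1))) volume 0 1 := by
  refine ContinuousOn.intervalIntegrable_of_Icc zero_le_one ?_
  exact continuousOn_const.div (by fun_prop) fun t ht => (one_add_mul_sub_one_pos ha ht).ne'

theorem integral_sub_one_div {a : ℝ} (ha : 0 < a) :
    ∫ t in (0 : ℝ)..1, (a - 1) / (1 + t * (a - 1)) = Real.log a := by
  have hderiv : ∀ t ∈ uIcc (0 : ℝ) 1, HasDerivAt (fun t => Real.log (1 + t * (a - 1)))
      ((a - 1) / (1 + t * (a - 1))) t := fun t ht => by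
    rw [uIcc_of_le zero_le_one] at ht
    have := (((hasDerivAt_id t).mul_const (a - 1)).const_add 1).log
      (one_add_mul_sub_one_pos ha ht).ne'
    simpa using this
  simpa using intervalIntegral.integral_eq_sub_of_hasDerivAt hderiv
    (intervalIntegrable_sub_one_div ha)

namespace IsTriangular

variable {d : ℕ} {c K : ℝ} {T : E d → E d} {x y : E d} {t : ℝ}

theorem isC1BoundedOn_sub_id (h : IsTriangular c K T) :
    IsC1BoundedOn (cube d) d (K + 1) fun x => T x - x where
  contDiffOn := h.contDiffOn.sub contDiffOn_id
  norm_le x hx := by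
    refine (norm_le_of_abs_apply_le (c := 1) fun i => ?_).trans_eq (mul_one _)
    obtain ⟨hx0, hx1⟩ := hx i
    obtain ⟨hT0, hT1⟩ := h.mapsTo hx i
    rw [PiLp.sub_apply, abs_le]
    constructor <;> linarith
  norm_fderivWithin_le x hx := by
    have hderiv := (h.hasFDerivWithinAt hx).sub (hasFDerivWithinAt_id x (cube d))
    rw [show fderivWithin ℝ (fun x => T x - x) (cube d) x = _ from
      hderiv.fderivWithin (uniqueDiffOn_cube d x hx)]
    exact (_root_.norm_sub_le _ _).trans
      (add_le_add (h.norm_fderivWithin_le x hx) ContinuousLinearMap.norm_id_le)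

theorem straightVelocity_interp (h : IsTriangular c K T) (ht : t ∈ Icc (0 : ℝ) 1)
    (hx : x ∈ cube d) : straightVelocity T (KRFlow.interp T t x) t = T x - x := by
  rw [straightVelocity, (h.interp ht).injOn.leftInvOn_invFunOn hx]

theorem isSolutionIn_interp (h : IsTriangular c K T) (hx : x ∈ cube d) :
    IsSolutionIn (cube d) (straightVelocity T) x fun t => KRFlow.interp T t x where
  initial := by simp [KRFlow.interp]
  mem t ht := (h.interp ht).mapsTo hx
  hasDerivWithinAt t ht := by
    rw [h.straightVelocity_interp ht hx]
    have hderiv := (((hasDerivAt_id t).const_sub 1).smul_const x).add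
      ((hasDerivAt_id t).smul_const (T x))
    refine (hderiv.congr_deriv ?_).hasDerivWithinAt
    simp [sub_eq_neg_add]

theorem exists_isC1BoundedOn_straightVelocity (d : ℕ) {c : ℝ} (hc : 0 < c) (K : ℝ) :
    ∃ b, ∀ T : E d → E d, IsTriangular c K T → ∀ t ∈ Icc (0 : ℝ) 1,
      IsC1BoundedOn (cube d) d b fun y => straightVelocity T y t := by
  obtain ⟨_, _, A, hA⟩ := exists_isTriangular_invFunOn d (lt_min zero_lt_one hc) (1 + K)
  refine ⟨(K + 1) * A, fun T h t ht => ?_⟩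
  have hR := hA _ (h.interp ht)
  exact h.isC1BoundedOn_sub_id.comp (uniqueDiffOn_cube d) hR.contDiffOn hR.norm_fderivWithin_le
    hR.mapsTo

theorem continuousOn_straightVelocity (h : IsTriangular c K T) :
    ContinuousOn (fun z : E d × ℝ => straightVelocity T z.1 z.2) (cube d ×ˢ Icc 0 1) := by
  have hTfst : ContinuousOn (fun z : E d × ℝ => T z.1) (cube d ×ˢ Icc 0 1) :=
    h.contDiffOn.continuousOn.comp continuousOn_fst fun z hz => hz.1
  have hcont : ContinuousOn (fun z : E d × ℝ => (KRFlow.interp T z.2 z.1, z.2))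
      (cube d ×ˢ Icc 0 1) :=
    (((continuousOn_const.sub continuousOn_snd).smul continuousOn_fst).add
      (continuousOn_snd.smul hTfst)).prodMk continuousOn_snd
  have hinj : InjOn (fun z : E d × ℝ => (KRFlow.interp T z.2 z.1, z.2)) (cube d ×ˢ Icc 0 1) := by
    rintro ⟨x, t⟩ ⟨hx, ht⟩ ⟨y, s⟩ ⟨hy, -⟩ hxy
    obtain ⟨hxy, rfl⟩ : KRFlow.interp T t x = KRFlow.interp T s y ∧ t = s := Prod.mk.inj hxy
    exact congrArg (·, t) ((h.interp ht).injOn hx hy hxy)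
  have hmaps : MapsTo (fun z : E d × ℝ => (Function.invFunOn (KRFlow.interp T z.2) (cube d) z.1,
      z.2)) (cube d ×ˢ Icc 0 1) (cube d ×ˢ Icc 0 1) := fun z hz =>
    ⟨(h.interp hz.2).mapsTo_invFunOn hz.1, hz.2⟩
  have hinv := continuousOn_of_isCompact_of_rightInvOn ((isCompact_cube d).prod isCompact_Icc)
    hcont hinj hmaps fun z hz => Prod.ext ((h.interp hz.2).rightInvOn_invFunOn hz.1) rfl
  exact (hTfst.comp hinv hmaps).sub hinv.fst

theorem wellPosed_straightVelocity (h : IsTriangular c K T) : WellPosed (straightVelocity T) := by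
  obtain ⟨b, hb⟩ := exists_isC1BoundedOn_straightVelocity d h.pos K
  exact wellPosed_of_exists_isSolutionIn h.continuousOn_straightVelocity
    (fun t ht => (hb T h t ht).lipschitzOnWith (convex_cube d)) fun x hx =>
    ⟨_, h.isSolutionIn_interp hx⟩

theorem flowMap_straightVelocity (h : IsTriangular c K T) (hx : x ∈ cube d) :
    flowMap (straightVelocity T) x 1 = T x := by
  have hflow := (h.wellPosed_straightVelocity x hx).2 _ _
    (h.wellPosed_straightVelocity.isTrajectory_flowMap hx)
    ((h.isSolutionIn_interp hx).isTrajectory h.continuousOn_straightVelocity)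
    (right_mem_Icc.2 zero_le_one)
  simpa [KRFlow.interp] using hflow

theorem divergence_straightVelocity (h : IsTriangular c K T) (ht : t ∈ Icc (0 : ℝ) 1)
    (hy : y ∈ cube d) : divergence (straightVelocity T) y t =
      ∑ i, (stdMatrix (fderivWithin ℝ T (cube d)
          (Function.invFunOn (KRFlow.interp T t) (cube d) y)) i i - 1) /
        (1 + t * (stdMatrix (fderivWithin ℝ T (cube d)
          (Function.invFunOn (KRFlow.interp T t) (cube d) y)) i i - 1)) := by
  have hI := h.interp ht
  obtain ⟨_, _, _, hinv⟩ := exists_isTriangular_invFunOn d hI.pos (1 + K)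
  have hR := hinv _ hI
  set R := Function.invFunOn (KRFlow.interp T t) (cube d)
  have hRy : R y ∈ cube d := hR.mapsTo hy
  have hderiv : HasFDerivWithinAt (fun y => straightVelocity T y t)
      ((fderivWithin ℝ T (cube d) (R y) - ContinuousLinearMap.id ℝ (E d)).comp
        (fderivWithin ℝ R (cube d) y)) (cube d) y :=
    HasFDerivWithinAt.comp (g := fun x => T x - x) (t := cube d) y
      ((h.hasFDerivWithinAt hRy).sub (hasFDerivWithinAt_id _ _)) (hR.hasFDerivWithinAt hy) hR.mapsTo
  have hlow : (stdMatrix (fderivWithin ℝ T (cube d) (R y) - ContinuousLinearMap.id ℝ (E d))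
      ).IsLowerTriangular := fun i j hij => by
    have hTij : fderivWithin ℝ T (cube d) (R y) (EuclideanSpace.single j 1) i = 0 :=
      h.isLowerTriangular hRy hij
    simp [stdMatrix_apply, hTij, (show i < j from hij).ne]
  rw [divergence, hderiv.fderivWithin (uniqueDiffOn_cube d y hy), Matrix.trace]
  refine Finset.sum_congr rfl fun i _ => ?_
  rw [Matrix.diag_apply, hR.stdMatrix_fderivWithin_comp hy hlow,
    hI.stdMatrix_fderivWithin_invFunOn hy, h.stdMatrix_fderivWithin_interp t hRy, ← div_eq_mul_inv]
  simp [stdMatrix_apply]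

theorem divergence_straightVelocity_interp (h : IsTriangular c K T) (ht : t ∈ Icc (0 : ℝ) 1)
    (hx : x ∈ cube d) : divergence (straightVelocity T) (KRFlow.interp T t x) t =
      ∑ i, (stdMatrix (fderivWithin ℝ T (cube d) x) i i - 1) /
        (1 + t * (stdMatrix (fderivWithin ℝ T (cube d) x) i i - 1)) := by
  rw [h.divergence_straightVelocity ht ((h.interp ht).mapsTo hx),
    (h.interp ht).injOn.leftInvOn_invFunOn hx]

theorem intervalIntegrable_divergence_straightVelocity_interp (h : IsTriangular c K T)
    (hx : x ∈ cube d) : IntervalIntegrable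
      (fun t => divergence (straightVelocity T) (KRFlow.interp T t x) t) volume 0 1 := by
  refine (IntervalIntegrable.sum Finset.univ fun i _ =>
    intervalIntegrable_sub_one_div (h.stdMatrix_pos hx i)).congr fun t ht => ?_
  rw [uIoc_of_le zero_le_one] at ht
  rw [h.divergence_straightVelocity_interp (Ioc_subset_Icc_self ht) hx, Finset.sum_apply]

theorem integral_divergence_straightVelocity_interp (h : IsTriangular c K T) (hx : x ∈ cube d) :
    ∫ t in (0 : ℝ)..1, divergence (straightVelocity T) (KRFlow.interp T t x) t =
      ∑ i, Real.log (stdMatrix (fderivWithin ℝ T (cube d) x) i i) := by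
  have hcongr : EqOn (fun t => divergence (straightVelocity T) (KRFlow.interp T t x) t)
      (fun t => ∑ i, (stdMatrix (fderivWithin ℝ T (cube d) x) i i - 1) /
        (1 + t * (stdMatrix (fderivWithin ℝ T (cube d) x) i i - 1))) (uIcc 0 1) := fun t ht => by
    rw [uIcc_of_le zero_le_one] at ht
    exact h.divergence_straightVelocity_interp ht hx
  rw [intervalIntegral.integral_congr hcongr, intervalIntegral.integral_finsetSum fun i _ =>
    intervalIntegrable_sub_one_div (h.stdMatrix_pos hx i)]
  exact Finset.sum_congr rfl fun i _ => integral_sub_one_div (h.stdMatrix_pos hx i)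

theorem exists_lipschitzOnWith_divergence_straightVelocity (d : ℕ) {c : ℝ} (hc : 0 < c) (K : ℝ)
    (B : ℝ≥0) : ∃ D : ℝ≥0, ∀ T : E d → E d, IsTriangular c K T →
      (∀ i, LipschitzOnWith B (fun x => stdMatrix (fderivWithin ℝ T (cube d) x) i i) (cube d)) →
      ∀ t ∈ Icc (0 : ℝ) 1,
        LipschitzOnWith D (fun y => divergence (straightVelocity T) y t) (cube d) := by
  have hm : 0 < min 1 c := lt_min zero_lt_one hc
  obtain ⟨_, _, A, hA⟩ := exists_isTriangular_invFunOn d hm (1 + K)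
  refine ⟨(d * ((min 1 c ^ 2)⁻¹ * (B * A.toNNReal : ℝ≥0))).toNNReal, fun T h hB t ht =>
    LipschitzOnWith.of_dist_le' fun y hy z hz => ?_⟩
  have hR := hA _ (h.interp ht)
  have hdiag : ∀ i, ∀ x ∈ cube d, min 1 c ≤ stdMatrix (fderivWithin ℝ T (cube d) x) i i :=
    fun i x hx => (min_le_right _ _).trans (h.le_stdMatrix x hx i)
  rw [Real.dist_eq, h.divergence_straightVelocity ht hy, h.divergence_straightVelocity ht hz,
    ← Finset.sum_sub_distrib]
  have hterm := fun i => (abs_sub_one_div_sub_le hm (min_le_left _ _) (hdiag i _ (hR.mapsTo hy))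
    (hdiag i _ (hR.mapsTo hz)) ht).trans (mul_le_mul_of_nonneg_left
      (((hB i).comp hR.lipschitzOnWith hR.mapsTo).dist_le_mul y hy z hz) (by positivity))
  refine (Finset.abs_sum_le_sum_abs _ _).trans
    ((Finset.sum_le_card_nsmul _ _ _ fun i _ => hterm i).trans_eq ?_)
  rw [Finset.card_univ, Fintype.card_fin, nsmul_eq_mul]
  ring

end IsTriangular

end StraightVelocity

section KLDivergence

variable {α β : Type*} [MeasurableSpace α] [MeasurableSpace β] {μ ν : Measure α} {ε : ℝ}

theorem klFun_le_of_abs_log_le {x : ℝ} (hx : 0 < x) (h : |Real.log x| ≤ ε) :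
    InformationTheory.klFun x ≤ ε ^ 2 * (x + 1) := by
  rw [InformationTheory.klFun_apply]
  set l := Real.log x
  have log_le : l ≤ x - 1 := Real.log_le_sub_one_of_pos hx
  have le_mul_log : x - 1 ≤ x * l := by
    have := mul_le_mul_of_nonneg_left (Real.one_sub_inv_le_log_of_pos hx) hx.le
    rwa [mul_sub, mul_one, mul_inv_cancel₀ hx.ne'] at this
  have sq_log_le : l ^ 2 ≤ ε ^ 2 := sq_le_sq' (neg_le_of_abs_le h) (le_of_abs_le h)
  have kl_le : x * l + 1 - x ≤ (x + 1) * l ^ 2 := by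
    rcases le_total 0 l with hl | hl
    · nlinarith [mul_le_mul_of_nonneg_right le_mul_log hl]
    · nlinarith [mul_le_mul_of_nonpos_right log_le hl, mul_nonneg hx.le (sq_nonneg l)]
  nlinarith

theorem ae_abs_log_rnDeriv_le [SigmaFinite μ] [SigmaFinite ν]
    (hμν : μ ≤ ENNReal.ofReal (Real.exp ε) • ν) (hνμ : ν ≤ ENNReal.ofReal (Real.exp ε) • μ) :
    ∀ᵐ x ∂ν, 0 < (μ.rnDeriv ν x).toReal ∧ |Real.log (μ.rnDeriv ν x).toReal| ≤ ε := by
  have hac : μ ≪ ν := Measure.absolutelyContinuous_of_le_smul hμν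
  have rnDeriv_le : μ.rnDeriv ν ≤ᵐ[ν] fun _ => ENNReal.ofReal (Real.exp ε) :=
    ae_le_of_forall_setLIntegral_le_of_sigmaFinite (Measure.measurable_rnDeriv _ _)
      fun s _ _ => by
        rw [Measure.setLIntegral_rnDeriv hac, setLIntegral_const]
        exact hμν s
  have le_rnDeriv : (fun _ => ENNReal.ofReal (Real.exp (-ε))) ≤ᵐ[ν] μ.rnDeriv ν :=
    ae_le_of_forall_setLIntegral_le_of_sigmaFinite measurable_const fun s _ _ => by
      rw [Measure.setLIntegral_rnDeriv hac, setLIntegral_const]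
      refine (mul_le_mul_right (hνμ s) _).trans_eq ?_
      rw [Measure.smul_apply, smul_eq_mul, ← mul_assoc, ← ENNReal.ofReal_mul (Real.exp_pos _).le,
        ← Real.exp_add, neg_add_cancel, Real.exp_zero, ENNReal.ofReal_one, one_mul]
  filter_upwards [rnDeriv_le, le_rnDeriv] with x hle hge
  have exp_le : Real.exp (-ε) ≤ (μ.rnDeriv ν x).toReal :=
    (ENNReal.ofReal_le_iff_le_toReal (ne_top_of_le_ne_top ENNReal.ofReal_ne_top hle)).1 hge
  have le_exp : (μ.rnDeriv ν x).toReal ≤ Real.exp ε :=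
    ENNReal.toReal_le_of_le_ofReal (Real.exp_pos _).le hle
  have hpos : 0 < (μ.rnDeriv ν x).toReal := (Real.exp_pos _).trans_le exp_le
  exact ⟨hpos, abs_le.2 ⟨(Real.le_log_iff_exp_le hpos).2 exp_le,
    (Real.log_le_iff_le_exp hpos).2 le_exp⟩⟩

theorem klDiv_le_of_le_smul [IsFiniteMeasure μ] [IsFiniteMeasure ν]
    (hμν : μ ≤ ENNReal.ofReal (Real.exp ε) • ν) (hνμ : ν ≤ ENNReal.ofReal (Real.exp ε) • μ) :
    InformationTheory.klDiv μ ν ≤ ENNReal.ofReal (ε ^ 2) * (μ univ + ν univ) := by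
  have hac : μ ≪ ν := Measure.absolutelyContinuous_of_le_smul hμν
  have klFun_le : ∀ᵐ x ∂ν, ENNReal.ofReal (InformationTheory.klFun (μ.rnDeriv ν x).toReal) ≤
      ENNReal.ofReal (ε ^ 2) * (μ.rnDeriv ν x + 1) := by
    filter_upwards [ae_abs_log_rnDeriv_le hμν hνμ, Measure.rnDeriv_lt_top μ ν]
      with x ⟨hpos, hlog⟩ hfin
    calc ENNReal.ofReal (InformationTheory.klFun (μ.rnDeriv ν x).toReal)
      _ ≤ ENNReal.ofReal (ε ^ 2 * ((μ.rnDeriv ν x).toReal + 1)) :=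
          ENNReal.ofReal_le_ofReal (klFun_le_of_abs_log_le hpos hlog)
      _ = ENNReal.ofReal (ε ^ 2) * (μ.rnDeriv ν x + 1) := by
          rw [ENNReal.ofReal_mul (sq_nonneg ε), ENNReal.ofReal_add hpos.le zero_le_one,
            ENNReal.ofReal_toReal hfin.ne, ENNReal.ofReal_one]
  rw [InformationTheory.klDiv_eq_lintegral_klFun_of_ac hac]
  refine (lintegral_mono_ae klFun_le).trans_eq ?_
  rw [lintegral_const_mul _ ((Measure.measurable_rnDeriv _ _).add_const 1),
    lintegral_add_right _ measurable_const, Measure.lintegral_rnDeriv hac, lintegral_one]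

theorem withDensity_ofReal_le_smul {p q : α → ℝ}
    (hp : ∀ᵐ x ∂μ, 0 < p x) (hq : ∀ᵐ x ∂μ, 0 < q x)
    (hpq : ∀ᵐ x ∂μ, Real.log (p x) - Real.log (q x) ≤ ε) :
    μ.withDensity (fun x => ENNReal.ofReal (p x)) ≤
      ENNReal.ofReal (Real.exp ε) • μ.withDensity (fun x => ENNReal.ofReal (q x)) := by
  rw [← withDensity_smul' _ _ ENNReal.ofReal_ne_top]
  refine withDensity_mono ?_
  filter_upwards [hp, hq, hpq] with x hpx hqx hx
  rw [Pi.smul_apply, smul_eq_mul, ← ENNReal.ofReal_mul (Real.exp_pos _).le]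
  refine ENNReal.ofReal_le_ofReal ?_
  rw [← div_le_iff₀ hqx, ← Real.log_le_iff_le_exp (div_pos hpx hqx),
    Real.log_div hpx.ne' hqx.ne']
  exact hx

theorem klDiv_map_withDensity_le {p q : α → ℝ} {φ : α → β} (hφ : AEMeasurable φ μ)
    [IsFiniteMeasure ((μ.withDensity fun x => ENNReal.ofReal (p x)).map φ)]
    [IsFiniteMeasure ((μ.withDensity fun x => ENNReal.ofReal (q x)).map φ)]
    (hp : ∀ᵐ x ∂μ, 0 < p x) (hq : ∀ᵐ x ∂μ, 0 < q x)
    (hpq : ∀ᵐ x ∂μ, |Real.log (p x) - Real.log (q x)| ≤ ε) :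
    InformationTheory.klDiv ((μ.withDensity fun x => ENNReal.ofReal (p x)).map φ)
        ((μ.withDensity fun x => ENNReal.ofReal (q x)).map φ) ≤
      ENNReal.ofReal (ε ^ 2) *
        ((μ.withDensity fun x => ENNReal.ofReal (p x)).map φ univ +
          (μ.withDensity fun x => ENNReal.ofReal (q x)).map φ univ) := by
  have map_le : ∀ {a b : α → ℝ}, (∀ᵐ x ∂μ, 0 < a x) → (∀ᵐ x ∂μ, 0 < b x) →
      (∀ᵐ x ∂μ, Real.log (a x) - Real.log (b x) ≤ ε) →
      (μ.withDensity fun x => ENNReal.ofReal (a x)).map φ ≤ ENNReal.ofReal (Real.exp ε) •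
        (μ.withDensity fun x => ENNReal.ofReal (b x)).map φ := fun {a b} ha hb hab => by
    rw [← Measure.map_smul]
    exact Measure.map_mono_of_aemeasurable (withDensity_ofReal_le_smul ha hb hab)
      ((hφ.mono_ac (withDensity_absolutelyContinuous _ _)).smul_measure _)
  refine klDiv_le_of_le_smul (map_le hp hq ?_) (map_le hq hp ?_)
  · filter_upwards [hpq] with x hx using le_of_abs_le hx
  · filter_upwards [hpq] with x hx using le_of_abs_le (abs_sub_comm (Real.log _) _ ▸ hx)

end KLDivergence

section ChangeOfVariables

variable {V : Type*} [NormedAddCommGroup V] [NormedSpace ℝ V] [FiniteDimensional ℝ V]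
  [MeasurableSpace V] [BorelSpace V] {μ : Measure V} [μ.IsAddHaarMeasure] {S U : Set V}
  {Φ : V → V} {Φ' : V → V →L[ℝ] V}

theorem map_withDensity_abs_det_mul (hS : MeasurableSet S) (hU : MeasurableSet U)
    (hΦ : BijOn Φ S U) (hΦ' : ∀ x ∈ S, HasFDerivWithinAt Φ (Φ' x) S x) (w : V → ℝ≥0∞) :
    ((μ.restrict S).withDensity fun x => ENNReal.ofReal |(Φ' x).det| * w (Φ x)).map Φ =
      (μ.restrict U).withDensity w := by
  have hcont : ContinuousOn Φ S := fun x hx => (hΦ' x hx).continuousWithinAt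
  ext B hB
  have hSB : MeasurableSet (S ∩ Φ ⁻¹' B) := by
    rw [← Subtype.image_preimage_coe]
    exact hS.subtype_image (hcont.domRestrict.measurable hB)
  have image_eq : Φ '' (S ∩ Φ ⁻¹' B) = B ∩ U := by
    rw [image_inter_preimage, hΦ.image_eq, inter_comm]
  rw [Measure.map_apply_of_aemeasurable
      ((hcont.aemeasurable hS).mono_ac (withDensity_absolutelyContinuous _ _)) hB,
    withDensity_apply', withDensity_apply', Measure.restrict_restrict' hS,
    Measure.restrict_restrict' hU, inter_comm, ← image_eq]
  exact (lintegral_image_eq_lintegral_abs_det_fderiv_mul μ hSB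
    (fun x hx => (hΦ' x hx.1).mono inter_subset_left) (hΦ.injOn.mono inter_subset_left) w).symm

theorem klDiv_map_withDensity_le_of_hasFDerivWithinAt {p q : V → ℝ} {ε : ℝ} (hS : MeasurableSet S)
    (hU : MeasurableSet U) (hΦ : BijOn Φ S U) (hΦ' : ∀ x ∈ S, HasFDerivWithinAt Φ (Φ' x) S x)
    (hdet : ∀ x ∈ S, (Φ' x).det ≠ 0) (hp : ∀ x ∈ S, 0 < p x) (hq : ∀ y ∈ U, 0 < q y)
    (hpq : ∀ x ∈ S, |Real.log (p x) - Real.log (|(Φ' x).det| * q (Φ x))| ≤ ε)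
    [IsFiniteMeasure (((μ.restrict S).withDensity fun x => ENNReal.ofReal (p x)).map Φ)]
    [IsFiniteMeasure ((μ.restrict U).withDensity fun y => ENNReal.ofReal (q y))] :
    InformationTheory.klDiv (((μ.restrict S).withDensity fun x => ENNReal.ofReal (p x)).map Φ)
        ((μ.restrict U).withDensity fun y => ENNReal.ofReal (q y)) ≤
      ENNReal.ofReal (ε ^ 2) *
        (((μ.restrict S).withDensity fun x => ENNReal.ofReal (p x)).map Φ univ +
          (μ.restrict U).withDensity (fun y => ENNReal.ofReal (q y)) univ) := by
  have hcont : ContinuousOn Φ S := fun x hx => (hΦ' x hx).continuousWithinAt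
  have hrhs := map_withDensity_abs_det_mul (μ := μ) hS hU hΦ hΦ' fun y => ENNReal.ofReal (q y)
  simp only [← ENNReal.ofReal_mul (abs_nonneg _)] at hrhs
  have : IsFiniteMeasure
      (((μ.restrict S).withDensity fun x => ENNReal.ofReal (|(Φ' x).det| * q (Φ x))).map Φ) := by
    rwa [hrhs]
  rw [← hrhs]
  have ae_of_mem : ∀ {P : V → Prop}, (∀ x ∈ S, P x) → ∀ᵐ x ∂μ.restrict S, P x :=
    fun hP => (ae_restrict_mem hS).mono hP
  exact klDiv_map_withDensity_le (hcont.aemeasurable hS) (ae_of_mem hp)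
    (ae_of_mem fun x hx => mul_pos (abs_pos.2 (hdet x hx)) (hq _ (hΦ.mapsTo hx))) (ae_of_mem hpq)

end ChangeOfVariables

section FlowComparison

variable {d : ℕ} {f g : E d → ℝ → E d} {δ : ℝ} {x : E d} {t : ℝ}

theorem abs_divergence_sub_le
    (hf : DifferentiableWithinAt ℝ (fun y => f y t) (cube d) x)
    (hg : DifferentiableWithinAt ℝ (fun y => g y t) (cube d) x) (hx : x ∈ cube d) :
    |divergence f x t - divergence g x t| ≤
      d * ‖fderivWithin ℝ (fun y => f y t - g y t) (cube d) x‖ := by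
  rw [divergence, divergence, ← Matrix.trace_sub, ← stdMatrix_sub,
    ← fderivWithin_fun_sub (uniqueDiffOn_cube d x hx) hf hg]
  exact abs_trace_stdMatrix_le _

namespace IsTangentField

theorem contDiffOn (hg : IsTangentField g) (ht : t ∈ Icc (0 : ℝ) 1) :
    ContDiffOn ℝ 1 (fun y => g y t) (cube d) :=
  contDiffOn_one_of_hasFDerivWithinAt (uniqueDiffOn_cube d)
    (fun y hy => (hg.differentiableOn t ht y hy).hasFDerivWithinAt)
    (hg.continuousOn_fderivWithin.comp (f := fun y => (y, t)) (by fun_prop) fun _ hy => ⟨hy, ht⟩)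

theorem exists_isC1BoundedOn (hg : IsTangentField g) :
    ∃ a b, ∀ t ∈ Icc (0 : ℝ) 1, IsC1BoundedOn (cube d) a b fun y => g y t := by
  obtain ⟨a, ha⟩ :=
    ((isCompact_cube d).prod isCompact_Icc).exists_bound_of_continuousOn hg.continuousOn
  obtain ⟨b, hb⟩ := hg.exists_norm_fderivWithin_le (isCompact_cube d)
  exact ⟨a, b, fun t ht => ⟨hg.contDiffOn ht, fun y hy => ha (y, t) ⟨hy, ht⟩, hb t ht⟩⟩

theorem continuousOn_flowMap (hg : IsTangentField g) :
    ContinuousOn (fun x => flowMap g x 1) (cube d) := fun x hx => by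
  obtain ⟨M, hM, -⟩ := hg.exists_hasFDerivWithinAt_flowMap hx
  exact hM.continuousWithinAt

theorem intervalIntegrable_divergence_flowMap (hg : IsTangentField g) (hx : x ∈ cube d) :
    IntervalIntegrable (fun t => divergence g (flowMap g x t) t) volume 0 1 :=
  (hg.continuousOn_divergence_flowMap hx).intervalIntegrable_of_Icc zero_le_one

variable {K D : ℝ≥0} {γ : ℝ → E d}

theorem norm_flowMap_sub_le (hg : IsTangentField g)
    (hfg : ∀ t ∈ Icc (0 : ℝ) 1, IsC1BoundedOn (cube d) δ δ fun y => f y t - g y t)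
    (hK : ∀ t ∈ Icc (0 : ℝ) 1, LipschitzOnWith K (fun y => f y t) (cube d)) (hx : x ∈ cube d)
    (hγ : IsSolutionIn (cube d) f x γ) (ht : t ∈ Icc (0 : ℝ) 1) :
    ‖flowMap g x t - γ t‖ ≤ δ * Real.exp K := by
  have hδ : 0 ≤ δ := (norm_nonneg _).trans ((hfg t ht).norm_le x hx)
  have hgap := hγ.norm_sub_le_of_norm_field_sub_le hδ hK (fun t ht => (hfg t ht).norm_le)
    (hg.isSolutionIn_flowMap hx) ht
  rwa [sub_self, norm_zero, zero_add, norm_sub_rev] at hgap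

theorem abs_divergence_flowMap_sub_le (hg : IsTangentField g)
    (hf : ∀ t ∈ Icc (0 : ℝ) 1, DifferentiableOn ℝ (fun y => f y t) (cube d))
    (hfg : ∀ t ∈ Icc (0 : ℝ) 1, IsC1BoundedOn (cube d) δ δ fun y => f y t - g y t)
    (hK : ∀ t ∈ Icc (0 : ℝ) 1, LipschitzOnWith K (fun y => f y t) (cube d))
    (hD : ∀ t ∈ Icc (0 : ℝ) 1, LipschitzOnWith D (fun y => divergence f y t) (cube d))
    (hx : x ∈ cube d) (hγ : IsSolutionIn (cube d) f x γ) (ht : t ∈ Icc (0 : ℝ) 1) :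
    |divergence f (γ t) t - divergence g (flowMap g x t) t| ≤ (d + D * Real.exp K) * δ := by
  have hy : flowMap g x t ∈ cube d := (hg.isSolutionIn_flowMap hx).mem t ht
  have along_f : |divergence f (γ t) t - divergence f (flowMap g x t) t| ≤
      D * (δ * Real.exp K) := by
    refine ((hD t ht).dist_le_mul _ (hγ.mem t ht) _ hy).trans ?_
    rw [dist_comm, dist_eq_norm]
    exact mul_le_mul_of_nonneg_left (hg.norm_flowMap_sub_le hfg hK hx hγ ht) D.2
  have at_flowMap : |divergence f (flowMap g x t) t - divergence g (flowMap g x t) t| ≤ d * δ :=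
    (abs_divergence_sub_le (hf t ht _ hy) (hg.differentiableOn t ht _ hy) hy).trans
      (mul_le_mul_of_nonneg_left ((hfg t ht).norm_fderivWithin_le _ hy) d.cast_nonneg)
  calc |divergence f (γ t) t - divergence g (flowMap g x t) t|
    _ ≤ D * (δ * Real.exp K) + d * δ := (abs_sub_le _ _ _).trans (add_le_add along_f at_flowMap)
    _ = (d + D * Real.exp K) * δ := by ring

theorem abs_integral_divergence_flowMap_sub_le (hg : IsTangentField g)
    (hf : ∀ t ∈ Icc (0 : ℝ) 1, DifferentiableOn ℝ (fun y => f y t) (cube d))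
    (hfg : ∀ t ∈ Icc (0 : ℝ) 1, IsC1BoundedOn (cube d) δ δ fun y => f y t - g y t)
    (hK : ∀ t ∈ Icc (0 : ℝ) 1, LipschitzOnWith K (fun y => f y t) (cube d))
    (hD : ∀ t ∈ Icc (0 : ℝ) 1, LipschitzOnWith D (fun y => divergence f y t) (cube d))
    (hx : x ∈ cube d) (hγ : IsSolutionIn (cube d) f x γ)
    (hint : IntervalIntegrable (fun t => divergence f (γ t) t) volume 0 1) :
    |(∫ t in (0 : ℝ)..1, divergence f (γ t) t) -
      ∫ t in (0 : ℝ)..1, divergence g (flowMap g x t) t| ≤ (d + D * Real.exp K) * δ := by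
  rw [← intervalIntegral.integral_sub hint (hg.intervalIntegrable_divergence_flowMap hx)]
  have hle : ∀ t ∈ uIoc (0 : ℝ) 1, ‖divergence f (γ t) t - divergence g (flowMap g x t) t‖ ≤
      (d + D * Real.exp K) * δ := fun t ht => by
    rw [uIoc_of_le zero_le_one] at ht
    exact hg.abs_divergence_flowMap_sub_le hf hfg hK hD hx hγ (Ioc_subset_Icc_self ht)
  simpa using intervalIntegral.norm_integral_le_of_norm_le_const hle

end IsTangentField

end FlowComparison

section Distance

variable {d : ℕ} {f g : E d → ℝ → E d}

theorem cNorm_le_c1Dist {t : ℝ} (ht : t ∈ Icc (0 : ℝ) 1) :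
    cNorm 1 (cube d) (fun x => f x t - g x t) ≤ c1Dist f g :=
  le_iSup₂ (f := fun t (_ : t ∈ Icc (0 : ℝ) 1) => cNorm 1 (cube d) fun x => f x t - g x t) t ht

theorem isC1BoundedOn_sub_c1Dist (hfg : c1Dist f g ≠ ⊤) {t : ℝ} (ht : t ∈ Icc (0 : ℝ) 1)
    (hf : ContDiffOn ℝ 1 (fun y => f y t) (cube d))
    (hg : ContDiffOn ℝ 1 (fun y => g y t) (cube d)) :
    IsC1BoundedOn (cube d) (c1Dist f g).toReal (c1Dist f g).toReal fun y => f y t - g y t :=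
  isC1BoundedOn_of_cNorm_le le_rfl (uniqueDiffOn_cube d) ENNReal.toReal_nonneg (hf.sub hg)
    ((cNorm_le_c1Dist ht).trans (ENNReal.ofReal_toReal hfg).ge)

theorem c1Dist_ne_top {a b a' b' : ℝ}
    (hf : ∀ t ∈ Icc (0 : ℝ) 1, IsC1BoundedOn (cube d) a b fun y => f y t)
    (hg : ∀ t ∈ Icc (0 : ℝ) 1, IsC1BoundedOn (cube d) a' b' fun y => g y t) :
    c1Dist f g ≠ ⊤ :=
  ne_top_of_le_ne_top ENNReal.ofReal_ne_top <| iSup₂_le fun t ht =>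
    ((hf t ht).sub (hg t ht) (uniqueDiffOn_cube d)).cNorm_one_le (uniqueDiffOn_cube d)

end Distance

section Estimate

variable {d k : ℕ} {L₁ L₂ c K b : ℝ} {D : ℝ≥0} {p q : E d → ℝ} {π ρ : Measure (E d)}
  {g : E d → ℝ → E d}

theorem log_sub_log_le {a b m : ℝ} (hm : 0 < m) (ha : m ≤ a) (hb : m ≤ b) :
    Real.log a - Real.log b ≤ m⁻¹ * |a - b| := by
  have hb' := hm.trans_le hb
  rw [← Real.log_div (hm.trans_le ha).ne' hb'.ne']
  calc Real.log (a / b)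
    _ ≤ a / b - 1 := Real.log_le_sub_one_of_pos (div_pos (hm.trans_le ha) hb')
    _ = b⁻¹ * (a - b) := by field_simp
    _ ≤ b⁻¹ * |a - b| := mul_le_mul_of_nonneg_left (le_abs_self _) (inv_pos.2 hb').le
    _ ≤ m⁻¹ * |a - b| := mul_le_mul_of_nonneg_right (inv_anti₀ hm hb) (abs_nonneg _)

theorem abs_log_sub_log_le {a b m : ℝ} (hm : 0 < m) (ha : m ≤ a) (hb : m ≤ b) :
    |Real.log a - Real.log b| ≤ m⁻¹ * |a - b| :=
  abs_sub_le_iff.2 ⟨log_sub_log_le hm ha hb, abs_sub_comm a b ▸ log_sub_log_le hm hb ha⟩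

theorem IsC1Density.abs_log_sub_log_le (hq : IsC1Density L₁ L₂ q) {x y : E d} (hx : x ∈ cube d)
    (hy : y ∈ cube d) : |Real.log (q x) - Real.log (q y)| ≤ L₁ / L₂ * ‖x - y‖ := by
  rw [div_eq_inv_mul, mul_assoc]
  exact (KRFlow.abs_log_sub_log_le hq.pos (hq.ge x hx) (hq.ge y hy)).trans <|
    mul_le_mul_of_nonneg_left (hq.isC1BoundedOn.norm_sub_le (convex_cube d) hx hy)
      (inv_pos.2 hq.pos).le

theorem log_eq_sum_log_stdMatrix_add (hp : IsC1Density L₁ L₂ p) (hq : IsC1Density L₁ L₂ q)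
    (hT : IsTriangular c K (krMap p q)) {x : E d} (hx : x ∈ cube d) :
    Real.log (p x) = ∑ i, Real.log (stdMatrix (fderivWithin ℝ (krMap p q) (cube d) x) i i) +
      Real.log (q (krMap p q x)) := by
  have hdiag : ∀ i ∈ Finset.univ, stdMatrix (fderivWithin ℝ (krMap p q) (cube d) x) i i ≠ 0 :=
    fun i _ => (hT.stdMatrix_pos hx i).ne'
  rw [← prod_stdMatrix_fderivWithin_krMap_mul hp hq hT hx,
    Real.log_mul (Finset.prod_ne_zero_iff.2 hdiag)
      (hq.pos.trans_le (hq.ge _ (hT.mapsTo hx))).ne', Real.log_prod hdiag]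

theorem exists_bounds_krVelocity (d : ℕ) {L₁ L₂ : ℝ} (hL₁ : 0 < L₁) (hL₂ : 0 < L₂) :
    ∃ c K b, ∃ D : ℝ≥0, ∀ p q : E d → ℝ, IsC1Density L₁ L₂ p → IsC1Density L₁ L₂ q →
      IsTriangular c K (krMap p q) ∧ ∀ t ∈ Icc (0 : ℝ) 1,
        IsC1BoundedOn (cube d) d b (fun y => krVelocity p q y t) ∧
        LipschitzOnWith D (fun y => divergence (krVelocity p q) y t) (cube d) := by
  obtain ⟨c, hc, K, hT⟩ := exists_isTriangular_krMap d hL₁ hL₂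
  obtain ⟨A, B, hB⟩ := exists_isC1BoundedOn_stdMatrix_fderivWithin_krMap d L₁ L₂ c K
  obtain ⟨b, hb⟩ := IsTriangular.exists_isC1BoundedOn_straightVelocity d hc K
  obtain ⟨D, hD⟩ :=
    IsTriangular.exists_lipschitzOnWith_divergence_straightVelocity d hc K B.toNNReal
  refine ⟨c, K, b, D, fun p q hp hq => ⟨hT p q hp hq, fun t ht => ⟨hb _ (hT p q hp hq) t ht,
    hD _ (hT p q hp hq) (fun i => ?_) t ht⟩⟩⟩
  exact (hB p q i hp hq (hT p q hp hq)).lipschitzOnWith (convex_cube d)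

theorem pushforward_krVelocity (hπ : RegularDensity k L₁ L₂ π p) (hρ : RegularDensity k L₁ L₂ ρ q)
    (hp : IsC1Density L₁ L₂ p) (hq : IsC1Density L₁ L₂ q) (hT : IsTriangular c K (krMap p q)) :
    pushforward (krVelocity p q) π = ρ := by
  have flowMap_eq : EqOn (fun x => flowMap (krVelocity p q) x 1) (krMap p q) (cube d) :=
    fun x hx => hT.flowMap_straightVelocity hx
  have density_eq : ∀ x ∈ cube d, ENNReal.ofReal (p x) =
      ENNReal.ofReal |(fderivWithin ℝ (krMap p q) (cube d) x).det| *
        ENNReal.ofReal (q (krMap p q x)) := fun x hx => by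
    have hprod := prod_stdMatrix_fderivWithin_krMap_mul hp hq hT hx
    rw [← hT.det_eq hx] at hprod
    rw [← ENNReal.ofReal_mul (abs_nonneg _), ← hprod, abs_of_nonneg]
    rw [hT.det_eq hx]
    exact Finset.prod_nonneg fun i _ => (hT.stdMatrix_pos hx i).le
  have ae_cube : ∀ᵐ x ∂volume.restrict (cube d), x ∈ cube d :=
    ae_restrict_mem (measurableSet_cube d)
  rw [pushforward, hρ.eq_withDensity, hπ.eq_withDensity,
    withDensity_congr_ae (ae_cube.mono density_eq), Measure.map_congr
      ((withDensity_absolutelyContinuous _ _).ae_le (ae_cube.mono flowMap_eq))]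
  exact map_withDensity_abs_det_mul (measurableSet_cube d) (measurableSet_cube d)
    ⟨hT.mapsTo, hT.injOn, hT.surjOn⟩ (fun x hx => hT.hasFDerivWithinAt hx)
    fun y => ENNReal.ofReal (q y)

theorem isProbabilityMeasure_pushforward (hπ : RegularDensity k L₁ L₂ π p)
    (hg : IsTangentField g) : IsProbabilityMeasure (pushforward g π) := by
  have := hπ.isProbabilityMeasure
  refine Measure.isProbabilityMeasure_map ?_
  rw [hπ.eq_withDensity]
  exact (hg.continuousOn_flowMap.aemeasurable (measurableSet_cube d)).mono_ac
    (withDensity_absolutelyContinuous _ _)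

theorem abs_log_sub_log_det_flowMap_mul_le (hp : IsC1Density L₁ L₂ p) (hq : IsC1Density L₁ L₂ q)
    (hT : IsTriangular c K (krMap p q))
    (hb : ∀ t ∈ Icc (0 : ℝ) 1, IsC1BoundedOn (cube d) d b (fun y => krVelocity p q y t))
    (hD : ∀ t ∈ Icc (0 : ℝ) 1,
      LipschitzOnWith D (fun y => divergence (krVelocity p q) y t) (cube d))
    (hg : IsTangentField g) {δ : ℝ} (hfg : ∀ t ∈ Icc (0 : ℝ) 1,
      IsC1BoundedOn (cube d) δ δ fun y => krVelocity p q y t - g y t)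
    {x : E d} (hx : x ∈ cube d) :
    |Real.log (p x) - Real.log (Real.exp (∫ t in (0 : ℝ)..1, divergence g (flowMap g x t) t) *
      q (flowMap g x 1))| ≤ (d + (D + L₁ / L₂) * Real.exp b.toNNReal) * δ := by
  have hy : flowMap g x 1 ∈ cube d := hg.bijOn_flowMap.mapsTo hx
  have hsol := hT.isSolutionIn_interp hx
  have hK := fun t ht => (hb t ht).lipschitzOnWith (convex_cube d)
  have jacobian_le := hg.abs_integral_divergence_flowMap_sub_le
    (fun t ht => (hb t ht).contDiffOn.differentiableOn one_ne_zero) hfg hK hD hx hsol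
    (hT.intervalIntegrable_divergence_straightVelocity_interp hx)
  rw [krVelocity, hT.integral_divergence_straightVelocity_interp hx] at jacobian_le
  have density_le : |Real.log (q (krMap p q x)) - Real.log (q (flowMap g x 1))| ≤
      L₁ / L₂ * (δ * Real.exp b.toNNReal) := by
    refine (hq.abs_log_sub_log_le (hT.mapsTo hx) hy).trans
      (mul_le_mul_of_nonneg_left ?_ (div_pos hp.pos_left hp.pos).le)
    have hgap := hg.norm_flowMap_sub_le hfg hK hx hsol (right_mem_Icc.2 zero_le_one)
    rw [norm_sub_rev]
    simpa [KRFlow.interp] using hgap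
  rw [Real.log_mul (Real.exp_pos _).ne' (hq.pos.trans_le (hq.ge _ hy)).ne', Real.log_exp,
    log_eq_sum_log_stdMatrix_add hp hq hT hx, add_sub_add_comm]
  refine ((abs_add_le _ _).trans (add_le_add jacobian_le density_le)).trans_eq ?_
  ring

theorem klDiv_pushforward_le (hπ : RegularDensity k L₁ L₂ π p) (hρ : RegularDensity k L₁ L₂ ρ q)
    (hp : IsC1Density L₁ L₂ p) (hq : IsC1Density L₁ L₂ q) (hT : IsTriangular c K (krMap p q))
    (hb : ∀ t ∈ Icc (0 : ℝ) 1, IsC1BoundedOn (cube d) d b (fun y => krVelocity p q y t))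
    (hD : ∀ t ∈ Icc (0 : ℝ) 1,
      LipschitzOnWith D (fun y => divergence (krVelocity p q) y t) (cube d))
    (hg : IsTangentField g) {δ : ℝ} (hfg : ∀ t ∈ Icc (0 : ℝ) 1,
      IsC1BoundedOn (cube d) δ δ fun y => krVelocity p q y t - g y t) :
    InformationTheory.klDiv (pushforward g π) ρ ≤
      ENNReal.ofReal (2 * ((d + (D + L₁ / L₂) * Real.exp b.toNNReal) * δ) ^ 2) := by
  have hpush := isProbabilityMeasure_pushforward hπ hg
  have hprob := hρ.isProbabilityMeasure
  choose! Φ' hΦ' hdet using fun x (hx : x ∈ cube d) => hg.exists_hasFDerivWithinAt_flowMap hx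
  have hlog : ∀ x ∈ cube d, |Real.log (p x) - Real.log (|(Φ' x).det| * q (flowMap g x 1))| ≤
      (d + (D + L₁ / L₂) * Real.exp b.toNNReal) * δ := fun x hx => by
    rw [hdet x hx, Real.abs_exp]
    exact abs_log_sub_log_det_flowMap_mul_le hp hq hT hb hD hg hfg hx
  rw [pushforward, hπ.eq_withDensity] at hpush ⊢
  rw [hρ.eq_withDensity] at hprob ⊢
  refine (klDiv_map_withDensity_le_of_hasFDerivWithinAt (measurableSet_cube d)
    (measurableSet_cube d) hg.bijOn_flowMap hΦ' (fun x hx => hdet x hx ▸ (Real.exp_pos _).ne')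
    (fun x hx => hp.pos.trans_le (hp.ge x hx)) (fun x hx => hq.pos.trans_le (hq.ge x hx))
    hlog).trans_eq ?_
  rw [measure_univ, measure_univ, one_add_one_eq_two, mul_comm (2 : ℝ),
    ENNReal.ofReal_mul (sq_nonneg _), ENNReal.ofReal_ofNat]

end Estimate

end KRFlow

theorem mainTheorem9_general (d : ℕ) (L₁ L₂ : ℝ) (hL₁ : 0 < L₁) (hL₂ : 0 < L₂) :
    ∃ C : ℝ≥0, ∀ (k : ℕ) (π ρ : Measure (KRFlow.E d)) (p q : KRFlow.E d → ℝ)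
      (g : KRFlow.E d → ℝ → KRFlow.E d),
      1 ≤ k →
      KRFlow.RegularDensity k L₁ L₂ π p →
      KRFlow.RegularDensity k L₁ L₂ ρ q →
      KRFlow.IsTangentField g →
      (∀ t ∈ Icc (0 : ℝ) 1,
        ContDiffOn ℝ 1 (fun x => KRFlow.krVelocity p q x t) (KRFlow.cube d)) ∧
      KRFlow.c1Dist (KRFlow.krVelocity p q) g ≠ ⊤ ∧
      KRFlow.WellPosed (KRFlow.krVelocity p q) ∧
      KRFlow.WellPosed g ∧
      IsProbabilityMeasure (KRFlow.pushforward (KRFlow.krVelocity p q) π) ∧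
      IsProbabilityMeasure (KRFlow.pushforward g π) ∧
      InformationTheory.klDiv (KRFlow.pushforward g π)
          (KRFlow.pushforward (KRFlow.krVelocity p q) π)
        ≤ (C : ℝ≥0∞) * KRFlow.c1Dist (KRFlow.krVelocity p q) g ^ 2 := by
  obtain ⟨c, K, b, D, hbounds⟩ := KRFlow.exists_bounds_krVelocity d hL₁ hL₂
  set M := d + (D + L₁ / L₂) * Real.exp b.toNNReal
  refine ⟨(2 * M ^ 2).toNNReal, fun k π ρ p q g hk hπ hρ hg => ?_⟩
  have hp := hπ.isC1Density hk hL₁.le hL₂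
  have hq := hρ.isC1Density hk hL₁.le hL₂
  obtain ⟨hT, hf⟩ := hbounds p q hp hq
  obtain ⟨a', b', hg'⟩ := hg.exists_isC1BoundedOn
  have htop : KRFlow.c1Dist (KRFlow.krVelocity p q) g ≠ ⊤ :=
    KRFlow.c1Dist_ne_top (fun t ht => (hf t ht).1) hg'
  have hkl := KRFlow.klDiv_pushforward_le hπ hρ hp hq hT (fun t ht => (hf t ht).1)
    (fun t ht => (hf t ht).2) hg fun t ht =>
      KRFlow.isC1BoundedOn_sub_c1Dist htop ht (hf t ht).1.contDiffOn (hg.contDiffOn ht)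
  rw [KRFlow.pushforward_krVelocity hπ hρ hp hq hT]
  refine ⟨fun t ht => (hf t ht).1.contDiffOn, htop, hT.wellPosed_straightVelocity, hg.wellPosed,
    hρ.isProbabilityMeasure, KRFlow.isProbabilityMeasure_pushforward hπ hg, hkl.trans_eq ?_⟩
  rw [mul_pow, ← mul_assoc, ENNReal.ofReal_mul (by positivity),
    ENNReal.ofReal_pow ENNReal.toReal_nonneg, ENNReal.ofReal_toReal htop, ENNReal.ofReal]

theorem mainTheorem9 (d : ℕ) (L₁ L₂ : ℝ) (hL₁ : 1 < L₁) (hL₂ : 0 < L₂) :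
    ∃ C : ℝ≥0, ∀ (k : ℕ) (π ρ : Measure (KRFlow.E d)) (p q : KRFlow.E d → ℝ) (r : ℝ)
      (g : KRFlow.E d → ℝ → KRFlow.E d),
      2 ≤ k →
      KRFlow.RegularDensity k L₁ L₂ π p →
      KRFlow.RegularDensity k L₁ L₂ ρ q →
      KRFlow.InAnsatz 2 r g →
      -- the objects in the estimate are well defined
      (∀ t ∈ Icc (0 : ℝ) 1,
        ContDiffOn ℝ 1 (fun x => KRFlow.krVelocity p q x t) (KRFlow.cube d)) ∧
      KRFlow.c1Dist (KRFlow.krVelocity p q) g ≠ ⊤ ∧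
      KRFlow.WellPosed (KRFlow.krVelocity p q) ∧
      KRFlow.WellPosed g ∧
      IsProbabilityMeasure (KRFlow.pushforward (KRFlow.krVelocity p q) π) ∧
      IsProbabilityMeasure (KRFlow.pushforward g π) ∧
      -- the estimate
      InformationTheory.klDiv (KRFlow.pushforward g π)
          (KRFlow.pushforward (KRFlow.krVelocity p q) π)
        ≤ (C : ℝ≥0∞) * KRFlow.c1Dist (KRFlow.krVelocity p q) g ^ 2 := by
  obtain ⟨C, hC⟩ := mainTheorem9_general d L₁ L₂ (zero_lt_one.trans hL₁) hL₂
  exact ⟨C, fun k π ρ p q _ g hk hπ hρ hg =>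
    hC k π ρ p q g (one_le_two.trans hk) hπ hρ hg.isTangentField⟩
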